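/- **Setting.** Let $\mathfrak g$ be a finite-dimensional real Lie algebra with a symmetric, $\mathrm{ad}$-invariant, non-degenerate (not necessarily definite) bilinear form $\langle-,-\rangle$, and let $G$ be a Lie group with Lie algebra $\mathfrak g$ such that $\langle-,-\rangle$ is $\mathrm{Ad}(G)$-invariant (automatic if $G$ is connected). Let $X$ be an oriented smooth 3-manifold (Hausdorff, $\sigma$-compact), and let $P$ be a principal $G$-bundle on $X$, given by smooth transition functions $g_{ij}\colon U_i\cap U_j\to G$, $g_{ij}g_{jk}=g_{ik}$, on an open cover $\{U_i\}$. Forms $\omega\in\Omega^k(-;\mathfrak g_P)$ with values in the adjoint bundle are families of $\mathfrak g$-valued forms with $\omega_i=\mathrm{Ad}_{g_{ij}}\omega_j$; connections are families of $\mathfrak g$-valued 1-forms with $A_j=\mathrm{Ad}_{g_{ij}^{-1}}A_i+g_{ij}^{-1}dg_{ij}$. Put $d_A\omega=d\omega+[A\wedge\omega]$ and $F_A=dA+\tfrac12[A\wedge A]$. Let $\Sigma$ be a closed oriented surface (not necessarily connected), embedded in $X$ as $\Sigma\times\{0\}$ by means of a tubular neighbourhood $\kappa\colon\Sigma\times\mathbb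 R\hookrightarrow X$, and let $\widehat\Sigma=\kappa(\Sigma\times[0,\infty))$ be its exterior component, such that $\partial\widehat\Sigma=\Sigma$ as oriented manifolds. The phase space over $\widehat\Sigma$ (Yang–Mills theory in temporal gauge) is the set of pairs $(A,E)$ of a connection $A$ on $P|_{\widehat\Sigma}$ and a 2-form $E\in\Omega^2(\widehat\Sigma;\mathfrak g_P)$. A function $F$ on it is differentiable at $(A,E)$, with differential $(\delta_AF,\tfrac{\delta F}{\delta E})$, if $\delta_AF$ is a linear functional on $\Omega^1(\widehat\Sigma;\mathfrak g_P)$ and $\tfrac{\delta F}{\delta E}\in\Omega^1(\widehat\Sigma;\mathfrak g_P)$ is compactly supported, with $\tfrac{d}{dt}\big|_{0}F(A+ta,E+te)=\delta_AF(a)+\int_{\widehat\Sigma}\langle\tfrac{\delta F}{\delta E}\wedge e\rangle$ for all $a,e$. The canonical Poisson bracket, i.e. the one with $\{\int_{\widehat\Sigma}\langle\omega\wedge E\rangle,A\}=\omega$, is $$\{F,F'\}=\delta_AF'\big(\tfrac{\delta F}{\delta E}\big)-\delta_AF\big(\tfrac{\delta F'}{\delta E}\big).$$ The Gauss law is $d_AE=0$.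 For $\alpha,\beta\in\Omega^0(\widehat\Sigma;\mathfrak g_P)_{\rm cpt}$ (compact support in $\widehat\Sigma$), with pointwise bracket, the regularized fluxes are $$\widehat\Phi_E^\alpha=\int_{\widehat\Sigma}\langle d_A\alpha\wedge E\rangle,\qquad \widehat\Phi_B^\beta=\int_{\widehat\Sigma}\langle d_A\beta\wedge F_A\rangle,$$ and for sections $a,b$ of the adjoint bundle over $\Sigma$ the fluxes are $\Phi_E^a=\int_\Sigma\langle a,E\rangle$ and $\Phi_B^b=\int_\Sigma\langle b,F_A\rangle$. For $\hbar>0$ let $\mathfrak g_\hbar$ be $\mathfrak g$ with the bracket $\hbar[-,-]$, let $\mathfrak g_0$ be its underlying abelian Lie algebra, and let $\mathfrak g_\hbar\ltimes_{\rm ad}\mathfrak g_0$ be the semidirect product for the adjoint action $x\cdot y=\hbar[x,y]$. Spaces $C^\infty(\Sigma,-)$ carry the pointwise bracket and the Fréchet topology of uniform convergence of all derivatives in charts on compact sets. **Theorem 1 (Phase space of Yang–Mills fluxes).** 1. The fields $(A,E)$ on all of $X$ restrict to points of the phase space over $\widehat\Sigma$, with the restricted curvature, and the Gauss law on $X$ implies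 the one on $\widehat\Sigma$. 2. For all $\alpha,\beta\in\Omega^0(\widehat\Sigma;\mathfrak g_P)_{\rm cpt}$, also $[\alpha,\beta]\in\Omega^0(\widehat\Sigma;\mathfrak g_P)_{\rm cpt}$, and at every point of the phase space $$\{\widehat\Phi_E^\alpha,\widehat\Phi_E^\beta\}=\widehat\Phi_E^{[\alpha,\beta]},\qquad \{\widehat\Phi_E^\alpha,\widehat\Phi_B^\beta\}=\widehat\Phi_B^{[\alpha,\beta]},\qquad \{\widehat\Phi_B^\alpha,\widehat\Phi_B^\beta\}=0 .$$ 3. $\widehat\Phi_B^\beta=\Phi_B^{\beta|_\Sigma}$ everywhere, and $\widehat\Phi_E^\alpha=\Phi_E^{\alpha|_\Sigma}$ wherever the Gauss law holds. 4. Every smooth section of the adjoint bundle over $\Sigma$ is the restriction of some element of $\Omega^0(\widehat\Sigma;\mathfrak g_P)_{\rm cpt}$. 5. Let $\hbar>0$ and let $\tau$ be a trivialization of $P|_\Sigma$, so that $x=(x_E,x_B)\in L_\hbar:=C^\infty(\Sigma,\mathfrak g_\hbar\ltimes_{\rm ad}\mathfrak g_0)$ gives smooth sections $\tau x_E,\tau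 x_B$ of the adjoint bundle over $\Sigma$. At every point of the phase space where the Gauss law holds, $\mu(x)=\hbar(\Phi_E^{\tau x_E}+\Phi_B^{\tau x_B})$ is a continuous linear functional of $x\in L_\hbar$, and the linear flux observables satisfy the Lie–Poisson brackets of $L_\hbar$: whenever $\alpha,\beta,\alpha',\beta'\in\Omega^0(\widehat\Sigma;\mathfrak g_P)_{\rm cpt}$ restrict on $\Sigma$ to $\tau x_E,\tau x_B,\tau x'_E,\tau x'_B$, respectively, $$\big\{\hbar(\widehat\Phi_E^{\alpha}+\widehat\Phi_B^{\beta}),\,\hbar(\widehat\Phi_E^{\alpha'}+\widehat\Phi_B^{\beta'})\big\}=\mu([x,x']).$$ 6. For every $\hbar>0$ there is an isomorphism of topological Lie algebras $C^\infty(\Sigma,\mathfrak g_\hbar\ltimes_{\rm ad}\mathfrak g_0)\simeq C^\infty(\Sigma,\mathfrak g_\hbar)\ltimes_{\rm ad}C^\infty(\Sigma,\mathfrak g_0)$, given by taking components; the first factor is the electric, the second the magnetic part. -/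

import Mathlib

open scoped Manifold ContDiff Topology
open Set

noncomputable section

namespace YMFlux

/-! ### Lie algebras on normed spaces -/

/-- A Lie ring whose underlying additive group carries a norm (no compatibility with the bracket is
asked for: the norm only serves to do calculus, and in finite dimension its choice is immaterial). -/
class NormedLieRing (L : Type*) extends NormedAddCommGroup L, LieRing L

/-- A real Lie algebra on a real normed space. -/
class NormedLieAlg (L : Type*) [NormedLieRing L] extends NormedSpace ℝ L, LieAlgebra ℝ L

/-- `𝔤_ħ`: the Lie algebra `𝔤` with its bracket rescaled by `ħ`. -/
@[nolint unusedArguments]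
def Rescaled (_ħ : ℝ) (𝔤 : Type*) : Type _ := 𝔤

/-- `𝔤_0`: the underlying vector space of `𝔤` as an abelian Lie algebra. -/
def Abelian (𝔤 : Type*) : Type _ := 𝔤

section LieAlgebras

variable {ħ : ℝ} {𝔤 : Type*} [NormedLieRing 𝔤] [NormedLieAlg 𝔤]

/-- The element of `𝔤` underlying an element of `𝔤_ħ`. -/
def Rescaled.out (x : Rescaled ħ 𝔤) : 𝔤 := x

/-- The element of `𝔤` underlying an element of `𝔤_0`. -/
def Abelian.out (x : Abelian 𝔤) : 𝔤 := x

instance : NormedAddCommGroup (Rescaled ħ 𝔤) := inferInstanceAs (NormedAddCommGroup 𝔤)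

instance : NormedLieRing (Rescaled ħ 𝔤) where
  bracket x y := ħ • ⁅x.out, y.out⁆
  add_lie x y z := by
    change ħ • ⁅x.out + y.out, z.out⁆ = ħ • ⁅x.out, z.out⁆ + ħ • ⁅y.out, z.out⁆
    rw [add_lie, smul_add]
  lie_add x y z := by
    change ħ • ⁅x.out, y.out + z.out⁆ = ħ • ⁅x.out, y.out⁆ + ħ • ⁅x.out, z.out⁆
    rw [lie_add, smul_add]
  lie_self x := by
    change ħ • ⁅x.out, x.out⁆ = 0
    rw [lie_self, smul_zero]
  leibniz_lie x y z := by
    change ħ • ⁅x.out, ħ • ⁅y.out, z.out⁆⁆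
      = ħ • ⁅ħ • ⁅x.out, y.out⁆, z.out⁆ + ħ • ⁅y.out, ħ • ⁅x.out, z.out⁆⁆
    rw [lie_smul, smul_lie, lie_smul, ← smul_add, ← smul_add, ← leibniz_lie]

instance : NormedSpace ℝ (Rescaled ħ 𝔤) := inferInstanceAs (NormedSpace ℝ 𝔤)

instance : NormedLieAlg (Rescaled ħ 𝔤) where
  lie_smul t x y := by
    change ħ • ⁅x.out, t • y.out⁆ = t • ħ • ⁅x.out, y.out⁆
    rw [lie_smul, smul_comm]

instance [FiniteDimensional ℝ 𝔤] : FiniteDimensional ℝ (Rescaled ħ 𝔤) :=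
  inferInstanceAs (FiniteDimensional ℝ 𝔤)

instance : NormedAddCommGroup (Abelian 𝔤) := inferInstanceAs (NormedAddCommGroup 𝔤)

instance : NormedLieRing (Abelian 𝔤) where
  bracket _ _ := 0
  add_lie _ _ _ := by change (0 : Abelian 𝔤) = 0 + 0; simp
  lie_add _ _ _ := by change (0 : Abelian 𝔤) = 0 + 0; simp
  lie_self _ := rfl
  leibniz_lie _ _ _ := by change (0 : Abelian 𝔤) = 0 + 0; simp

instance : NormedSpace ℝ (Abelian 𝔤) := inferInstanceAs (NormedSpace ℝ 𝔤)

instance : NormedLieAlg (Abelian 𝔤) where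
  lie_smul t _ _ := (smul_zero t).symm

instance [FiniteDimensional ℝ 𝔤] : FiniteDimensional ℝ (Abelian 𝔤) :=
  inferInstanceAs (FiniteDimensional ℝ 𝔤)

variable (ħ 𝔤) in
/-- The adjoint action of `𝔤_ħ` on `𝔤_0`: `x` acts as the bracket `ħ [x, ·]` of `𝔤_ħ`. -/
def adAction : Rescaled ħ 𝔤 →ₗ⁅ℝ⁆ LieDerivation ℝ (Abelian 𝔤) (Abelian 𝔤) where
  toFun x :=
    { toFun := fun y => ħ • ⁅x.out, y.out⁆
      map_add' := fun y z => by
        change ħ • ⁅x.out, y.out + z.out⁆ = ħ • ⁅x.out, y.out⁆ + ħ • ⁅x.out, z.out⁆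
        rw [lie_add, smul_add]
      map_smul' := fun t y => by
        change ħ • ⁅x.out, t • y.out⁆ = t • ħ • ⁅x.out, y.out⁆
        rw [lie_smul, smul_comm]
      leibniz' := fun y z => by
        change ħ • ⁅x.out, (0 : 𝔤)⁆ = (0 : 𝔤) - (0 : 𝔤)
        simp }
  map_add' x y := by
    ext z
    change ħ • ⁅x.out + y.out, z.out⁆ = ħ • ⁅x.out, z.out⁆ + ħ • ⁅y.out, z.out⁆
    rw [add_lie, smul_add]
  map_smul' t x := by
    ext z
    change ħ • ⁅t • x.out, z.out⁆ = t • ħ • ⁅x.out, z.out⁆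
    rw [smul_lie, smul_comm]
  map_lie' {x y} := by
    ext z
    rw [LieDerivation.lie_apply]
    change ħ • ⁅ħ • ⁅x.out, y.out⁆, z.out⁆
      = ħ • ⁅x.out, ħ • ⁅y.out, z.out⁆⁆ - ħ • ⁅y.out, ħ • ⁅x.out, z.out⁆⁆
    rw [smul_lie, lie_smul, lie_smul, ← smul_sub, ← smul_sub, lie_lie]

variable (ħ 𝔤) in
/-- The semidirect product `𝔤_ħ ⋉_ad 𝔤_0`; the component `right` is the one in `𝔤_ħ` (electric),
the component `left` is the one in the abelian ideal `𝔤_0` (magnetic). -/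
abbrev FluxAlg : Type _ := Abelian 𝔤 ⋊⁅adAction ħ 𝔤⁆ Rescaled ħ 𝔤

instance : NormedAddCommGroup (FluxAlg ħ 𝔤) :=
  NormedAddCommGroup.induced (FluxAlg ħ 𝔤) (Abelian 𝔤 × Rescaled ħ 𝔤)
    (LieAlgebra.SemiDirectSum.toProdl (adAction ħ 𝔤))
    (LieAlgebra.SemiDirectSum.toProdl (adAction ħ 𝔤)).injective

instance : NormedLieRing (FluxAlg ħ 𝔤) where
  add_lie := add_lie
  lie_add := lie_add
  lie_self := lie_self
  leibniz_lie := leibniz_lie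

instance : NormedSpace ℝ (FluxAlg ħ 𝔤) :=
  NormedSpace.induced ℝ (FluxAlg ħ 𝔤) (Abelian 𝔤 × Rescaled ħ 𝔤)
    (LieAlgebra.SemiDirectSum.toProdl (adAction ħ 𝔤))

instance : NormedLieAlg (FluxAlg ħ 𝔤) where
  lie_smul := lie_smul

instance [FiniteDimensional ℝ 𝔤] : FiniteDimensional ℝ (FluxAlg ħ 𝔤) :=
  (LieAlgebra.SemiDirectSum.toProdl (adAction ħ 𝔤)).symm.finiteDimensional

end LieAlgebras

/-- The bracket of a finite-dimensional Lie algebra as a continuous bilinear map. -/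
def lieL (L : Type*) [NormedLieRing L] [NormedLieAlg L] [FiniteDimensional ℝ L] :
    L →L[ℝ] L →L[ℝ] L :=
  LinearMap.toContinuousBilinearMap (LieModule.toEnd ℝ L L : L →ₗ[ℝ] L →ₗ[ℝ] L)

/-- `ℝⁿ`. -/
abbrev 𝔼 (n : ℕ) : Type := EuclideanSpace ℝ (Fin n)

/-! ### The Fréchet Lie algebra of smooth maps -/

section SmoothMaps

variable (S : Type*) [TopologicalSpace S] [ChartedSpace (𝔼 2) S]
  (L : Type*) [NormedLieRing L] [NormedLieAlg L] [FiniteDimensional ℝ L]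

/-- The smooth maps among all maps `S → L`. -/
def smoothSubmodule : Submodule ℝ (S → L) where
  carrier := {f | ContMDiff (𝓡 2) 𝓘(ℝ, L) ∞ f}
  add_mem' hf hg := hf.add hg
  zero_mem' := contMDiff_const
  smul_mem' c f hf := by
    have h : ContMDiff (𝓡 2) 𝓘(ℝ, L) ∞ f := hf
    exact (contDiff_const_smul (n := ∞) c).contMDiff.comp h

/-- `C^∞(S, L)`. -/
def SmoothMaps : Type _ := smoothSubmodule S L

instance : AddCommGroup (SmoothMaps S L) := inferInstanceAs (AddCommGroup (smoothSubmodule S L))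

instance : Module ℝ (SmoothMaps S L) := inferInstanceAs (Module ℝ (smoothSubmodule S L))

/-- The pointwise Lie bracket on `C^∞(S, L)`. -/
instance : LieRing (SmoothMaps S L) where
  bracket f g := ⟨fun s => ⁅f.1 s, g.1 s⁆, by
    change ContMDiff (𝓡 2) 𝓘(ℝ, L) ∞ (fun s => lieL L (f.1 s) (g.1 s))
    exact (contMDiff_const.clm_apply f.2).clm_apply g.2⟩
  add_lie f g h := Subtype.ext (funext fun s => add_lie (f.1 s) (g.1 s) (h.1 s))
  lie_add f g h := Subtype.ext (funext fun s => lie_add (f.1 s) (g.1 s) (h.1 s))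
  lie_self f := Subtype.ext (funext fun s => lie_self (f.1 s))
  leibniz_lie f g h := Subtype.ext (funext fun s => leibniz_lie (f.1 s) (g.1 s) (h.1 s))

instance : LieAlgebra ℝ (SmoothMaps S L) where
  lie_smul t f g := Subtype.ext (funext fun s => lie_smul t (f.1 s) (g.1 s))

/-- The `C^∞` (Fréchet) topology: uniform convergence of all derivatives, in all charts, on compact
sets. -/
instance : TopologicalSpace (SmoothMaps S L) :=
  ⨅ (c : S) (k : ℕ), TopologicalSpace.induced
    (fun f : SmoothMaps S L =>
      UniformOnFun.ofFun {K : Set (𝔼 2) | IsCompact K ∧ K ⊆ (extChartAt (𝓡 2) c).target}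
        (iteratedFDeriv ℝ k (f.1 ∘ (extChartAt (𝓡 2) c).symm)))
    (UniformOnFun.topologicalSpace (𝔼 2) (𝔼 2 [×k]→L[ℝ] L)
      {K : Set (𝔼 2) | IsCompact K ∧ K ⊆ (extChartAt (𝓡 2) c).target})

variable (ħ : ℝ) (𝔤 : Type*) [NormedLieRing 𝔤] [NormedLieAlg 𝔤] [FiniteDimensional ℝ 𝔤]

/-- The adjoint action of `C^∞(S, 𝔤_ħ)` on `C^∞(S, 𝔤_0)`, pointwise. -/
def adActionMaps : SmoothMaps S (Rescaled ħ 𝔤) →ₗ⁅ℝ⁆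
    LieDerivation ℝ (SmoothMaps S (Abelian 𝔤)) (SmoothMaps S (Abelian 𝔤)) where
  toFun f :=
    { toFun := fun k => ⟨fun s => adAction ħ 𝔤 (f.1 s) (k.1 s), by
        change ContMDiff (𝓡 2) 𝓘(ℝ, 𝔤) ∞ (fun s => ħ • lieL 𝔤 (f.1 s).out (k.1 s).out)
        have hf : ContMDiff (𝓡 2) 𝓘(ℝ, 𝔤) ∞ (fun s => (f.1 s).out) := f.2
        have hk : ContMDiff (𝓡 2) 𝓘(ℝ, 𝔤) ∞ (fun s => (k.1 s).out) := k.2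
        exact (contDiff_const_smul (n := ∞) ħ).contMDiff.comp
          ((contMDiff_const.clm_apply hf).clm_apply hk)⟩
      map_add' := fun k l => Subtype.ext (funext fun s =>
        map_add (adAction ħ 𝔤 (f.1 s)) (k.1 s) (l.1 s))
      map_smul' := fun t k => Subtype.ext (funext fun s =>
        map_smul (adAction ħ 𝔤 (f.1 s)) t (k.1 s))
      leibniz' := fun k l => Subtype.ext (funext fun s =>
        (adAction ħ 𝔤 (f.1 s)).apply_lie_eq_sub (k.1 s) (l.1 s)) }
  map_add' f g := by
    ext k
    refine Subtype.ext (funext fun s => ?_)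
    exact congrArg (fun D => D (k.1 s)) (map_add (adAction ħ 𝔤) (f.1 s) (g.1 s))
  map_smul' t f := by
    ext k
    refine Subtype.ext (funext fun s => ?_)
    exact congrArg (fun D => D (k.1 s)) (map_smul (adAction ħ 𝔤) t (f.1 s))
  map_lie' {f g} := by
    ext k
    refine Subtype.ext (funext fun s => ?_)
    have h := congrArg (fun D => D (k.1 s)) (LieHom.map_lie (adAction ħ 𝔤) (f.1 s) (g.1 s))
    rw [LieDerivation.lie_apply]
    exact h.trans (LieDerivation.lie_apply _ _ _)

/-- The semidirect product `C^∞(S, 𝔤_ħ) ⋉_ad C^∞(S, 𝔤_0)`, with the product topology. -/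
abbrev SemidirectMaps : Type _ :=
  SmoothMaps S (Abelian 𝔤) ⋊⁅adActionMaps S ħ 𝔤⁆ SmoothMaps S (Rescaled ħ 𝔤)

instance : TopologicalSpace (SemidirectMaps S ħ 𝔤) :=
  TopologicalSpace.induced (LieAlgebra.SemiDirectSum.toProd (ψ := adActionMaps S ħ 𝔤)) inferInstance

end SmoothMaps

/-! ### Differential forms on manifolds -/

section Forms

variable {n k : ℕ} {M : Type*} [TopologicalSpace M] [ChartedSpace (𝔼 n) M]
  [IsManifold (𝓡 n) ∞ M]
  {V W Z : Type*} [NormedAddCommGroup V] [NormedSpace ℝ V]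
  [NormedAddCommGroup W] [NormedSpace ℝ W] [NormedAddCommGroup Z] [NormedSpace ℝ Z]

/-- `k`-forms (not necessarily smooth) with values in `V` on an `n`-manifold `M`: the value at `x`
is an alternating form on `T_x M`, which is the type `𝔼 n`, through the preferred chart at `x`. -/
abbrev DForm (n k : ℕ) (M V : Type*) [NormedAddCommGroup V] [NormedSpace ℝ V] : Type _ :=
  M → (𝔼 n) [⋀^Fin k]→L[ℝ] V

/-- The expression of a form in the preferred chart at `c`, as a form on the target of that
chart. -/
def inChart (c : M) (ξ : DForm n k M V) : 𝔼 n → (𝔼 n) [⋀^Fin k]→L[ℝ] V := fun y =>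
  (ξ ((extChartAt (𝓡 n) c).symm y)).compContinuousLinearMap
    (tangentCoordChange (𝓡 n) c ((extChartAt (𝓡 n) c).symm y) ((extChartAt (𝓡 n) c).symm y))

/-- The part of the target of the preferred chart at `c` that corresponds to `S`. -/
def chartPart (c : M) (S : Set M) : Set (𝔼 n) :=
  (extChartAt (𝓡 n) c).target ∩ (extChartAt (𝓡 n) c).symm ⁻¹' S

/-- The form `ξ` is smooth on `S` (up to the boundary, if `S` is a domain with boundary). -/
def SmoothFormOn (S : Set M) (ξ : DForm n k M V) : Prop :=
  ∀ c : M, ContDiffOn ℝ ∞ (inChart c ξ) (chartPart c S)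

/-- The exterior derivative of the restriction of `ξ` to `S`, at the points of `S`. -/
def extD (S : Set M) (ξ : DForm n k M V) : DForm n (k + 1) M V := fun x =>
  extDerivWithin (inChart x ξ) (chartPart x S) (extChartAt (𝓡 n) x x)

/-- The wedge product of a `1`-form and a `k`-form, with the coefficients multiplied by `B`:
`(ξ ∧ η)(v₀, …, v_k) = ∑ᵢ (-1)ⁱ B (ξ vᵢ) (η (v₀, …, v̂ᵢ, …, v_k))`. -/
def wedge (B : V →L[ℝ] W →L[ℝ] Z) (ξ : (𝔼 n) [⋀^Fin 1]→L[ℝ] V) (η : (𝔼 n) [⋀^Fin k]→L[ℝ] W) :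
    (𝔼 n) [⋀^Fin (k + 1)]→L[ℝ] Z :=
  ContinuousAlternatingMap.alternatizeUncurryFin
    (((ContinuousLinearMap.compContinuousAlternatingMapCLM (𝕜 := ℝ) (E := 𝔼 n) (F := W) (G := Z)
        (ι := Fin k)).flip η).comp
      (B.comp ((ContinuousAlternatingMap.ofSubsingleton ℝ (𝔼 n) V (0 : Fin 1)).symm ξ)))

/-- A function as a `0`-form. -/
def zeroForm (f : M → V) : DForm n 0 M V := fun x =>
  ContinuousAlternatingMap.constOfIsEmpty ℝ (𝔼 n) (Fin 0) (f x)

lemma inChart_add (c : M) (ξ η : DForm n k M V) :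
    inChart c (ξ + η) = inChart c ξ + inChart c η := rfl

lemma inChart_smul (c : M) (t : ℝ) (ξ : DForm n k M V) :
    inChart c (t • ξ) = t • inChart c ξ := rfl

lemma SmoothFormOn.add {S : Set M} {ξ η : DForm n k M V} (h : SmoothFormOn S ξ)
    (h' : SmoothFormOn S η) : SmoothFormOn S (ξ + η) := fun c => by
  rw [inChart_add]; exact (h c).add (h' c)

lemma SmoothFormOn.smul {S : Set M} {ξ : DForm n k M V} (t : ℝ) (h : SmoothFormOn S ξ) :
    SmoothFormOn S (t • ξ) := fun c => by
  rw [inChart_smul]; exact (h c).const_smul t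

lemma SmoothFormOn.zero (S : Set M) : SmoothFormOn S (0 : DForm n k M V) := fun c => by
  have h : inChart c (0 : DForm n k M V) = fun _ => 0 := rfl
  rw [h]; exact contDiffOn_const

end Forms

/-! ### Orientations and integration -/

/-- An orientation of the manifold `M`: for each `x` a sign, which says whether the preferred chart
at `x` preserves (`1`) or reverses (`-1`) orientation at `x`; the signs at nearby points are
required to be consistent. -/
structure MOrientation (n : ℕ) (M : Type*) [TopologicalSpace M] [ChartedSpace (𝔼 n) M]
    [IsManifold (𝓡 n) ∞ M] where
  sgn : M → ℝ
  sgn_eq : ∀ x, sgn x = 1 ∨ sgn x = -1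
  consistent : ∀ c, ∀ᶠ x in 𝓝 c, 0 < sgn c * sgn x * (tangentCoordChange (𝓡 n) c x x).det

namespace MOrientation

variable {n : ℕ} {M : Type*} [TopologicalSpace M] [ChartedSpace (𝔼 n) M]
  [IsManifold (𝓡 n) ∞ M]

/-- The frame `v` of `T_x M` is positively oriented. -/
def Positive (o : MOrientation n M) (x : M) (v : Fin n → 𝔼 n) : Prop :=
  0 < o.sgn x * (EuclideanSpace.basisFun (Fin n) ℝ).toBasis.det v

/-- The sign of the preferred chart at `c`, at a point `x` of its domain. -/
def chartSign (o : MOrientation n M) (c x : M) : ℝ :=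
  o.sgn x * Real.sign (tangentCoordChange (𝓡 n) c x x).det

/-- The integral of an `n`-form over the oriented `n`-manifold `M`, through a smooth partition of
unity subordinate to the chart domains. -/
def integral [T2Space M] [SigmaCompactSpace M] (o : MOrientation n M) (η : DForm n n M ℝ) : ℝ :=
  ∑ᶠ c : M, ∫ y in (extChartAt (𝓡 n) c).target,
    (SmoothPartitionOfUnity.exists_isSubordinate_chartAt_source (𝓡 n) M).choose c
        ((extChartAt (𝓡 n) c).symm y)
      * o.chartSign c ((extChartAt (𝓡 n) c).symm y)
      * inChart c η y (fun i => EuclideanSpace.single i 1)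

end MOrientation

/-! ### Gauge sectors, twisted forms, connections -/

/-- An invariant metric on a Lie algebra: a symmetric, `ad`-invariant, non-degenerate (not
necessarily definite) bilinear form. -/
structure LieMetric (𝔤 : Type*) [NormedLieRing 𝔤] [NormedLieAlg 𝔤] where
  form : LinearMap.BilinForm ℝ 𝔤
  symm : ∀ x y, form x y = form y x
  nondegenerate : form.Nondegenerate
  invariant : ∀ x y z, form ⁅x, y⁆ z = form x ⁅y, z⁆

/-- The pairing as a continuous bilinear map. -/
def LieMetric.toL {𝔤 : Type*} [NormedLieRing 𝔤] [NormedLieAlg 𝔤] [FiniteDimensional ℝ 𝔤]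
    (B : LieMetric 𝔤) : 𝔤 →L[ℝ] 𝔤 →L[ℝ] ℝ :=
  LinearMap.toContinuousBilinearMap B.form

instance {d : ℕ} {G : Type*} [TopologicalSpace G] [ChartedSpace (𝔼 d) G] [Group G]
    [LieGroup (𝓡 d) ∞ G] : LieGroup (𝓡 d) (minSmoothness ℝ 3) G := by
  rw [minSmoothness_of_isRCLikeNormedField]
  infer_instance

/-- A topological sector of gauge theory on the `3`-manifold `X` with structure group a Lie group
`G` whose Lie algebra is (identified with) `𝔤`: a principal `G`-bundle, given by transition
functions on an open cover. -/
structure Sector (ι X : Type*) [TopologicalSpace X] [ChartedSpace (𝔼 3) X]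
    (d : ℕ) (G : Type*) [TopologicalSpace G] [ChartedSpace (𝔼 d) G] [Group G]
    [LieGroup (𝓡 d) ∞ G] (𝔤 : Type*) [NormedLieRing 𝔤] [NormedLieAlg 𝔤] where
  lieIso : GroupLieAlgebra (𝓡 d) G ≃ₗ⁅ℝ⁆ 𝔤
  U : ι → Set X
  isOpen : ∀ i, IsOpen (U i)
  cover : ∀ x, ∃ i, x ∈ U i
  g : ι → ι → X → G
  smooth : ∀ i j, ContMDiffOn (𝓡 3) (𝓡 d) ∞ (g i j) (U i ∩ U j)
  cocycle : ∀ i j k, ∀ x ∈ U i ∩ U j ∩ U k, g i j x * g j k x = g i k x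

namespace Sector

variable {ι X : Type*} [TopologicalSpace X] [ChartedSpace (𝔼 3) X] [IsManifold (𝓡 3) ∞ X]
  {d : ℕ} {G : Type*} [TopologicalSpace G] [ChartedSpace (𝔼 d) G] [Group G]
  [LieGroup (𝓡 d) ∞ G] {𝔤 : Type*} [NormedLieRing 𝔤] [NormedLieAlg 𝔤] [FiniteDimensional ℝ 𝔤]
  (P : Sector ι X d G 𝔤)

/-- The adjoint action of `G` on `𝔤`: the derivative at `1` of the conjugation by `g`. -/
def Ad (g : G) : 𝔤 →L[ℝ] 𝔤 :=
  LinearMap.toContinuousLinearMap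
    (P.lieIso.toLinearEquiv.toLinearMap ∘ₗ
      (show GroupLieAlgebra (𝓡 d) G →ₗ[ℝ] GroupLieAlgebra (𝓡 d) G from
        (mfderiv (𝓡 d) (𝓡 d) (fun x : G => g * x * g⁻¹) 1).toLinearMap) ∘ₗ
      P.lieIso.toLinearEquiv.symm.toLinearMap)

/-- The pullback `u⁻¹ du` of the Maurer-Cartan form along `u : X → G`, at the point `x`: it maps the
tangent vector `v` to the image of `du(v)` under left translation to `1`. -/
def maurerCartan (u : X → G) (x : X) : 𝔼 3 →L[ℝ] 𝔤 :=
  LinearMap.toContinuousLinearMap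
    (P.lieIso.toLinearEquiv.toLinearMap ∘ₗ
      (show 𝔼 3 →ₗ[ℝ] GroupLieAlgebra (𝓡 d) G from
        (mfderiv (𝓡 3) (𝓡 d) (fun y : X => (u x)⁻¹ * u y) x).toLinearMap))

/-- The local representatives `ξ_i` of a form with values in the adjoint bundle, over `S`:
`ξ_i = Ad_{g_ij} ξ_j` on overlaps. The representatives are extended by `0`, so that two forms are
equal if they agree on `S`. For open `S`, or for a domain `S` with smooth boundary, these are the
elements of `Ω^k(S; 𝔤_P)`. -/
def forms (S : Set X) (k : ℕ) : Submodule ℝ (ι → DForm 3 k X 𝔤) where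
  carrier := {ξ | (∀ i, SmoothFormOn (P.U i ∩ S) (ξ i)) ∧ (∀ i, ∀ x ∉ P.U i ∩ S, ξ i x = 0) ∧
    ∀ i j, ∀ x ∈ P.U i ∩ P.U j ∩ S,
      ξ i x = (P.Ad (P.g i j x)).compContinuousAlternatingMap (ξ j x)}
  add_mem' := by
    rintro ξ η ⟨h1, h2, h3⟩ ⟨h1', h2', h3'⟩
    refine ⟨fun i => (h1 i).add (h1' i), fun i x hx => ?_, fun i j x hx => ?_⟩
    · change ξ i x + η i x = 0
      rw [h2 i x hx, h2' i x hx, add_zero]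
    · change ξ i x + η i x = _
      rw [h3 i j x hx, h3' i j x hx]
      ext v
      simp
  zero_mem' := by
    refine ⟨fun i => SmoothFormOn.zero _, fun i x hx => rfl, fun i j x hx => ?_⟩
    ext v
    simp
  smul_mem' := by
    rintro t ξ ⟨h1, h2, h3⟩
    refine ⟨fun i => (h1 i).smul t, fun i x hx => ?_, fun i j x hx => ?_⟩
    · change t • ξ i x = 0
      rw [h2 i x hx, smul_zero]
    · change t • ξ i x = _
      rw [h3 i j x hx]
      ext v
      simp

/-- The forms in `Ω^k(S; 𝔤_P)` that have compact support in `S`. -/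
def formsCpt (S : Set X) (k : ℕ) : Set (ι → DForm 3 k X 𝔤) :=
  {ξ | ξ ∈ P.forms S k ∧ ∃ K ⊆ S, IsCompact K ∧ ∀ i, ∀ x ∉ K, ξ i x = 0}

/-- The gauge potentials over `S` (principal connections on `P`): families of local `1`-forms with
`A_j = Ad_{g_ij⁻¹} A_i + g_ij⁻¹ dg_ij` on overlaps, extended by `0`. -/
def IsConnection (S : Set X) (A : ι → DForm 3 1 X 𝔤) : Prop :=
  (∀ i, SmoothFormOn (P.U i ∩ S) (A i)) ∧ (∀ i, ∀ x ∉ P.U i ∩ S, A i x = 0) ∧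
    ∀ i j, ∀ x ∈ P.U i ∩ P.U j ∩ S,
      A j x = (P.Ad (P.g i j x)⁻¹).compContinuousAlternatingMap (A i x)
        + ContinuousAlternatingMap.ofSubsingleton ℝ (𝔼 3) 𝔤 (0 : Fin 1)
            (P.maurerCartan (P.g i j) x)

/-- The covariant derivative `d_A ξ = d ξ + [A ∧ ξ]`, over `S`. -/
def dCov {k : ℕ} (_P : Sector ι X d G 𝔤) (S : Set X) (A : ι → DForm 3 1 X 𝔤)
    (ξ : ι → DForm 3 k X 𝔤) : ι → DForm 3 (k + 1) X 𝔤 := fun i x =>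
  extD S (ξ i) x + wedge (lieL 𝔤) (A i x) (ξ i x)

/-- The curvature `F_A = d A + ½ [A ∧ A]`, over `S`. -/
def curv (_P : Sector ι X d G 𝔤) (S : Set X) (A : ι → DForm 3 1 X 𝔤) : ι → DForm 3 2 X 𝔤 :=
  fun i x => extD S (A i) x + (1 / 2 : ℝ) • wedge (lieL 𝔤) (A i x) (A i x)

/-- A set of the cover that contains `x`. -/
def idx (x : X) : ι := (P.cover x).choose

/-- `∫_S ⟨ξ ∧ η⟩` for a `1`-form `ξ` and a `2`-form `η` with values in the adjoint bundle. The form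
`⟨ξ ∧ η⟩` is evaluated at `x` in any of the local representations around `x`. -/
def pairIntegral [T2Space X] [SigmaCompactSpace X] (B : LieMetric 𝔤) (o : MOrientation 3 X)
    (S : Set X) (ξ : ι → DForm 3 1 X 𝔤) (η : ι → DForm 3 2 X 𝔤) : ℝ :=
  o.integral (S.indicator fun x => wedge B.toL (ξ (P.idx x) x) (η (P.idx x) x))

/-- The phase space over `S` (before imposing the Gauss law): a gauge potential `A` and an electric
flux density `E`, which is a `2`-form with values in the adjoint bundle. -/
structure Phase (S : Set X) where
  A : ι → DForm 3 1 X 𝔤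
  isConnection : P.IsConnection S A
  E : P.forms S 2

variable {P} in
/-- The translate `(A + t a, E + t e)` of a point of phase space. -/
def Phase.shift {S : Set X} (p : P.Phase S) (t : ℝ) (a : P.forms S 1) (e : P.forms S 2) :
    P.Phase S where
  A := p.A + t • a.1
  isConnection := by
    obtain ⟨h1, h2, h3⟩ := p.isConnection
    obtain ⟨a1, a2, a3⟩ := (t • a).2
    refine ⟨fun i => (h1 i).add (a1 i), fun i x hx => ?_, fun i j x hx => ?_⟩
    · change p.A i x + (t • a).1 i x = 0
      rw [h2 i x hx, a2 i x hx, add_zero]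
    · have hg : P.g j i x = (P.g i j x)⁻¹ := by
        have e1 := P.cocycle i i i x ⟨⟨hx.1.1, hx.1.1⟩, hx.1.1⟩
        have e2 := P.cocycle i j i x ⟨hx.1, hx.1.1⟩
        rw [mul_eq_left.mp e1] at e2
        exact (inv_eq_of_mul_eq_one_right e2).symm
      change p.A j x + (t • a).1 j x = _
      rw [h3 i j x hx, a3 j i x ⟨⟨hx.1.2, hx.1.1⟩, hx.2⟩, hg]
      change _ = (P.Ad (P.g i j x)⁻¹).compContinuousAlternatingMap
        (p.A i x + (t • a).1 i x) + _
      ext v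
      simp
      abel
  E := p.E + t • e

/-- The functional `F` on phase space is differentiable at `p`, its derivative in the direction
`(a, e)` being `δ a + ∫_S ⟨h ∧ e⟩`: the derivative `δF/δE` in the direction of the momentum `E` is
represented by the smooth compactly supported `1`-form `h`. -/
def HasDifferentialAt [T2Space X] [SigmaCompactSpace X] (B : LieMetric 𝔤) (o : MOrientation 3 X)
    {S : Set X} (F : P.Phase S → ℝ) (p : P.Phase S) (δ : P.forms S 1 →ₗ[ℝ] ℝ)
    (h : P.forms S 1) : Prop :=
  h.1 ∈ P.formsCpt S 1 ∧ ∀ (a : P.forms S 1) (e : P.forms S 2),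
    HasDerivAt (fun t : ℝ => F (p.shift t a e)) (δ a + P.pairIntegral B o S h.1 e.1) 0

/-- The canonical Poisson bracket `{F, F'}` has the value `c` at `p`. The bracket is the one for
which the functional `∫_S ⟨h ∧ E⟩` generates the translation of `A` by `h`, that is
`{∫_S ⟨h ∧ E⟩, A} = h`; hence
`{F, F'} = (δF'/δA) (δF/δE) - (δF/δA) (δF'/δE)`. -/
def HasPoissonBracketAt [T2Space X] [SigmaCompactSpace X] (B : LieMetric 𝔤)
    (o : MOrientation 3 X) {S : Set X} (F F' : P.Phase S → ℝ) (p : P.Phase S) (c : ℝ) : Prop :=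
  ∃ (δ δ' : P.forms S 1 →ₗ[ℝ] ℝ) (h h' : P.forms S 1),
    P.HasDifferentialAt B o F p δ h ∧ P.HasDifferentialAt B o F' p δ' h' ∧ c = δ' h - δ h'

/-- The Gauss law `d_A E = 0`, over `S`. -/
def Gauss {S : Set X} (p : P.Phase S) : Prop :=
  ∀ i, ∀ x ∈ P.U i ∩ S, P.dCov S p.A p.E.1 i x = 0

/-- The smearing functions `Ω⁰(S; 𝔤_P)_cpt`: compactly supported smooth sections of the adjoint
bundle over `S`, as families of local functions. The Lie bracket is pointwise. -/
def IsWeight (S : Set X) (α : ι → X → 𝔤) : Prop := (fun i => zeroForm (α i)) ∈ P.formsCpt S 0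

/-- The regularized electric flux `∫_S ⟨d_A α ∧ E⟩`. -/
def regFluxE [T2Space X] [SigmaCompactSpace X] (B : LieMetric 𝔤) (o : MOrientation 3 X)
    (S : Set X) (α : ι → X → 𝔤) (p : P.Phase S) : ℝ :=
  P.pairIntegral B o S (P.dCov S p.A fun i => zeroForm (α i)) p.E.1

/-- The regularized magnetic flux `∫_S ⟨d_A β ∧ F_A⟩`. -/
def regFluxB [T2Space X] [SigmaCompactSpace X] (B : LieMetric 𝔤) (o : MOrientation 3 X)
    (S : Set X) (β : ι → X → 𝔤) (p : P.Phase S) : ℝ :=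
  P.pairIntegral B o S (P.dCov S p.A fun i => zeroForm (β i)) (P.curv S p.A)

end Sector

/-! ### The surface and its exterior -/

/-- A tubular neighbourhood `Y × ℝ → X` of an oriented surface `Y`, embedded as `Y × {0}` in an
oriented `3`-manifold `X`, such that `Y` is the oriented boundary of the image of `Y × [0, ∞)`
(outward normal first). -/
structure Tube {Y X : Type*} [TopologicalSpace Y] [ChartedSpace (𝔼 2) Y] [IsManifold (𝓡 2) ∞ Y]
    [TopologicalSpace X] [ChartedSpace (𝔼 3) X] [IsManifold (𝓡 3) ∞ X]
    (oY : MOrientation 2 Y) (oX : MOrientation 3 X) where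
  toFun : Y × ℝ → X
  injective : Function.Injective toFun
  isLocalDiffeomorph : IsLocalDiffeomorph ((𝓡 2).prod 𝓘(ℝ, ℝ)) (𝓡 3) ∞ toFun
  boundary : ∀ (s : Y) (u v : 𝔼 2), oY.Positive s ![u, v] →
    oX.Positive (toFun (s, 0))
      ![(mfderiv ((𝓡 2).prod 𝓘(ℝ, ℝ)) (𝓡 3) toFun (s, 0) : 𝔼 2 × ℝ →L[ℝ] 𝔼 3) (0, -1),
        (mfderiv ((𝓡 2).prod 𝓘(ℝ, ℝ)) (𝓡 3) toFun (s, 0) : 𝔼 2 × ℝ →L[ℝ] 𝔼 3) (u, 0),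
        (mfderiv ((𝓡 2).prod 𝓘(ℝ, ℝ)) (𝓡 3) toFun (s, 0) : 𝔼 2 × ℝ →L[ℝ] 𝔼 3) (v, 0)]

namespace Tube

variable {Y X : Type*} [TopologicalSpace Y] [ChartedSpace (𝔼 2) Y] [IsManifold (𝓡 2) ∞ Y]
  [TopologicalSpace X] [ChartedSpace (𝔼 3) X] [IsManifold (𝓡 3) ∞ X]
  {oY : MOrientation 2 Y} {oX : MOrientation 3 X} (κ : Tube oY oX)

/-- The embedding `Y → X` of the surface. -/
def incl (s : Y) : X := κ.toFun (s, 0)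

/-- The exterior component of the tubular neighbourhood, a domain with boundary `Y`. -/
def exterior : Set X := κ.toFun '' {q | 0 ≤ q.2}

variable {ι : Type*} {d : ℕ} {G : Type*} [TopologicalSpace G] [ChartedSpace (𝔼 d) G] [Group G]
  [LieGroup (𝓡 d) ∞ G] {𝔤 : Type*} [NormedLieRing 𝔤] [NormedLieAlg 𝔤] [FiniteDimensional ℝ 𝔤]
  (P : Sector ι X d G 𝔤)

/-- Smooth sections over `Y` of the adjoint bundle, as families of local functions. -/
def IsSection (a : ι → Y → 𝔤) : Prop :=
  (∀ i, ContMDiffOn (𝓡 2) 𝓘(ℝ, 𝔤) ∞ (a i) (κ.incl ⁻¹' P.U i)) ∧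
    ∀ i j, ∀ s ∈ κ.incl ⁻¹' (P.U i ∩ P.U j), a i s = P.Ad (P.g i j (κ.incl s)) (a j s)

/-- The smearing function `α` restricts on `Y` to the section `a`. -/
def Restricts (α : ι → X → 𝔤) (a : ι → Y → 𝔤) : Prop :=
  ∀ i, ∀ s ∈ κ.incl ⁻¹' P.U i, α i (κ.incl s) = a i s

/-- `∫_Y ⟨a, η⟩`, for a section `a` over `Y` and a `2`-form `η`, both with values in the adjoint
bundle. -/
def surfaceIntegral [T2Space Y] [SigmaCompactSpace Y] (B : LieMetric 𝔤) (a : ι → Y → 𝔤)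
    (η : ι → DForm 3 2 X 𝔤) : ℝ :=
  oY.integral fun s =>
    ((B.toL (a (P.idx (κ.incl s)) s)).compContinuousAlternatingMap
        (η (P.idx (κ.incl s)) (κ.incl s))).compContinuousLinearMap
      (mfderiv (𝓡 2) (𝓡 3) κ.incl s : 𝔼 2 →L[ℝ] 𝔼 3)

/-- The electric flux `∫_Y ⟨a, E⟩`. -/
def fluxE [T2Space Y] [SigmaCompactSpace Y] (B : LieMetric 𝔤) (a : ι → Y → 𝔤)
    (p : P.Phase κ.exterior) : ℝ :=
  κ.surfaceIntegral P B a p.E.1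

/-- The magnetic flux `∫_Y ⟨b, F_A⟩`. -/
def fluxB [T2Space Y] [SigmaCompactSpace Y] (B : LieMetric 𝔤) (b : ι → Y → 𝔤)
    (p : P.Phase κ.exterior) : ℝ :=
  κ.surfaceIntegral P B b (P.curv κ.exterior p.A)

/-- A trivialization over `Y` of the principal bundle. -/
def IsTrivialization (τ : ι → Y → G) : Prop :=
  (∀ i, ContMDiffOn (𝓡 2) (𝓡 d) ∞ (τ i) (κ.incl ⁻¹' P.U i)) ∧
    ∀ i j, ∀ s ∈ κ.incl ⁻¹' (P.U i ∩ P.U j), P.g i j (κ.incl s) * τ j s = τ i s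

end Tube

namespace Sector

variable {ι X : Type*} [TopologicalSpace X] [ChartedSpace (𝔼 3) X]
  {d : ℕ} {G : Type*} [TopologicalSpace G] [ChartedSpace (𝔼 d) G] [Group G]
  [LieGroup (𝓡 d) ∞ G] {𝔤 : Type*} [NormedLieRing 𝔤] [NormedLieAlg 𝔤] [FiniteDimensional ℝ 𝔤]
  (P : Sector ι X d G 𝔤) {Y : Type*} [TopologicalSpace Y] [ChartedSpace (𝔼 2) Y]

/-- The section of the adjoint bundle that corresponds, under the trivialization `τ`, to the
electric component of `x`. -/
def elec {ħ : ℝ} (τ : ι → Y → G) (x : SmoothMaps Y (FluxAlg ħ 𝔤)) : ι → Y → 𝔤 :=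
  fun i s => P.Ad (τ i s) (x.1 s).right.out

/-- The section of the adjoint bundle that corresponds, under the trivialization `τ`, to the
magnetic component of `x`. -/
def magn {ħ : ℝ} (τ : ι → Y → G) (x : SmoothMaps Y (FluxAlg ħ 𝔤)) : ι → Y → 𝔤 :=
  fun i s => P.Ad (τ i s) (x.1 s).left.out

end Sector

end YMFlux

set_option linter.unusedSectionVars false

/-! The Poisson brackets are pointwise identities under an integral sign. The electric flux `∫⟨d_A α
∧ E⟩` has `δ/δE = d_A α` and `δ_A(a) = ∫⟨[a, α] ∧ E⟩`; the magnetic flux has `δ/δE = 0` and `δ_A(a)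
= ∫⟨[a, β] ∧ F_A⟩ + ⟨d_A β ∧ d_A a⟩`. Hence `{E, E}` is the integral of `⟨([d_A α, β] - [d_A β, α])
∧ E⟩`, which is `⟨d_A[α, β] ∧ E⟩` because `d_A` is a derivation of the bracket (`covD_bracket`,
`diffE_weightForm`). In `{E, B}` the variation `a = d_A α` produces `d_A d_A α = [F_A, α]`
(`covD_covD`), and invariance of the metric turns `⟨d_A β ∧ [F_A, α]⟩` into `⟨[α, d_A β] ∧ F_A⟩`, so
that again `d_A[α, β]` appears (`diffB_weightForm`). `{B, B}` vanishes since neither flux depends on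
`E`. The derivative in `A` stays a linear functional of `a`, so nothing is integrated by parts and
no boundary terms arise.

The comparison with the fluxes through the surface is Stokes' theorem for `d⟨α, η⟩ = ⟨d_A α ∧ η⟩ +
⟨α, d_A η⟩` (`extD_pairing`): the last term vanishes for `η = F_A` by the Bianchi identity and for
`η = E` by the Gauss law. `Tube.stokes` cuts the form by a partition of unity on the surface and,
over each chart, applies the divergence theorem on a half-space.

All this presupposes that local expressions glue. For `d_A ξ` and `F_A` this is gauge covariance
(`covD_gauge`, `curvD_gauge`), which rests on two facts about the Lie group: the derivative of `Ad`
at `1` is the bracket (`fderiv_conjD`), and the Maurer-Cartan equation (`extD_mcForm`). The exterior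
is a closed subset of `X`, so calculus on it means derivatives within a set; `Regular` records what
makes these unique and compatible with `d² = 0` and with pullbacks.

For the last two items: sections extend off the surface by a partition of unity; `Ad` preserves
brackets, so a trivialization turns pointwise brackets of functions into brackets of sections, and
bilinearity gives the Lie-Poisson bracket, one factor `ħ` belonging to `μ` and the other to the
bracket of `𝔤_ħ`. Continuity of `μ` needs only uniform convergence of order zero. The splitting into
components is postcomposition with linear maps, continuous in the Fréchet topology. -/

namespace YMFlux

/-! ### Derivatives of maps between manifolds as maps between the model spaces -/

section TDeriv

variable {E H M E' H' M' E'' H'' M'' : Type*}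
  [NormedAddCommGroup E] [NormedSpace ℝ E] [TopologicalSpace H] {I : ModelWithCorners ℝ E H}
  [TopologicalSpace M] [ChartedSpace H M]
  [NormedAddCommGroup E'] [NormedSpace ℝ E'] [TopologicalSpace H'] {I' : ModelWithCorners ℝ E' H'}
  [TopologicalSpace M'] [ChartedSpace H' M']
  [NormedAddCommGroup E''] [NormedSpace ℝ E''] [TopologicalSpace H'']
  {I'' : ModelWithCorners ℝ E'' H''} [TopologicalSpace M''] [ChartedSpace H'' M'']

/-- The manifold derivative, as a map between the model vector spaces. -/
def tderiv (I : ModelWithCorners ℝ E H) (I' : ModelWithCorners ℝ E' H') (f : M → M') (x : M) :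
    E →L[ℝ] E' := mfderiv I I' f x

theorem tderiv_comp {g : M' → M''} {f : M → M'} {x : M} (hg : MDifferentiableAt I' I'' g (f x))
    (hf : MDifferentiableAt I I' f x) :
    tderiv I I'' (g ∘ f) x = (tderiv I' I'' g (f x)).comp (tderiv I I' f x) :=
  mfderiv_comp x hg hf

theorem tderiv_congr {f g : M → M'} {x : M} (h : f =ᶠ[𝓝 x] g) :
    tderiv I I' f x = tderiv I I' g x :=
  Filter.EventuallyEq.mfderiv_eq h

theorem tderiv_eq_fderiv {f : E → E'} {x : E} :
    tderiv 𝓘(ℝ, E) 𝓘(ℝ, E') f x = fderiv ℝ f x := mfderiv_eq_fderiv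

theorem tderiv_id {x : M} : tderiv I I (id : M → M) x = ContinuousLinearMap.id ℝ E := mfderiv_id

end TDeriv

section Charts

variable {n : ℕ} {M : Type*} [TopologicalSpace M] [ChartedSpace (𝔼 n) M]
  [IsManifold (𝓡 n) ∞ M]

theorem target_mem_nhds {c : M} {y : 𝔼 n} (hy : y ∈ (extChartAt (𝓡 n) c).target) :
    (extChartAt (𝓡 n) c).target ∈ 𝓝 y :=
  (isOpen_extChartAt_target c).mem_nhds hy

theorem contMDiffAt_extChartAt_symm {c : M} {y : 𝔼 n} (hy : y ∈ (extChartAt (𝓡 n) c).target) :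
    ContMDiffAt 𝓘(ℝ, 𝔼 n) (𝓡 n) ∞ (extChartAt (𝓡 n) c).symm y :=
  (contMDiffOn_extChartAt_symm c).contMDiffAt (target_mem_nhds hy)

theorem eventually_contMDiffAt_extChartAt_symm {c : M} {y : 𝔼 n}
    (hy : y ∈ (extChartAt (𝓡 n) c).target) :
    ∀ᶠ w in 𝓝 y, ContMDiffAt 𝓘(ℝ, 𝔼 n) (𝓡 n) ∞ (extChartAt (𝓡 n) c).symm w := by
  filter_upwards [target_mem_nhds hy] with w hw using contMDiffAt_extChartAt_symm hw

theorem contMDiffAt_extChartAt_of_mem {c x : M} (hx : x ∈ (extChartAt (𝓡 n) c).source) :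
    ContMDiffAt (𝓡 n) 𝓘(ℝ, 𝔼 n) ∞ (extChartAt (𝓡 n) c) x := by
  rw [extChartAt_source] at hx
  exact contMDiffAt_extChartAt' hx

theorem tderiv_extChartAt_symm {c : M} {y : 𝔼 n} (hy : y ∈ (extChartAt (𝓡 n) c).target) :
    tderiv 𝓘(ℝ, 𝔼 n) (𝓡 n) (extChartAt (𝓡 n) c).symm y =
      tangentCoordChange (𝓡 n) c ((extChartAt (𝓡 n) c).symm y)
        ((extChartAt (𝓡 n) c).symm y) := by
  have h := (contMDiffAt_extChartAt_symm hy).mdifferentiableAt (by simp)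
  rw [tangentCoordChange_def, (extChartAt (𝓡 n) c).right_inv hy]
  -- `mfderiv` is an `if` on differentiability, and its positive branch is the derivative of the
  -- coordinate expression, which is how the tangent coordinate change is defined.
  exact (if_pos h :)

theorem tangentCoordChange_self' {c x : M} (hx : x ∈ (extChartAt (𝓡 n) c).source) :
    tangentCoordChange (𝓡 n) c c x = ContinuousLinearMap.id ℝ (𝔼 n) := by
  ext1 v
  exact tangentCoordChange_self hx

theorem tangentCoordChange_comp' {a b c x : M} (ha : x ∈ (extChartAt (𝓡 n) a).source)
    (hb : x ∈ (extChartAt (𝓡 n) b).source) (hc : x ∈ (extChartAt (𝓡 n) c).source) :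
    (tangentCoordChange (𝓡 n) b c x).comp (tangentCoordChange (𝓡 n) a b x) =
      tangentCoordChange (𝓡 n) a c x := by
  ext1 v
  exact tangentCoordChange_comp ⟨⟨ha, hb⟩, hc⟩

theorem tderiv_extChartAt_symm_self (x : M) :
    tderiv 𝓘(ℝ, 𝔼 n) (𝓡 n) (extChartAt (𝓡 n) x).symm (extChartAt (𝓡 n) x x) =
      ContinuousLinearMap.id ℝ (𝔼 n) := by
  rw [tderiv_extChartAt_symm (mem_extChartAt_target x), extChartAt_to_inv x]
  exact tangentCoordChange_self' (mem_extChartAt_source x)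

variable {F : Type*} [NormedAddCommGroup F] [NormedSpace ℝ F]

/-- The local expression of a map from a vector space to a manifold. -/
theorem contDiffAt_extChartAt_comp {ψ : F → M} {z : F} {c : M}
    (hψ : ContMDiffAt 𝓘(ℝ, F) (𝓡 n) ∞ ψ z) (hc : ψ z ∈ (extChartAt (𝓡 n) c).source) :
    ContDiffAt ℝ ∞ (extChartAt (𝓡 n) c ∘ ψ) z := by
  rw [← contMDiffAt_iff_contDiffAt]
  exact (contMDiffAt_extChartAt_of_mem hc).comp z hψ

/-- Chain rule through a fixed chart at `c`. The tangent space at `ψ z` is read in the preferred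
chart of that point, which may jump with `z`; the factor on the right that comes from the fixed
chart is the one that varies smoothly. -/
theorem tderiv_eq_tangentCoordChange_comp {ψ : F → M} {z : F} {c : M}
    (hψ : ContMDiffAt 𝓘(ℝ, F) (𝓡 n) ∞ ψ z) (hc : ψ z ∈ (extChartAt (𝓡 n) c).source) :
    tderiv 𝓘(ℝ, F) (𝓡 n) ψ z = (tangentCoordChange (𝓡 n) c (ψ z) (ψ z)).comp
      (fderiv ℝ (extChartAt (𝓡 n) c ∘ ψ) z) := by
  have hmem : (extChartAt (𝓡 n) c).source ∈ 𝓝 (ψ z) :=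
    (isOpen_extChartAt_source c).mem_nhds hc
  have h1 : ψ =ᶠ[𝓝 z] (extChartAt (𝓡 n) c).symm ∘ (extChartAt (𝓡 n) c ∘ ψ) := by
    filter_upwards [hψ.continuousAt hmem] with w hw
    exact ((extChartAt (𝓡 n) c).left_inv hw).symm
  have hy : (extChartAt (𝓡 n) c) (ψ z) ∈ (extChartAt (𝓡 n) c).target :=
    (extChartAt (𝓡 n) c).map_source hc
  rw [tderiv_congr h1, tderiv_comp
    (I' := 𝓘(ℝ, 𝔼 n)) (f := extChartAt (𝓡 n) c ∘ ψ) ((contMDiffAt_extChartAt_symm hy).mdifferentiableAt (by simp))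
    ((contMDiffAt_iff_contDiffAt.mpr (contDiffAt_extChartAt_comp hψ hc)).mdifferentiableAt
      (by simp)), tderiv_eq_fderiv]
  congr 1
  rw [Function.comp_apply, tderiv_extChartAt_symm hy, (extChartAt (𝓡 n) c).left_inv hc]

theorem tderiv_eq_fderiv_extChartAt_comp {ψ : F → M} {z : F}
    (hψ : ContMDiffAt 𝓘(ℝ, F) (𝓡 n) ∞ ψ z) :
    tderiv 𝓘(ℝ, F) (𝓡 n) ψ z = fderiv ℝ (extChartAt (𝓡 n) (ψ z) ∘ ψ) z := by
  rw [tderiv_eq_tangentCoordChange_comp hψ (mem_extChartAt_source _),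
    tangentCoordChange_self' (mem_extChartAt_source _), ContinuousLinearMap.id_comp]

end Charts

/-! ### Smoothness of families of alternating maps -/

section Alternating

variable {k : ℕ} {V F F' Z : Type*} [NormedAddCommGroup V] [NormedSpace ℝ V] [FiniteDimensional ℝ V]
  [NormedAddCommGroup F] [NormedSpace ℝ F] [NormedAddCommGroup F'] [NormedSpace ℝ F']
  [NormedAddCommGroup Z] [NormedSpace ℝ Z]
  [FiniteDimensional ℝ F] [FiniteDimensional ℝ F']

instance finiteDimensional_continuousAlternatingMap :
    FiniteDimensional ℝ (F [⋀^Fin k]→L[ℝ] V) := by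
  let f : (F [⋀^Fin k]→L[ℝ] V) →ₗ[ℝ] MultilinearMap ℝ (fun _ : Fin k => F) V :=
    { toFun := fun ξ => ξ.toMultilinearMap
      map_add' := fun _ _ => rfl
      map_smul' := fun _ _ => rfl }
  refine Module.Finite.of_injective f fun ξ η h => ?_
  ext v
  exact congrArg (fun m : MultilinearMap ℝ (fun _ : Fin k => F) V => m v) h

/-- The evaluation of an alternating map at a tuple of vectors. -/
def evalAlt (V : Type*) [NormedAddCommGroup V] [NormedSpace ℝ V] [FiniteDimensional ℝ V]
    (v : Fin k → F) : (F [⋀^Fin k]→L[ℝ] V) →L[ℝ] V :=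
  LinearMap.toContinuousLinearMap
    { toFun := fun ξ => ξ v
      map_add' := fun _ _ => rfl
      map_smul' := fun _ _ => rfl }

-- An alternating map is determined by its values on tuples of basis vectors, and an injective
-- linear map has a left inverse. Smoothness of a family of alternating maps can thus be tested on
-- its values.
omit [FiniteDimensional ℝ F'] in
theorem exists_leftInverse_eval :
    ∃ (m : ℕ) (v : Fin m → Fin k → F) (g : (Fin m → V) →L[ℝ] (F [⋀^Fin k]→L[ℝ] V)),
      ∀ ξ : F [⋀^Fin k]→L[ℝ] V, g (fun i => ξ (v i)) = ξ := by
  let b := Module.finBasis ℝ F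
  let e := Fintype.equivFin (Fin k → Fin (Module.finrank ℝ F))
  let v : Fin _ → Fin k → F := fun i j => b (e.symm i j)
  let f : (F [⋀^Fin k]→L[ℝ] V) →ₗ[ℝ] (Fin _ → V) :=
    { toFun := fun ξ i => ξ (v i)
      map_add' := fun _ _ => rfl
      map_smul' := fun _ _ => rfl }
  have hf : LinearMap.ker f = ⊥ := by
    rw [LinearMap.ker_eq_bot]
    intro ξ η h
    have : ξ.toMultilinearMap = η.toMultilinearMap := by
      refine Module.Basis.ext_multilinear (fun _ => b) fun w => ?_
      have := congrFun h (e w)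
      simpa [f, v] using this
    ext w
    exact congrArg (fun m : MultilinearMap ℝ (fun _ : Fin k => F) V => m w) this
  obtain ⟨g, hg⟩ := f.exists_leftInverse_of_injective hf
  exact ⟨_, v, LinearMap.toContinuousLinearMap g, fun ξ => congrArg (fun l => l ξ) hg⟩

theorem contDiffWithinAt_alternating {N : WithTop ℕ∞} {T : Set Z} {z : Z}
    {η : Z → F [⋀^Fin k]→L[ℝ] V}
    (h : ∀ v, ContDiffWithinAt ℝ N (fun z => η z v) T z) : ContDiffWithinAt ℝ N η T z := by
  obtain ⟨m, v, g, hg⟩ := exists_leftInverse_eval (k := k) (F := F) (V := V)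
  have : η = fun z => g (fun i => η z (v i)) := funext fun z => (hg (η z)).symm
  rw [this]
  exact g.contDiff.comp_contDiffWithinAt (contDiffWithinAt_pi.2 fun i => h (v i))

theorem _root_.ContDiffWithinAt.alternating_apply {N : WithTop ℕ∞} {T : Set Z} {z : Z}
    {η : Z → F [⋀^Fin k]→L[ℝ] V} (h : ContDiffWithinAt ℝ N η T z) (v : Fin k → F) :
    ContDiffWithinAt ℝ N (fun z => η z v) T z :=
  (evalAlt V v).contDiff.comp_contDiffWithinAt h

/-- The pullback is linear in the form and a continuous multilinear function of copies of `L`. -/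
theorem contDiffWithinAt_compContinuousLinearMap {N : WithTop ℕ∞} {T : Set Z} {z : Z}
    {η : Z → F' [⋀^Fin k]→L[ℝ] V} {L : Z → F →L[ℝ] F'}
    (hη : ContDiffWithinAt ℝ N η T z) (hL : ContDiffWithinAt ℝ N L T z) :
    ContDiffWithinAt ℝ N (fun z => (η z).compContinuousLinearMap (L z)) T z := by
  refine contDiffWithinAt_alternating fun v => ?_
  let Λ := ContinuousMultilinearMap.compContinuousLinearMapContinuousMultilinear ℝ
    (fun _ : Fin k => F) (fun _ => F') V
  have h1 : ContDiffWithinAt ℝ N (fun z => Λ (fun _ => L z)) T z :=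
    Λ.contDiff.comp_contDiffWithinAt (contDiffWithinAt_pi.2 fun _ => hL)
  let τ : (F' [⋀^Fin k]→L[ℝ] V) →L[ℝ] ContinuousMultilinearMap ℝ (fun _ : Fin k => F') V :=
    ContinuousAlternatingMap.toContinuousMultilinearMapCLM ℝ
  have h2 : ContDiffWithinAt ℝ N (fun z => τ (η z)) T z :=
    τ.contDiff.comp_contDiffWithinAt hη
  exact (ContinuousMultilinearMap.apply ℝ (fun _ : Fin k => F) V v
    ).contDiff.comp_contDiffWithinAt (h1.clm_apply h2)

end Alternating

/-! ### Pullback of forms to vector spaces -/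

section Pull

theorem minSmoothness_two_le : minSmoothness ℝ 2 ≤ (∞ : WithTop ℕ∞) := by
  rw [minSmoothness_of_isRCLikeNormedField]
  exact WithTop.coe_le_coe.2 (le_top : (2 : ℕ∞) ≤ ⊤)

variable {n k : ℕ} {M : Type*} [TopologicalSpace M] [ChartedSpace (𝔼 n) M]
  [IsManifold (𝓡 n) ∞ M]
  {V : Type*} [NormedAddCommGroup V] [NormedSpace ℝ V] [FiniteDimensional ℝ V]
  {F F' : Type*} [NormedAddCommGroup F] [NormedSpace ℝ F] [NormedAddCommGroup F']
  [NormedSpace ℝ F'] [FiniteDimensional ℝ F] [FiniteDimensional ℝ F']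

/-- The pullback of a form along a map from a vector space. -/
def pull (ψ : F → M) (ξ : DForm n k M V) : F → F [⋀^Fin k]→L[ℝ] V := fun z =>
  (ξ (ψ z)).compContinuousLinearMap (tderiv 𝓘(ℝ, F) (𝓡 n) ψ z)

theorem inChart_eq_pull {c : M} {y : 𝔼 n} (hy : y ∈ (extChartAt (𝓡 n) c).target)
    (ξ : DForm n k M V) : inChart c ξ y = pull (extChartAt (𝓡 n) c).symm ξ y := by
  rw [inChart, pull, tderiv_extChartAt_symm hy]

theorem inChart_self (x : M) (ξ : DForm n k M V) :
    inChart x ξ (extChartAt (𝓡 n) x x) = ξ x := by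
  rw [inChart, extChartAt_to_inv x, tangentCoordChange_self' (mem_extChartAt_source x)]
  rfl

theorem pull_eq_inChart {ψ : F → M} {z : F} {c : M} (hψ : ContMDiffAt 𝓘(ℝ, F) (𝓡 n) ∞ ψ z)
    (hc : ψ z ∈ (extChartAt (𝓡 n) c).source) (ξ : DForm n k M V) :
    pull ψ ξ z = (inChart c ξ (extChartAt (𝓡 n) c (ψ z))).compContinuousLinearMap
      (fderiv ℝ (extChartAt (𝓡 n) c ∘ ψ) z) := by
  rw [pull, inChart, (extChartAt (𝓡 n) c).left_inv hc, tderiv_eq_tangentCoordChange_comp hψ hc]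
  rfl

theorem mem_chartPart {c x : M} {S : Set M} (hc : x ∈ (extChartAt (𝓡 n) c).source)
    (hx : x ∈ S) : extChartAt (𝓡 n) c x ∈ chartPart c S := by
  refine ⟨(extChartAt (𝓡 n) c).map_source hc, ?_⟩
  rwa [mem_preimage, (extChartAt (𝓡 n) c).left_inv hc]

/-- A subset of a manifold on which one can do calculus, such as a domain with boundary. -/
def Regular (n : ℕ) {M : Type*} [TopologicalSpace M] [ChartedSpace (𝔼 n) M] (S : Set M) : Prop :=
  ∀ c : M, UniqueDiffOn ℝ (chartPart (n := n) c S) ∧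
    chartPart (n := n) c S ⊆ closure (interior (chartPart (n := n) c S))

theorem isOpen_chartPart {U : Set M} (hU : IsOpen U) (c : M) : IsOpen (chartPart (n := n) c U) :=
  (continuousOn_extChartAt_symm c).isOpen_inter_preimage (isOpen_extChartAt_target c) hU

theorem _root_.IsOpen.regular {U : Set M} (hU : IsOpen U) : Regular n U := fun c =>
  ⟨(isOpen_chartPart hU c).uniqueDiffOn, by
    rw [(isOpen_chartPart hU c).interior_eq]; exact subset_closure⟩

theorem chartPart_inter {c : M} (U S : Set M) :
    chartPart (n := n) c (U ∩ S) = chartPart c U ∩ chartPart c S := by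
  ext y; simp only [chartPart, mem_inter_iff, mem_preimage]; tauto

theorem Regular.open_inter {U S : Set M} (hS : Regular n S) (hU : IsOpen U) :
    Regular n (U ∩ S) := by
  intro c
  rw [chartPart_inter]
  have ho := isOpen_chartPart (n := n) hU c
  refine ⟨by rw [inter_comm]; exact (hS c).1.inter ho, ?_⟩
  rw [interior_inter, ho.interior_eq]
  rintro y ⟨hy, hy'⟩
  exact ho.inter_closure ⟨hy, (hS c).2 hy'⟩

theorem chartPart_inter_mem_nhdsWithin {c : M} {U S : Set M} (hU : IsOpen U) {y : 𝔼 n}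
    (hy : y ∈ chartPart c U) : chartPart c (U ∩ S) ∈ 𝓝[chartPart c S] y := by
  rw [chartPart_inter, inter_comm]
  exact inter_mem_nhdsWithin _ ((isOpen_chartPart hU c).mem_nhds hy)

theorem SmoothFormOn.mono {S T : Set M} {ξ : DForm n k M V} (h : SmoothFormOn S ξ)
    (hT : T ⊆ S) : SmoothFormOn T ξ := fun c =>
  (h c).mono fun _ hy => ⟨hy.1, hT hy.2⟩

/-- Smoothness of a form at the points of `S`, tested in one chart around each point. -/
def SmoothFormAt (S : Set M) (ξ : DForm n k M V) (x : M) : Prop :=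
  ContDiffWithinAt ℝ ∞ (inChart x ξ) (chartPart x S) (extChartAt (𝓡 n) x x)

/-- Near `z` the pullback is the chart expression of `ξ` after that of `ψ`, composed with the
derivative of the latter. This identity is needed at all points near `z`, and smoothness of order
`∞` at `z` alone does not spread to them; hence the form of `hψ'`. -/
theorem contDiffWithinAt_pull {ψ : F → M} {T : Set F} {S : Set M} {z : F} {c : M}
    (hψ' : ∀ᶠ w in 𝓝 z, ContMDiffAt 𝓘(ℝ, F) (𝓡 n) ∞ ψ w) (hc : ψ z ∈ (extChartAt (𝓡 n) c).source)
    (hT : MapsTo ψ T S) {ξ : DForm n k M V}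
    (hξ : ContDiffWithinAt ℝ ∞ (inChart c ξ) (chartPart c S) (extChartAt (𝓡 n) c (ψ z))) :
    ContDiffWithinAt ℝ ∞ (pull ψ ξ) T z := by
  have hψ := hψ'.self_of_nhds
  have hmem : ∀ᶠ w in 𝓝 z, ψ w ∈ (extChartAt (𝓡 n) c).source :=
    hψ.continuousAt ((isOpen_extChartAt_source c).mem_nhds hc)
  have hΦ := contDiffAt_extChartAt_comp hψ hc
  have e : pull ψ ξ =ᶠ[𝓝 z] fun w => (inChart c ξ ((extChartAt (𝓡 n) c ∘ ψ) w)
      ).compContinuousLinearMap (fderiv ℝ (extChartAt (𝓡 n) c ∘ ψ) w) := by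
    filter_upwards [hmem, hψ'] with w h1 h2
    exact pull_eq_inChart h2 h1 ξ
  refine ContDiffWithinAt.congr_of_eventuallyEq ?_ (e.filter_mono nhdsWithin_le_nhds) e.self_of_nhds
  refine contDiffWithinAt_compContinuousLinearMap ?_ ?_
  · refine (hξ.comp_inter (f := extChartAt (𝓡 n) c ∘ ψ) (s := T) z
      hΦ.contDiffWithinAt).mono_of_mem_nhdsWithin ?_
    refine Filter.inter_mem self_mem_nhdsWithin ?_
    filter_upwards [nhdsWithin_le_nhds hmem, self_mem_nhdsWithin] with w h1 h2
    exact mem_chartPart h1 (hT h2)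
  · exact (hΦ.fderiv_right (m := ∞) (by simp)).contDiffWithinAt

theorem SmoothFormOn.contDiffOn_pull {ψ : F → M} {T : Set F} {S : Set M} {ξ : DForm n k M V}
    (hξ : SmoothFormOn S ξ) (hψ : ∀ z ∈ T, ∀ᶠ w in 𝓝 z, ContMDiffAt 𝓘(ℝ, F) (𝓡 n) ∞ ψ w)
    (hT : MapsTo ψ T S) : ContDiffOn ℝ ∞ (pull ψ ξ) T := fun z hz =>
  contDiffWithinAt_pull (hψ z hz) (mem_extChartAt_source (ψ z)) hT
    (hξ _ _ (mem_chartPart (mem_extChartAt_source _) (hT hz)))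

/-- The exterior derivative commutes with pullback. -/
theorem extDerivWithin_pull {ψ : F → M} {T : Set F} {S : Set M} {z : F}
    (hψ' : ∀ᶠ w in 𝓝 z, ContMDiffAt 𝓘(ℝ, F) (𝓡 n) ∞ ψ w) (hT : UniqueDiffOn ℝ T) (hT' : z ∈ closure (interior T))
    (hz : z ∈ T) (hTS : MapsTo ψ T S) {ξ : DForm n k M V} (hξ : SmoothFormAt S ξ (ψ z)) :
    extDerivWithin (pull ψ ξ) T z = pull ψ (extD S ξ) z := by
  set c := ψ z with hc'
  have hc : ψ z ∈ (extChartAt (𝓡 n) c).source := mem_extChartAt_source _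
  have hψ := hψ'.self_of_nhds
  have hmem : ∀ᶠ w in 𝓝 z, ψ w ∈ (extChartAt (𝓡 n) c).source :=
    hψ.continuousAt ((isOpen_extChartAt_source c).mem_nhds hc)
  -- On `T ∩ O` the map is smooth and stays in one chart, so its derivative within the set is the
  -- full derivative and the pullback has the shape required by `extDerivWithin_pullback`.
  obtain ⟨O, hO, hOo, hzO⟩ := eventually_nhds_iff.1 (hmem.and hψ')
  have hTO : UniqueDiffOn ℝ (T ∩ O) := hT.inter hOo
  have hTOm : T ∩ O ∈ 𝓝[T] z := inter_mem_nhdsWithin _ (hOo.mem_nhds hzO)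
  have hΦ := contDiffAt_extChartAt_comp hψ hc
  have e : EqOn (pull ψ ξ) (fun w => (inChart c ξ ((extChartAt (𝓡 n) c ∘ ψ) w)
      ).compContinuousLinearMap (fderivWithin ℝ (extChartAt (𝓡 n) c ∘ ψ) (T ∩ O) w)) (T ∩ O) := by
    intro w hw
    have h1 := hO w hw.2
    simp only
    rw [pull_eq_inChart h1.2 h1.1 ξ, fderivWithin_eq_fderiv (hTO w hw)
      ((contDiffAt_extChartAt_comp h1.2 h1.1).differentiableAt (by simp))]
    rfl
  have e0 : extDerivWithin (pull ψ ξ) T z = extDerivWithin (pull ψ ξ) (T ∩ O) z := by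
    unfold extDerivWithin
    rw [fderivWithin_inter (hOo.mem_nhds hzO)]
  rw [e0, extDerivWithin_congr' e ⟨hz, hzO⟩,
    extDerivWithin_pullback (r := ∞) (t := chartPart c S) (f := extChartAt (𝓡 n) c ∘ ψ)
      (hξ.differentiableWithinAt (by simp)) hΦ.contDiffWithinAt minSmoothness_two_le hTO ?_ ⟨hz, hzO⟩ ?_]
  · rw [pull_eq_inChart hψ hc, fderivWithin_eq_fderiv (hTO z ⟨hz, hzO⟩)
      (hΦ.differentiableAt (by simp)), inChart_self]
    rfl
  · rw [interior_inter, hOo.interior_eq, inter_comm]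
    exact hOo.inter_closure ⟨hzO, hT'⟩
  · intro w hw
    exact mem_chartPart (hO w hw.2).1 (hTS hw.1)

end Pull


/-! ### Exterior calculus -/

section Wedge

variable {n k m : ℕ} {V W Z : Type*} [NormedAddCommGroup V] [NormedSpace ℝ V]
  [NormedAddCommGroup W] [NormedSpace ℝ W] [NormedAddCommGroup Z] [NormedSpace ℝ Z]

theorem wedge_apply (B : V →L[ℝ] W →L[ℝ] Z) (ξ : (𝔼 n) [⋀^Fin 1]→L[ℝ] V)
    (η : (𝔼 n) [⋀^Fin k]→L[ℝ] W) (v : Fin (k + 1) → 𝔼 n) :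
    wedge B ξ η v = ∑ i : Fin (k + 1), (-1) ^ i.val • B (ξ (fun _ => v i)) (η (i.removeNth v)) := by
  rw [wedge, ContinuousAlternatingMap.alternatizeUncurryFin_apply]
  rfl

theorem wedge_add_left (B : V →L[ℝ] W →L[ℝ] Z) (ξ ξ' : (𝔼 n) [⋀^Fin 1]→L[ℝ] V)
    (η : (𝔼 n) [⋀^Fin k]→L[ℝ] W) : wedge B (ξ + ξ') η = wedge B ξ η + wedge B ξ' η := by
  ext v
  simp [wedge_apply, Finset.sum_add_distrib]

theorem wedge_add_right (B : V →L[ℝ] W →L[ℝ] Z) (ξ : (𝔼 n) [⋀^Fin 1]→L[ℝ] V)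
    (η η' : (𝔼 n) [⋀^Fin k]→L[ℝ] W) : wedge B ξ (η + η') = wedge B ξ η + wedge B ξ η' := by
  ext v
  simp [wedge_apply, Finset.sum_add_distrib]

theorem wedge_smul_left (B : V →L[ℝ] W →L[ℝ] Z) (t : ℝ) (ξ : (𝔼 n) [⋀^Fin 1]→L[ℝ] V)
    (η : (𝔼 n) [⋀^Fin k]→L[ℝ] W) : wedge B (t • ξ) η = t • wedge B ξ η := by
  ext v
  simp [wedge_apply, Finset.smul_sum, smul_comm t]

theorem wedge_smul_right (B : V →L[ℝ] W →L[ℝ] Z) (t : ℝ) (ξ : (𝔼 n) [⋀^Fin 1]→L[ℝ] V)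
    (η : (𝔼 n) [⋀^Fin k]→L[ℝ] W) : wedge B ξ (t • η) = t • wedge B ξ η := by
  ext v
  simp [wedge_apply, Finset.smul_sum, smul_comm t]

theorem wedge_zero_left (B : V →L[ℝ] W →L[ℝ] Z) (η : (𝔼 n) [⋀^Fin k]→L[ℝ] W) :
    wedge B 0 η = 0 := by
  ext v
  simp [wedge_apply]

theorem wedge_zero_right (B : V →L[ℝ] W →L[ℝ] Z) (ξ : (𝔼 n) [⋀^Fin 1]→L[ℝ] V) :
    wedge B ξ (0 : (𝔼 n) [⋀^Fin k]→L[ℝ] W) = 0 := by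
  ext v
  simp [wedge_apply]

theorem wedge_compContinuousLinearMap (B : V →L[ℝ] W →L[ℝ] Z) (ξ : (𝔼 n) [⋀^Fin 1]→L[ℝ] V)
    (η : (𝔼 n) [⋀^Fin k]→L[ℝ] W) (L : 𝔼 m →L[ℝ] 𝔼 n) :
    (wedge B ξ η).compContinuousLinearMap L =
      wedge B (ξ.compContinuousLinearMap L) (η.compContinuousLinearMap L) := by
  ext v
  rw [ContinuousAlternatingMap.compContinuousLinearMap_apply, wedge_apply, wedge_apply]
  rfl

theorem contDiffWithinAt_wedge [FiniteDimensional ℝ V] [FiniteDimensional ℝ W]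
    [FiniteDimensional ℝ Z] {F : Type*} [NormedAddCommGroup F] [NormedSpace ℝ F]
    {N : WithTop ℕ∞} (B : V →L[ℝ] W →L[ℝ] Z)
    {T : Set F} {z : F} {ξ : F → (𝔼 n) [⋀^Fin 1]→L[ℝ] V} {η : F → (𝔼 n) [⋀^Fin k]→L[ℝ] W}
    (hξ : ContDiffWithinAt ℝ N ξ T z) (hη : ContDiffWithinAt ℝ N η T z) :
    ContDiffWithinAt ℝ N (fun z => wedge B (ξ z) (η z)) T z := by
  refine contDiffWithinAt_alternating fun v => ?_
  simp only [wedge_apply]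
  refine ContDiffWithinAt.sum fun i _ => ContDiffWithinAt.const_smul _ ?_
  exact (contDiffWithinAt_const.clm_apply (hξ.alternating_apply _)).clm_apply
    (hη.alternating_apply _)

theorem contDiffWithinAt_bilin [FiniteDimensional ℝ V] [FiniteDimensional ℝ W]
    [FiniteDimensional ℝ Z] {F : Type*} [NormedAddCommGroup F] [NormedSpace ℝ F]
    {N : WithTop ℕ∞} (B : V →L[ℝ] W →L[ℝ] Z)
    {T : Set F} {z : F} {f : F → V} {η : F → (𝔼 n) [⋀^Fin k]→L[ℝ] W}
    (hf : ContDiffWithinAt ℝ N f T z) (hη : ContDiffWithinAt ℝ N η T z) :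
    ContDiffWithinAt ℝ N (fun z => (B (f z)).compContinuousAlternatingMap (η z)) T z := by
  refine contDiffWithinAt_alternating fun v => ?_
  exact (contDiffWithinAt_const.clm_apply hf).clm_apply (hη.alternating_apply v)

/-- The Leibniz rule for the product of a function and a form. -/
theorem extDerivWithin_bilin (B : V →L[ℝ] W →L[ℝ] Z)
    {T : Set (𝔼 n)} {z : 𝔼 n} {f : 𝔼 n → V} {η : 𝔼 n → (𝔼 n) [⋀^Fin k]→L[ℝ] W}
    (hT : UniqueDiffWithinAt ℝ T z)
    (hf : DifferentiableWithinAt ℝ f T z) (hη : DifferentiableWithinAt ℝ η T z) :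
    extDerivWithin (fun z => (B (f z)).compContinuousAlternatingMap (η z)) T z =
      wedge B (ContinuousAlternatingMap.ofSubsingleton ℝ (𝔼 n) V (0 : Fin 1)
        (fderivWithin ℝ f T z)) (η z) +
      (B (f z)).compContinuousAlternatingMap (extDerivWithin η T z) := by
  -- The product as a bilinear map into the space of forms: the ordinary product rule for `C`, once
  -- alternatized, gives the two terms.
  set C : V →L[ℝ] ((𝔼 n) [⋀^Fin k]→L[ℝ] W) →L[ℝ] ((𝔼 n) [⋀^Fin k]→L[ℝ] Z) :=
    (ContinuousLinearMap.compContinuousAlternatingMapCLM (𝕜 := ℝ) (E := 𝔼 n) (F := W) (G := Z)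
        (ι := Fin k)).comp B with hC
  have h := C.hasFDerivWithinAt_of_bilinear hf.hasFDerivWithinAt hη.hasFDerivWithinAt
  have e : fderivWithin ℝ (fun z => (B (f z)).compContinuousAlternatingMap (η z)) T z = _ :=
    h.fderivWithin hT
  ext v
  rw [extDerivWithin, e, ContinuousAlternatingMap.alternatizeUncurryFin_apply,
    ContinuousAlternatingMap.add_apply, wedge_apply,
    ContinuousLinearMap.compContinuousAlternatingMap_coe, Function.comp_apply, extDerivWithin,
    ContinuousAlternatingMap.alternatizeUncurryFin_apply, map_sum, ← Finset.sum_add_distrib]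
  refine Finset.sum_congr rfl fun i _ => ?_
  rw [map_zsmul, ← smul_add]
  congr 1
  simp [hC]
  rw [add_comm]

end Wedge

section Manifold

variable {n k : ℕ} {M : Type*} [TopologicalSpace M] [ChartedSpace (𝔼 n) M]
  [IsManifold (𝓡 n) ∞ M]
  {V W Z : Type*} [NormedAddCommGroup V] [NormedSpace ℝ V] [FiniteDimensional ℝ V]
  [NormedAddCommGroup W] [NormedSpace ℝ W] [FiniteDimensional ℝ W]
  [NormedAddCommGroup Z] [NormedSpace ℝ Z] [FiniteDimensional ℝ Z]
  {S : Set M} {x : M}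

/-- The product of a function and a form, the coefficients being multiplied by `B`. -/
def bilin (B : V →L[ℝ] W →L[ℝ] Z) (f : M → V) (η : DForm n k M W) : DForm n k M Z :=
  fun x => (B (f x)).compContinuousAlternatingMap (η x)

theorem inChart_wedge (B : V →L[ℝ] W →L[ℝ] Z) (ξ : DForm n 1 M V) (η : DForm n k M W) (c : M) :
    inChart c (fun x => wedge B (ξ x) (η x)) =
      fun y => wedge B (inChart c ξ y) (inChart c η y) := by
  funext y
  exact wedge_compContinuousLinearMap _ _ _ _

theorem inChart_zeroForm (f : M → V) (c : M) :
    inChart (n := n) c (zeroForm f) = fun y =>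
      ContinuousAlternatingMap.constOfIsEmpty ℝ (𝔼 n) (Fin 0)
        (f ((extChartAt (𝓡 n) c).symm y)) := rfl

theorem contDiffOn_of_zeroForm {f : M → V} (hf : SmoothFormOn (n := n) S (zeroForm f)) (c : M) :
    ContDiffOn ℝ ∞ (f ∘ (extChartAt (𝓡 n) c).symm) (chartPart c S) := fun y hy =>
  (hf c y hy).alternating_apply ![]

theorem smoothFormOn_zeroForm {f : M → V}
    (hf : ∀ c : M, ContDiffOn ℝ ∞ (f ∘ (extChartAt (𝓡 n) c).symm) (chartPart c S)) :
    SmoothFormOn (n := n) S (zeroForm f) := fun c y hy =>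
  contDiffWithinAt_alternating fun _ => hf c y hy

theorem SmoothFormOn.bilin (B : V →L[ℝ] W →L[ℝ] Z) {f : M → V} {η : DForm n k M W}
    (hf : SmoothFormOn (n := n) S (zeroForm f)) (hη : SmoothFormOn S η) :
    SmoothFormOn S (bilin B f η) := fun c y hy =>
  contDiffWithinAt_bilin B (contDiffOn_of_zeroForm hf c y hy) (hη c y hy)

theorem SmoothFormOn.wedge (B : V →L[ℝ] W →L[ℝ] Z) {ξ : DForm n 1 M V} {η : DForm n k M W}
    (hξ : SmoothFormOn S ξ) (hη : SmoothFormOn S η) :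
    SmoothFormOn S (fun x => wedge B (ξ x) (η x)) := fun c y hy => by
  rw [inChart_wedge]
  exact contDiffWithinAt_wedge B (hξ c y hy) (hη c y hy)

theorem SmoothFormOn.smoothFormAt {ξ : DForm n k M V} (h : SmoothFormOn S ξ) (hx : x ∈ S) :
    SmoothFormAt S ξ x := h x _ (mem_chartPart (mem_extChartAt_source x) hx)

theorem SmoothFormOn.congr {ξ η : DForm n k M V} (h : SmoothFormOn S ξ)
    (hη : ∀ x ∈ S, η x = ξ x) : SmoothFormOn S η := fun c y hy =>
  (h c y hy).congr_of_mem (fun w hw => by unfold inChart; rw [hη _ hw.2]) hy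

/-- Smoothness of forms is a local property. -/
theorem smoothFormOn_of_locally {ξ : DForm n k M V}
    (h : ∀ x ∈ S, ∃ U : Set M, IsOpen U ∧ x ∈ U ∧ SmoothFormOn (U ∩ S) ξ) : SmoothFormOn S ξ := by
  intro c y hy
  obtain ⟨U, hU, hxU, hs⟩ := h _ hy.2
  exact (hs c y ⟨hy.1, hxU, hy.2⟩).mono_of_mem_nhdsWithin
    (chartPart_inter_mem_nhdsWithin hU ⟨hy.1, hxU⟩)

theorem uniqueDiffWithinAt_chartPart (hS : Regular n S) (hx : x ∈ S) :
    UniqueDiffWithinAt ℝ (chartPart x S) (extChartAt (𝓡 n) x x) :=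
  (hS x).1 _ (mem_chartPart (mem_extChartAt_source x) hx)

theorem extD_add {ξ η : DForm n k M V} (hS : Regular n S) (hx : x ∈ S)
    (hξ : SmoothFormOn S ξ) (hη : SmoothFormOn S η) :
    extD S (ξ + η) x = extD S ξ x + extD S η x := by
  unfold extD
  rw [inChart_add]
  exact extDerivWithin_add (uniqueDiffWithinAt_chartPart hS hx)
    ((hξ.smoothFormAt hx).differentiableWithinAt (by simp))
    ((hη.smoothFormAt hx).differentiableWithinAt (by simp))

theorem extD_smul {ξ : DForm n k M V} (hS : Regular n S) (hx : x ∈ S) (t : ℝ) :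
    extD S (t • ξ) x = t • extD S ξ x := by
  unfold extD
  rw [inChart_smul]
  exact extDerivWithin_smul _ _ (uniqueDiffWithinAt_chartPart hS hx)

/-- Derivatives within a set are local. Representatives in the `i`-th trivialization are smooth only
on `P.U i ∩ S`, while exterior derivatives are taken over `S`; this passes between the two. -/
theorem extD_inter {ξ : DForm n k M V} {U : Set M} (hU : IsOpen U) (hx : x ∈ U) :
    extD (U ∩ S) ξ x = extD S ξ x := by
  unfold extD extDerivWithin
  rw [chartPart_inter, inter_comm, fderivWithin_inter]
  exact (isOpen_chartPart hU x).mem_nhds (mem_chartPart (mem_extChartAt_source x) hx)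

theorem extD_congr {ξ η : DForm n k M V} {U : Set M} (hU : IsOpen U) (hx : x ∈ U) (hxS : x ∈ S)
    (h : ∀ y ∈ U ∩ S, ξ y = η y) : extD S ξ x = extD S η x := by
  rw [← extD_inter hU hx, ← extD_inter (ξ := η) hU hx]
  refine extDerivWithin_congr' (fun w hw => ?_)
    (mem_chartPart (mem_extChartAt_source x) ⟨hx, hxS⟩)
  unfold inChart
  rw [h _ hw.2]

theorem extD_zero : extD S (0 : DForm n k M V) x = 0 := by
  have : inChart x (0 : DForm n k M V) = fun _ => 0 := rfl
  unfold extD extDerivWithin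
  rw [this]
  ext v
  simp [ContinuousAlternatingMap.alternatizeUncurryFin_apply]

/-- Derivatives within `S` are unique, so the derivative within the larger set is the one within
`S`. At boundary points this compares forms on the domain with forms on an open neighbourhood. -/
theorem extD_mono {ξ : DForm n k M V} {T : Set M} (hS : Regular n S) (hx : x ∈ S) (hST : S ⊆ T)
    (hξ : SmoothFormAt T ξ x) : extD S ξ x = extD T ξ x := by
  unfold extD extDerivWithin
  rw [fderivWithin_subset (show chartPart x S ⊆ chartPart x T from fun w hw => ⟨hw.1, hST hw.2⟩)
    (uniqueDiffWithinAt_chartPart hS hx)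
    (hξ.differentiableWithinAt (by simp))]

/-- The value of `extD` at each point is computed in the preferred chart of that point; naturality
of `d` under coordinate changes makes these values fit together in any one chart. -/
theorem inChart_extD {ξ : DForm n k M V} (hS : Regular n S) (hξ : SmoothFormOn S ξ) {c : M}
    {y : 𝔼 n} (hy : y ∈ chartPart c S) :
    inChart c (extD S ξ) y = extDerivWithin (inChart c ξ) (chartPart c S) y := by
  rw [inChart_eq_pull hy.1, ← extDerivWithin_pull (S := S)
    (eventually_contMDiffAt_extChartAt_symm hy.1) (hS c).1 ((hS c).2 hy) hy (fun w hw => hw.2)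
    (hξ.smoothFormAt hy.2)]
  exact extDerivWithin_congr' (fun w hw => (inChart_eq_pull hw.1 ξ).symm) hy

theorem SmoothFormOn.extD {ξ : DForm n k M V} (hS : Regular n S) (hξ : SmoothFormOn S ξ) :
    SmoothFormOn S (extD S ξ) := by
  intro c
  refine ContDiffOn.congr ?_ fun y hy => inChart_extD hS hξ hy
  unfold extDerivWithin
  exact (ContinuousAlternatingMap.alternatizeUncurryFinCLM ℝ (𝔼 n) V (n := k)
    ).contDiff.comp_contDiffOn ((hξ c).fderivWithin (m := ∞) (hS c).1 (by simp))

theorem extD_extD {ξ : DForm n k M V} (hS : Regular n S) (hξ : SmoothFormOn S ξ) (hx : x ∈ S) :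
    YMFlux.extD S (YMFlux.extD S ξ) x = 0 := by
  have hy := mem_chartPart (n := n) (mem_extChartAt_source x) hx
  have h := extDerivWithin_extDerivWithin_apply (hξ x _ hy) minSmoothness_two_le (hS x).1
    ((hS x).2 hy) hy
  rw [← h]
  exact extDerivWithin_congr' (fun w hw => inChart_extD hS hξ hw) hy

/-- The differential of a function, in the preferred chart. -/
theorem extD_zeroForm {f : M → V} (hS : Regular n S) (hx : x ∈ S) :
    extD (n := n) S (zeroForm f) x = ContinuousAlternatingMap.ofSubsingleton ℝ (𝔼 n) V (0 : Fin 1)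
      (fderivWithin ℝ (f ∘ (extChartAt (𝓡 n) x).symm) (chartPart x S) (extChartAt (𝓡 n) x x)) := by
  unfold extD
  rw [inChart_zeroForm]
  exact extDerivWithin_constOfIsEmpty _ (uniqueDiffWithinAt_chartPart hS hx)

theorem extD_bilin (B : V →L[ℝ] W →L[ℝ] Z) {f : M → V} {η : DForm n k M W}
    (hS : Regular n S) (hx : x ∈ S)
    (hf : SmoothFormOn (n := n) S (zeroForm f)) (hη : SmoothFormOn S η) :
    extD S (bilin B f η) x = wedge B (extD (n := n) S (zeroForm f) x) (η x) +
      (B (f x)).compContinuousAlternatingMap (extD S η x) := by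
  have hy := mem_chartPart (n := n) (mem_extChartAt_source x) hx
  rw [extD_zeroForm hS hx]
  unfold extD
  have h := extDerivWithin_bilin (f := f ∘ (extChartAt (𝓡 n) x).symm)
    B (uniqueDiffWithinAt_chartPart hS hx)
    ((contDiffOn_of_zeroForm hf x _ hy).differentiableWithinAt (by simp))
    ((hη x _ hy).differentiableWithinAt (by simp))
  rw [inChart_self] at h
  simp only [Function.comp_apply, extChartAt_to_inv] at h
  exact h

end Manifold


/-! ### Covariant derivatives and curvature in a local trivialization -/

section Low

variable {n : ℕ} {V W Z : Type*} [NormedAddCommGroup V] [NormedSpace ℝ V]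
  [NormedAddCommGroup W] [NormedSpace ℝ W] [NormedAddCommGroup Z] [NormedSpace ℝ Z]

theorem removeNth_two_zero {E : Type*} (w : Fin 2 → E) :
    (0 : Fin 2).removeNth w = fun _ => w 1 := by
  funext j; fin_cases j; rfl

theorem removeNth_two_one {E : Type*} (w : Fin 2 → E) :
    (1 : Fin 2).removeNth w = fun _ => w 0 := by
  funext j; fin_cases j; rfl

theorem removeNth_three_zero {E : Type*} (w : Fin 3 → E) :
    (0 : Fin 3).removeNth w = ![w 1, w 2] := by
  funext j; fin_cases j <;> rfl

theorem removeNth_three_one {E : Type*} (w : Fin 3 → E) :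
    (1 : Fin 3).removeNth w = ![w 0, w 2] := by
  funext j; fin_cases j <;> rfl

theorem removeNth_three_two {E : Type*} (w : Fin 3 → E) :
    (2 : Fin 3).removeNth w = ![w 0, w 1] := by
  funext j; fin_cases j <;> rfl

theorem wedge_zero_form (B : V →L[ℝ] W →L[ℝ] Z) (ξ : (𝔼 n) [⋀^Fin 1]→L[ℝ] V)
    (η : (𝔼 n) [⋀^Fin 0]→L[ℝ] W) (w : Fin 1 → 𝔼 n) :
    wedge B ξ η w = B (ξ (fun _ => w 0)) (η ![]) := by
  rw [wedge_apply]
  rw [Fin.sum_univ_succ, Fin.sum_univ_zero, add_zero,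
    Subsingleton.elim ((0 : Fin (0 + 1)).removeNth w) ![]]
  simp

theorem wedge_one_form (B : V →L[ℝ] W →L[ℝ] Z) (ξ : (𝔼 n) [⋀^Fin 1]→L[ℝ] V)
    (η : (𝔼 n) [⋀^Fin 1]→L[ℝ] W) (w : Fin 2 → 𝔼 n) :
    wedge B ξ η w = B (ξ (fun _ => w 0)) (η (fun _ => w 1)) -
      B (ξ (fun _ => w 1)) (η (fun _ => w 0)) := by
  rw [wedge_apply, Fin.sum_univ_two, removeNth_two_zero, removeNth_two_one]
  simp [sub_eq_add_neg]

theorem wedge_two_form (B : V →L[ℝ] W →L[ℝ] Z) (ξ : (𝔼 n) [⋀^Fin 1]→L[ℝ] V)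
    (η : (𝔼 n) [⋀^Fin 2]→L[ℝ] W) (w : Fin 3 → 𝔼 n) :
    wedge B ξ η w = B (ξ (fun _ => w 0)) (η ![w 1, w 2]) -
      B (ξ (fun _ => w 1)) (η ![w 0, w 2]) + B (ξ (fun _ => w 2)) (η ![w 0, w 1]) := by
  rw [wedge_apply, Fin.sum_univ_three, removeNth_three_zero, removeNth_three_one,
    removeNth_three_two]
  simp [sub_eq_add_neg]

theorem extDerivWithin_one_form {A : 𝔼 n → (𝔼 n) [⋀^Fin 1]→L[ℝ] V} {T : Set (𝔼 n)} {z : 𝔼 n}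
    (w : Fin 2 → 𝔼 n) :
    extDerivWithin A T z w = fderivWithin ℝ A T z (w 0) (fun _ => w 1) -
      fderivWithin ℝ A T z (w 1) (fun _ => w 0) := by
  rw [extDerivWithin, ContinuousAlternatingMap.alternatizeUncurryFin_apply, Fin.sum_univ_two,
    removeNth_two_zero, removeNth_two_one]
  simp [sub_eq_add_neg]

theorem extDerivWithin_two_form {A : 𝔼 n → (𝔼 n) [⋀^Fin 2]→L[ℝ] V} {T : Set (𝔼 n)} {z : 𝔼 n}
    (w : Fin 3 → 𝔼 n) :
    extDerivWithin A T z w = fderivWithin ℝ A T z (w 0) ![w 1, w 2] -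
      fderivWithin ℝ A T z (w 1) ![w 0, w 2] + fderivWithin ℝ A T z (w 2) ![w 0, w 1] := by
  rw [extDerivWithin, ContinuousAlternatingMap.alternatizeUncurryFin_apply, Fin.sum_univ_three,
    removeNth_three_zero, removeNth_three_one, removeNth_three_two]
  simp [sub_eq_add_neg]

theorem _root_.HasFDerivWithinAt.alternating_apply {k : ℕ} [FiniteDimensional ℝ V]
    {A : 𝔼 n → (𝔼 n) [⋀^Fin k]→L[ℝ] V}
    {A' : 𝔼 n →L[ℝ] (𝔼 n) [⋀^Fin k]→L[ℝ] V} {T : Set (𝔼 n)} {z : 𝔼 n}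
    (h : HasFDerivWithinAt A A' T z) (v : Fin k → 𝔼 n) :
    HasFDerivWithinAt (fun z => A z v) ((evalAlt V v).comp A') T z :=
  (evalAlt V v).hasFDerivAt.comp_hasFDerivWithinAt z h

end Low

section LieForms

variable {n : ℕ} {M : Type*} [TopologicalSpace M] [ChartedSpace (𝔼 n) M]
  [IsManifold (𝓡 n) ∞ M]
  {𝔤 : Type*} [NormedLieRing 𝔤] [NormedLieAlg 𝔤] [FiniteDimensional ℝ 𝔤]
  {S : Set M} {x : M}

theorem lieL_apply (a b : 𝔤) : lieL 𝔤 a b = ⁅a, b⁆ := rfl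

/-- By the product rule `d[A ∧ A] = [dA ∧ A] - [A ∧ dA]`, and `[dA ∧ A] = -[A ∧ dA]` by antisymmetry
of the bracket. -/
theorem extDerivWithin_wedge_lie {A : 𝔼 n → (𝔼 n) [⋀^Fin 1]→L[ℝ] 𝔤} {T : Set (𝔼 n)} {z : 𝔼 n}
    (hT : UniqueDiffWithinAt ℝ T z) (hA : DifferentiableWithinAt ℝ A T z) :
    extDerivWithin (fun z => wedge (lieL 𝔤) (A z) (A z)) T z =
      (-2 : ℝ) • wedge (lieL 𝔤) (A z) (extDerivWithin A T z) := by
  have hA' := hA.hasFDerivWithinAt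
  have hd : DifferentiableWithinAt ℝ (fun z => wedge (lieL 𝔤) (A z) (A z)) T z := by
    obtain ⟨m, v, g, hg⟩ := exists_leftInverse_eval (k := 2) (F := 𝔼 n) (V := 𝔤)
    have e : (fun z => wedge (lieL 𝔤) (A z) (A z)) =
        fun z => g (fun i => wedge (lieL 𝔤) (A z) (A z) (v i)) := funext fun z => (hg _).symm
    rw [e]
    refine g.differentiableAt.comp_differentiableWithinAt z (differentiableWithinAt_pi.2 fun i => ?_)
    simp only [wedge_one_form]
    have h0 := (hA'.alternating_apply (fun _ => v i 0)).differentiableWithinAt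
    have h1 := (hA'.alternating_apply (fun _ => v i 1)).differentiableWithinAt
    exact (((lieL 𝔤).differentiableAt.comp_differentiableWithinAt z h0).clm_apply h1).sub
      (((lieL 𝔤).differentiableAt.comp_differentiableWithinAt z h1).clm_apply h0)
  -- On a pair of vectors `[A ∧ A]` takes the value `2 [A w₀, A w₁]`, to which the product rule
  -- applies.
  have key : ∀ (u : 𝔼 n) (w : Fin 2 → 𝔼 n),
      fderivWithin ℝ (fun z => wedge (lieL 𝔤) (A z) (A z)) T z u w =
        (2 : ℝ) • (⁅fderivWithin ℝ A T z u (fun _ => w 0), A z (fun _ => w 1)⁆ +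
          ⁅A z (fun _ => w 0), fderivWithin ℝ A T z u (fun _ => w 1)⁆) := by
    intro u w
    have h1 := (hd.hasFDerivWithinAt.alternating_apply w).fderivWithin hT
    have hb := ((lieL 𝔤).hasFDerivWithinAt_of_bilinear
      (hA'.alternating_apply (fun _ => w 0)) (hA'.alternating_apply (fun _ => w 1))).const_smul
        (2 : ℝ)
    have e : (fun z => wedge (lieL 𝔤) (A z) (A z) w) =
        (2 : ℝ) • fun z => lieL 𝔤 (A z (fun _ => w 0)) (A z (fun _ => w 1)) := by
      funext z
      rw [wedge_one_form]
      simp only [lieL_apply, Pi.smul_apply]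
      rw [← lie_skew (A z fun _ => w 0), two_smul]
      abel
    rw [e, hb.fderivWithin hT] at h1
    have h2 := congrArg (fun l => l u) h1
    refine h2.symm.trans ?_
    simp only [smul_apply, add_apply]
    rw [add_comm]
    rfl
  ext w
  rw [extDerivWithin_two_form, ContinuousAlternatingMap.smul_apply, wedge_two_form, key, key, key]
  simp only [extDerivWithin_one_form, lieL_apply]
  simp only [Matrix.cons_val_zero, Matrix.cons_val_one]
  simp only [lie_sub]
  rw [← lie_skew (A z fun _ => w 2) (fderivWithin ℝ A T z (w 0) fun _ => w 1),
    ← lie_skew (A z fun _ => w 2) (fderivWithin ℝ A T z (w 1) fun _ => w 0),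
    ← lie_skew (A z fun _ => w 1) (fderivWithin ℝ A T z (w 2) fun _ => w 0)]
  module

/-- The covariant derivative with respect to a connection form. -/
def covD {k : ℕ} (S : Set M) (A : DForm n 1 M 𝔤) (ξ : DForm n k M 𝔤) : DForm n (k + 1) M 𝔤 :=
  fun x => extD S ξ x + wedge (lieL 𝔤) (A x) (ξ x)

/-- The curvature of a connection form. -/
def curvD (S : Set M) (A : DForm n 1 M 𝔤) : DForm n 2 M 𝔤 :=
  fun x => extD S A x + (1 / 2 : ℝ) • wedge (lieL 𝔤) (A x) (A x)

theorem SmoothFormOn.covD {k : ℕ} {A : DForm n 1 M 𝔤} {ξ : DForm n k M 𝔤} (hS : Regular n S)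
    (hA : SmoothFormOn S A) (hξ : SmoothFormOn S ξ) : SmoothFormOn S (covD S A ξ) :=
  (hξ.extD hS).add (hA.wedge (lieL 𝔤) hξ)

theorem SmoothFormOn.curvD {A : DForm n 1 M 𝔤} (hS : Regular n S)
    (hA : SmoothFormOn S A) : SmoothFormOn S (curvD S A) :=
  (hA.extD hS).add ((hA.wedge (lieL 𝔤) hA).smul (1 / 2))

theorem extD_wedge_lie {A : DForm n 1 M 𝔤} (hS : Regular n S) (hx : x ∈ S)
    (hA : SmoothFormOn S A) : extD S (fun x => wedge (lieL 𝔤) (A x) (A x)) x =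
      (-2 : ℝ) • wedge (lieL 𝔤) (A x) (extD S A x) := by
  have h := extDerivWithin_wedge_lie (uniqueDiffWithinAt_chartPart hS hx)
    ((hA.smoothFormAt hx).differentiableWithinAt (by simp))
  rw [inChart_self] at h
  unfold extD
  rw [inChart_wedge]
  exact h

/-- Up to a factor `2`, the value on three vectors is the cyclic sum in the Jacobi identity. -/
theorem wedge_lie_wedge_lie (a : (𝔼 n) [⋀^Fin 1]→L[ℝ] 𝔤) :
    wedge (lieL 𝔤) a (wedge (lieL 𝔤) a a) = 0 := by
  ext w
  rw [wedge_two_form]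
  simp only [wedge_one_form, lieL_apply, Matrix.cons_val_zero, Matrix.cons_val_one,
    ContinuousAlternatingMap.coe_zero, Pi.zero_apply]
  generalize (a fun _ => w 0) = p
  generalize (a fun _ => w 1) = q
  generalize (a fun _ => w 2) = r
  rw [← lie_skew r q, ← lie_skew p r, ← lie_skew q p]
  simp only [sub_neg_eq_add, lie_add, lie_sub, lie_neg]
  linear_combination (norm := module) (2 : ℝ) • lie_jacobi p q r

/-- The Bianchi identity. -/
theorem covD_curvD {A : DForm n 1 M 𝔤} (hS : Regular n S) (hx : x ∈ S)
    (hA : SmoothFormOn S A) : covD S A (curvD S A) x = 0 := by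
  have h1 : extD S (curvD S A) x = extD S (extD S A) x +
      (1 / 2 : ℝ) • extD S (fun x => wedge (lieL 𝔤) (A x) (A x)) x := by
    rw [← extD_smul hS hx]
    exact extD_add hS hx (hA.extD hS) ((hA.wedge (lieL 𝔤) hA).smul (1 / 2))
  rw [covD, h1, extD_extD hS hA hx, extD_wedge_lie hS hx hA, curvD, wedge_add_right,
    wedge_smul_right, wedge_lie_wedge_lie]
  module

/-- The square of the covariant derivative is the bracket with the curvature. -/
theorem covD_covD {A : DForm n 1 M 𝔤} {α : M → 𝔤} (hS : Regular n S) (hx : x ∈ S)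
    (hA : SmoothFormOn S A) (hα : SmoothFormOn (n := n) S (zeroForm α)) :
    covD S A (covD S A (zeroForm α)) x =
      ((lieL 𝔤).flip (α x)).compContinuousAlternatingMap (curvD S A x) := by
  -- The bracket of a `1`-form with a function is rewritten with the function in the first slot,
  -- where the Leibniz rule `extD_bilin` expects it.
  have e : (fun x => wedge (lieL 𝔤) (A x) (zeroForm (n := n) α x)) = bilin (lieL 𝔤).flip α A := by
    funext x
    ext w
    rw [wedge_zero_form]
    simp only [bilin, zeroForm, ContinuousLinearMap.compContinuousAlternatingMap_coe,
      Function.comp_apply, ContinuousLinearMap.flip_apply]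
    congr 2
    congr 1
    funext j
    fin_cases j
    rfl
  have h1 : extD S (covD S A (zeroForm α)) x = extD S (extD (n := n) S (zeroForm α)) x +
      extD S (bilin (lieL 𝔤).flip α A) x := by
    rw [← e]
    exact extD_add hS hx (hα.extD hS) (hA.wedge (lieL 𝔤) hα)
  rw [covD, h1, extD_extD hS hα hx, extD_bilin _ hS hx hα hA, curvD, covD, wedge_add_right]
  ext w
  simp only [ContinuousAlternatingMap.add_apply, wedge_one_form, wedge_zero_form,
    ContinuousLinearMap.compContinuousAlternatingMap_coe, Function.comp_apply,
    ContinuousLinearMap.flip_apply, lieL_apply, zeroForm, ContinuousAlternatingMap.coe_zero, Pi.zero_apply,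
    ContinuousAlternatingMap.smul_apply, ContinuousAlternatingMap.constOfIsEmpty_apply]
  generalize (A x fun _ => w 0) = p
  generalize (A x fun _ => w 1) = q
  generalize hr : α x = r
  simp only [add_lie, smul_lie, lie_lie, sub_lie]
  have h2 : ∀ a b : 𝔤, (1 / 2 : ℝ) • (a - b - (b - a)) = a - b := fun a b => by module
  rw [h2]
  abel

/-- `d` is a derivation of the bracket by the Leibniz rule, and `[A, ·]` is one by the Jacobi
identity. -/
theorem covD_bracket {A : DForm n 1 M 𝔤} {α β : M → 𝔤} (hS : Regular n S) (hx : x ∈ S)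
    (hα : SmoothFormOn (n := n) S (zeroForm α)) (hβ : SmoothFormOn (n := n) S (zeroForm β)) :
    covD S A (zeroForm fun x => ⁅α x, β x⁆) x =
      ((lieL 𝔤).flip (β x)).compContinuousAlternatingMap (covD S A (zeroForm α) x) +
      (lieL 𝔤 (α x)).compContinuousAlternatingMap (covD S A (zeroForm β) x) := by
  have e : zeroForm (n := n) (fun x => ⁅α x, β x⁆) = bilin (lieL 𝔤) α (zeroForm β) := by
    funext x
    ext w
    rfl
  have h1 := extD_bilin (lieL 𝔤) hS hx hα hβ
  rw [covD, e, h1, ← e, covD, covD]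
  ext w
  simp only [ContinuousAlternatingMap.add_apply, wedge_zero_form,
    ContinuousLinearMap.compContinuousAlternatingMap_coe, Function.comp_apply,
    ContinuousLinearMap.flip_apply, lieL_apply, zeroForm,
    ContinuousAlternatingMap.constOfIsEmpty_apply]
  have hw : w = fun _ => w 0 := by funext j; fin_cases j; rfl
  rw [← hw]
  simp only [add_lie, lie_add, leibniz_lie (A x w) (α x) (β x)]
  abel

/-- Stokes' integrand: `d⟨α, η⟩ = ⟨d_A α ∧ η⟩ + ⟨α, d_A η⟩`. -/
theorem extD_pairing (B : LieMetric 𝔤) {A : DForm n 1 M 𝔤} {α : M → 𝔤} {η : DForm n 2 M 𝔤}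
    (hS : Regular n S) (hx : x ∈ S)
    (hα : SmoothFormOn (n := n) S (zeroForm α)) (hη : SmoothFormOn S η) :
    extD S (bilin B.toL α η) x = wedge B.toL (covD S A (zeroForm α) x) (η x) +
      (B.toL (α x)).compContinuousAlternatingMap (covD S A η x) := by
  rw [extD_bilin _ hS hx hα hη, covD, covD]
  ext w
  simp only [ContinuousAlternatingMap.add_apply, wedge_zero_form, wedge_two_form,
    ContinuousLinearMap.compContinuousAlternatingMap_coe, Function.comp_apply,
    lieL_apply, zeroForm, ContinuousAlternatingMap.constOfIsEmpty_apply, map_add, map_sub,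
    add_apply]
  -- Invariance makes the terms with `A` in `d_A α` and in `d_A η` cancel; what remains is the
  -- ordinary Leibniz rule.
  have hB : ∀ p q r : 𝔤, B.toL ⁅p, q⁆ r = - B.toL q ⁅p, r⁆ := fun p q r => by
    rw [← lie_skew, map_neg, neg_apply]
    exact congrArg Neg.neg (B.invariant q p r)
  simp only [hB]
  abel

end LieForms


/-! ### The adjoint representation and the Maurer-Cartan form of a Lie group -/

section Helpers

variable {n : ℕ} {M : Type*} [TopologicalSpace M] [ChartedSpace (𝔼 n) M] [IsManifold (𝓡 n) ∞ M]
  {E H N : Type*} [NormedAddCommGroup E] [NormedSpace ℝ E] [TopologicalSpace H]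
  {I : ModelWithCorners ℝ E H} [TopologicalSpace N] [ChartedSpace H N]
  {F : Type*} [NormedAddCommGroup F] [NormedSpace ℝ F]

/-- The preferred chart at `a` defines the coordinates of the tangent space at `a`, hence has
derivative the identity there. -/
theorem tderiv_comp_symm_self {f : M → N} (a : M) (hf : MDifferentiableAt (𝓡 n) I f a) :
    tderiv 𝓘(ℝ, 𝔼 n) I (f ∘ (extChartAt (𝓡 n) a).symm) (extChartAt (𝓡 n) a a) =
      tderiv (𝓡 n) I f a := by
  have h := contMDiffAt_extChartAt_symm (n := n) (mem_extChartAt_target (I := 𝓡 n) a)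
  rw [tderiv_comp (I' := 𝓡 n) (by rwa [extChartAt_to_inv]) (h.mdifferentiableAt (by simp)),
    tderiv_extChartAt_symm_self, extChartAt_to_inv]
  rfl

theorem tderiv_extChartAt_self (a : M) :
    tderiv (𝓡 n) 𝓘(ℝ, 𝔼 n) (extChartAt (𝓡 n) a) a = ContinuousLinearMap.id ℝ (𝔼 n) := by
  rw [← tderiv_comp_symm_self a ((contMDiffAt_extChartAt_of_mem
    (mem_extChartAt_source a)).mdifferentiableAt (by simp)), tderiv_eq_fderiv]
  have : (extChartAt (𝓡 n) a ∘ (extChartAt (𝓡 n) a).symm) =ᶠ[𝓝 (extChartAt (𝓡 n) a a)] id := by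
    filter_upwards [target_mem_nhds (n := n) (mem_extChartAt_target (I := 𝓡 n) a)] with w hw
    exact (extChartAt (𝓡 n) a).right_inv hw
  rw [this.fderiv_eq, fderiv_id]

theorem tderiv_eq_fderiv_of_eq {ψ : F → M} {z : F} {c : M}
    (hψ : ContMDiffAt 𝓘(ℝ, F) (𝓡 n) ∞ ψ z) (hc : ψ z = c) :
    tderiv 𝓘(ℝ, F) (𝓡 n) ψ z = fderiv ℝ (extChartAt (𝓡 n) c ∘ ψ) z := by
  subst hc
  exact tderiv_eq_fderiv_extChartAt_comp hψ

theorem contMDiffAt_of_comp_symm {f : M → F} {c : M}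
    (h : ContDiffAt ℝ ∞ (f ∘ (extChartAt (𝓡 n) c).symm) (extChartAt (𝓡 n) c c)) :
    ContMDiffAt (𝓡 n) 𝓘(ℝ, F) ∞ f c := by
  have h1 := (contMDiffAt_iff_contDiffAt.2 h).comp c
    (contMDiffAt_extChartAt_of_mem (mem_extChartAt_source (I := 𝓡 n) c))
  refine h1.congr_of_eventuallyEq ?_
  filter_upwards [(isOpen_extChartAt_source (I := 𝓡 n) c).mem_nhds (mem_extChartAt_source c)]
    with x hx
  simp only [Function.comp_apply, (extChartAt (𝓡 n) c).left_inv hx]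

end Helpers

/-- The manifold derivative within a set, as a map between the model vector spaces. -/
def tderivWithin {E H M E' H' M' : Type*}
    [NormedAddCommGroup E] [NormedSpace ℝ E] [TopologicalSpace H]
    [TopologicalSpace M] [ChartedSpace H M]
    [NormedAddCommGroup E'] [NormedSpace ℝ E'] [TopologicalSpace H']
    [TopologicalSpace M'] [ChartedSpace H' M'] (I : ModelWithCorners ℝ E H)
    (I' : ModelWithCorners ℝ E' H') (f : M → M') (s : Set M) (x : M) : E →L[ℝ] E' :=
  mfderivWithin I I' f s x

section LieGroup

variable (d : ℕ) {G : Type*} [TopologicalSpace G] [ChartedSpace (𝔼 d) G] [Group G]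
  [LieGroup (𝓡 d) ∞ G]

/-- The derivative at `1` of conjugation by `g`. -/
def conjD (g : G) : 𝔼 d →L[ℝ] 𝔼 d := tderiv (𝓡 d) (𝓡 d) (fun x : G => g * x * g⁻¹) 1

/-- The derivative at `1` of left translation by `g`. -/
def leftD (g : G) : 𝔼 d →L[ℝ] 𝔼 d := tderiv (𝓡 d) (𝓡 d) (fun x : G => g * x) 1

/-- The Maurer-Cartan form at `g`. -/
def mcD (g : G) : 𝔼 d →L[ℝ] 𝔼 d := tderiv (𝓡 d) (𝓡 d) (fun x : G => g⁻¹ * x) g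

/-- The bracket of the Lie algebra of `G`, on the model space. -/
def brD (G : Type*) [TopologicalSpace G] [ChartedSpace (𝔼 d) G] [Group G]
    [LieGroup (𝓡 d) ∞ G] (a b : 𝔼 d) : 𝔼 d :=
  @Bracket.bracket (GroupLieAlgebra (𝓡 d) G) (GroupLieAlgebra (𝓡 d) G) _ a b

theorem contMDiff_conj (g : G) : ContMDiff (𝓡 d) (𝓡 d) ∞ (fun x : G => g * x * g⁻¹) :=
  (contMDiff_const.mul contMDiff_id).mul contMDiff_const

theorem contMDiff_left (g : G) : ContMDiff (𝓡 d) (𝓡 d) ∞ (fun x : G => g * x) :=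
  contMDiff_const.mul contMDiff_id

theorem conjD_mul (g h : G) : conjD d (g * h) = (conjD d g).comp (conjD d h) := by
  have e : (fun x : G => g * h * x * (g * h)⁻¹) =
      (fun x => g * x * g⁻¹) ∘ (fun x => h * x * h⁻¹) := by
    funext x; simp [mul_assoc]
  unfold conjD
  rw [e, tderiv_comp (I' := 𝓡 d) ((contMDiff_conj d g).mdifferentiable (by simp) _)
    ((contMDiff_conj d h).mdifferentiable (by simp) _)]
  congr 2
  simp

theorem conjD_one : conjD d (1 : G) = ContinuousLinearMap.id ℝ _ := by
  have e : (fun x : G => 1 * x * 1⁻¹) = id := by funext x; simp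
  rw [conjD, e, tderiv_id]

theorem mcD_comp_leftD (g : G) : (mcD d g).comp (leftD d g) = ContinuousLinearMap.id ℝ _ := by
  have e : (fun x : G => g⁻¹ * x) ∘ (fun x => g * x) = id := by funext x; simp
  have h := tderiv_comp (I := 𝓡 d) (I' := 𝓡 d) (I'' := 𝓡 d) (x := (1 : G))
    ((contMDiff_left d g⁻¹).mdifferentiable (by simp) (g * 1))
    ((contMDiff_left d g).mdifferentiable (by simp) 1)
  rw [e, tderiv_id, mul_one] at h
  exact h.symm

theorem leftD_comp_mcD (g : G) : (leftD d g).comp (mcD d g) = ContinuousLinearMap.id ℝ _ := by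
  have e : (fun x : G => g * x) ∘ (fun x => g⁻¹ * x) = id := by funext x; simp
  have h := tderiv_comp (I := 𝓡 d) (I' := 𝓡 d) (I'' := 𝓡 d) (x := g)
    ((contMDiff_left d g).mdifferentiable (by simp) (g⁻¹ * g))
    ((contMDiff_left d g⁻¹).mdifferentiable (by simp) g)
  rw [e, tderiv_id, inv_mul_cancel] at h
  exact h.symm

/-- The left-invariant vector fields in the preferred chart at `c`. -/
def chartField (c : G) (p : 𝔼 d) : 𝔼 d →L[ℝ] 𝔼 d :=
  fderiv ℝ (fun q => extChartAt (𝓡 d) c ((extChartAt (𝓡 d) c).symm p *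
    (extChartAt (𝓡 d) (1 : G)).symm q)) (extChartAt (𝓡 d) (1 : G) 1)

theorem contMDiffAt_symm_mul_symm {a b : G} {z : 𝔼 d × 𝔼 d}
    (ha : z.1 ∈ (extChartAt (𝓡 d) a).target) (hb : z.2 ∈ (extChartAt (𝓡 d) b).target) :
    ContMDiffAt 𝓘(ℝ, 𝔼 d × 𝔼 d) (𝓡 d) ∞ (fun z : 𝔼 d × 𝔼 d =>
      (extChartAt (𝓡 d) a).symm z.1 * (extChartAt (𝓡 d) b).symm z.2) z := by
  have h1 : ContMDiffAt 𝓘(ℝ, 𝔼 d × 𝔼 d) 𝓘(ℝ, 𝔼 d) ∞ (fun z : 𝔼 d × 𝔼 d => z.1) z :=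
    contDiffAt_fst.contMDiffAt
  have h2 : ContMDiffAt 𝓘(ℝ, 𝔼 d × 𝔼 d) 𝓘(ℝ, 𝔼 d) ∞ (fun z : 𝔼 d × 𝔼 d => z.2) z :=
    contDiffAt_snd.contMDiffAt
  exact ((contMDiffAt_extChartAt_symm ha).comp z h1).mul ((contMDiffAt_extChartAt_symm hb).comp z h2)

theorem contDiffAt_chart_mul {c : G} {p : 𝔼 d} (hp : p ∈ (extChartAt (𝓡 d) c).target) :
    ContDiffAt ℝ ∞ (fun z : 𝔼 d × 𝔼 d => extChartAt (𝓡 d) c ((extChartAt (𝓡 d) c).symm z.1 *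
      (extChartAt (𝓡 d) (1 : G)).symm z.2)) (p, extChartAt (𝓡 d) (1 : G) 1) := by
  refine contDiffAt_extChartAt_comp
    (contMDiffAt_symm_mul_symm d hp (mem_extChartAt_target (I := 𝓡 d) (1 : G))) ?_
  simp only [extChartAt_to_inv, mul_one]
  exact (extChartAt (𝓡 d) c).map_target hp

/-- A partial derivative in one variable of a smooth function of two variables is smooth in the
other. -/
theorem contDiffAt_chartField {c : G} {p : 𝔼 d} (hp : p ∈ (extChartAt (𝓡 d) c).target) :
    ContDiffAt ℝ ∞ (chartField d c) p :=
  ContDiffAt.fderiv (m := ∞) (n := ∞) (f := fun p q => extChartAt (𝓡 d) c ((extChartAt (𝓡 d) c).symm p *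
      (extChartAt (𝓡 d) (1 : G)).symm q)) (contDiffAt_chart_mul d hp) contDiffAt_const (by simp)

theorem tderiv_symm_comp_chartField {c : G} {p : 𝔼 d} (hp : p ∈ (extChartAt (𝓡 d) c).target) :
    (tderiv 𝓘(ℝ, 𝔼 d) (𝓡 d) (extChartAt (𝓡 d) c).symm p).comp (chartField d c p) =
      leftD d ((extChartAt (𝓡 d) c).symm p) := by
  set g := (extChartAt (𝓡 d) c).symm p with hg
  have e0 := mem_extChartAt_target (I := 𝓡 d) (1 : G)
  have hψ : ContMDiffAt 𝓘(ℝ, 𝔼 d) (𝓡 d) ∞ ((fun x : G => g * x) ∘ (extChartAt (𝓡 d) (1 : G)).symm)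
      (extChartAt (𝓡 d) (1 : G) 1) :=
    (contMDiff_left d g).contMDiffAt.comp _ (contMDiffAt_extChartAt_symm e0)
  have hz : ((fun x : G => g * x) ∘ (extChartAt (𝓡 d) (1 : G)).symm)
      (extChartAt (𝓡 d) (1 : G) 1) = g := by simp
  have h1 := tderiv_eq_tangentCoordChange_comp (c := c) hψ (by
    rw [hz]; exact (extChartAt (𝓡 d) c).map_target hp)
  rw [tderiv_comp_symm_self _ ((contMDiff_left d g).mdifferentiable (by simp) 1), hz] at h1
  rw [tderiv_extChartAt_symm hp, leftD, h1]
  rfl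

theorem inverse_tderiv_symm_apply {c : G} {p : 𝔼 d} (hp : p ∈ (extChartAt (𝓡 d) c).target)
    (a : 𝔼 d) : (tderiv 𝓘(ℝ, 𝔼 d) (𝓡 d) (extChartAt (𝓡 d) c).symm p).inverse
      (leftD d ((extChartAt (𝓡 d) c).symm p) a) = chartField d c p a := by
  have hi : (tderiv 𝓘(ℝ, 𝔼 d) (𝓡 d) (extChartAt (𝓡 d) c).symm p).IsInvertible := by
    have h := isInvertible_mfderivWithin_extChartAt_symm (I := 𝓡 d) hp
    rw [ModelWithCorners.Boundaryless.range_eq_univ, mfderivWithin_univ] at h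
    exact h
  rw [← tderiv_symm_comp_chartField d hp]
  exact hi.inverse_apply_eq.2 rfl

/-- The pullback of a left-invariant vector field under the inverse of the preferred chart. -/
def pulledField (c : G) (a p : 𝔼 d) : 𝔼 d :=
  (tderivWithin 𝓘(ℝ, 𝔼 d) (𝓡 d) (extChartAt (𝓡 d) c).symm (range (𝓡 d)) p).inverse
    (leftD d ((extChartAt (𝓡 d) c).symm p) a)

/-- The bracket of left-invariant fields is the left-invariant field of the bracket. At `c`, in the
preferred chart there, it becomes the commutator of the coordinate fields `chartField`. -/
theorem leftD_brD (c : G) (a b : 𝔼 d) :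
    leftD d c (brD d G a b) =
      fderiv ℝ (fun p => chartField d c p b) (extChartAt (𝓡 d) c c)
        (chartField d c (extChartAt (𝓡 d) c c) a) -
      fderiv ℝ (fun p => chartField d c p a) (extChartAt (𝓡 d) c c)
        (chartField d c (extChartAt (𝓡 d) c c) b) := by
  have h := congrFun (mulInvariantVector_mlieBracket (I := 𝓡 d) (G := G) a b) c
  have h' : leftD d c (brD d G a b) = (tderiv (𝓡 d) 𝓘(ℝ, 𝔼 d) (extChartAt (𝓡 d) c) c).inverse
    (VectorField.lieBracketWithin ℝ (pulledField d c a) (pulledField d c b)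
      ((extChartAt (𝓡 d) c).symm ⁻¹' univ ∩ range (𝓡 d)) (extChartAt (𝓡 d) c c)) := h
  have key : ∀ a : 𝔼 d, pulledField d c a
      =ᶠ[𝓝 (extChartAt (𝓡 d) c c)] fun p => chartField d c p a := by
    intro a
    filter_upwards [target_mem_nhds (n := d) (mem_extChartAt_target (I := 𝓡 d) c)] with p hp
    rw [← inverse_tderiv_symm_apply d hp, pulledField, ModelWithCorners.Boundaryless.range_eq_univ,
      tderivWithin, mfderivWithin_univ]
    rfl
  rw [h', tderiv_extChartAt_self, ContinuousLinearMap.inverse_id,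
    preimage_univ, univ_inter, ModelWithCorners.Boundaryless.range_eq_univ,
    VectorField.lieBracketWithin_univ, (key a).lieBracket_vectorField_eq (key b)]
  rfl

end LieGroup


section LieGroup

variable (d : ℕ) {G : Type*} [TopologicalSpace G] [ChartedSpace (𝔼 d) G] [Group G]
  [LieGroup (𝓡 d) ∞ G]

theorem conjD_symm_eq {c : G} {p : 𝔼 d} :
    conjD d ((extChartAt (𝓡 d) c).symm p) = fderiv ℝ (fun q => extChartAt (𝓡 d) (1 : G)
      ((extChartAt (𝓡 d) c).symm p * (extChartAt (𝓡 d) (1 : G)).symm q *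
        ((extChartAt (𝓡 d) c).symm p)⁻¹)) (extChartAt (𝓡 d) (1 : G) 1) := by
  set g := (extChartAt (𝓡 d) c).symm p
  have e0 := mem_extChartAt_target (I := 𝓡 d) (1 : G)
  have hψ : ContMDiffAt 𝓘(ℝ, 𝔼 d) (𝓡 d) ∞
      ((fun x : G => g * x * g⁻¹) ∘ (extChartAt (𝓡 d) (1 : G)).symm)
      (extChartAt (𝓡 d) (1 : G) 1) :=
    (contMDiff_conj d g).contMDiffAt.comp _ (contMDiffAt_extChartAt_symm e0)
  rw [conjD, ← tderiv_comp_symm_self _ ((contMDiff_conj d g).mdifferentiable (by simp) 1),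
    tderiv_eq_fderiv_of_eq hψ (c := 1) (by simp)]
  rfl

theorem contDiffAt_conjD_symm (c : G) :
    ContDiffAt ℝ ∞ (conjD d ∘ (extChartAt (𝓡 d) c).symm) (extChartAt (𝓡 d) c c) := by
  have e : conjD d ∘ (extChartAt (𝓡 d) c).symm = fun p => fderiv ℝ (fun q =>
      extChartAt (𝓡 d) (1 : G) ((extChartAt (𝓡 d) c).symm p *
        (extChartAt (𝓡 d) (1 : G)).symm q * ((extChartAt (𝓡 d) c).symm p)⁻¹))
        (extChartAt (𝓡 d) (1 : G) 1) := funext fun p => conjD_symm_eq d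
  rw [e]
  refine ContDiffAt.fderiv (m := ∞) (n := ∞) (f := fun p q => extChartAt (𝓡 d) (1 : G)
      ((extChartAt (𝓡 d) c).symm p * (extChartAt (𝓡 d) (1 : G)).symm q *
        ((extChartAt (𝓡 d) c).symm p)⁻¹)) ?_ contDiffAt_const (by simp)
  have hc := mem_extChartAt_target (I := 𝓡 d) c
  have h1 := contMDiffAt_symm_mul_symm d (a := c) (b := (1 : G))
    (z := (extChartAt (𝓡 d) c c, extChartAt (𝓡 d) (1 : G) 1)) hc
    (mem_extChartAt_target (I := 𝓡 d) (1 : G))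
  have h2 : ContMDiffAt 𝓘(ℝ, 𝔼 d × 𝔼 d) 𝓘(ℝ, 𝔼 d) ∞ (fun z : 𝔼 d × 𝔼 d => z.1)
      (extChartAt (𝓡 d) c c, extChartAt (𝓡 d) (1 : G) 1) := contDiffAt_fst.contMDiffAt
  have h3 := h1.mul ((contMDiffAt_extChartAt_symm hc).comp
    (extChartAt (𝓡 d) c c, extChartAt (𝓡 d) (1 : G) 1) h2).inv
  refine contDiffAt_extChartAt_comp h3 ?_
  simp

theorem leftD_one : leftD d (1 : G) = ContinuousLinearMap.id ℝ _ := by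
  have e : (fun x : G => 1 * x) = id := by funext x; simp
  rw [leftD, e, tderiv_id]

theorem chartField_self (c : G) : chartField d c (extChartAt (𝓡 d) c c) = leftD d c := by
  have h := tderiv_symm_comp_chartField d (mem_extChartAt_target (I := 𝓡 d) c)
  rw [tderiv_extChartAt_symm_self, ContinuousLinearMap.id_comp, extChartAt_to_inv] at h
  exact h

/-- The right-invariant vector fields in the preferred chart at `1`. -/
def chartFieldR (G : Type*) [TopologicalSpace G] [ChartedSpace (𝔼 d) G] [Group G]
    [LieGroup (𝓡 d) ∞ G] (p : 𝔼 d) : 𝔼 d →L[ℝ] 𝔼 d :=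
  fderiv ℝ (fun q => extChartAt (𝓡 d) (1 : G) ((extChartAt (𝓡 d) (1 : G)).symm q *
    (extChartAt (𝓡 d) (1 : G)).symm p)) (extChartAt (𝓡 d) (1 : G) 1)

theorem tderiv_symm_comp_chartFieldR {p : 𝔼 d} (hp : p ∈ (extChartAt (𝓡 d) (1 : G)).target) :
    (tderiv 𝓘(ℝ, 𝔼 d) (𝓡 d) (extChartAt (𝓡 d) (1 : G)).symm p).comp (chartFieldR d G p) =
      tderiv (𝓡 d) (𝓡 d) (fun x : G => x * (extChartAt (𝓡 d) (1 : G)).symm p) 1 := by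
  set g := (extChartAt (𝓡 d) (1 : G)).symm p with hg
  have e0 := mem_extChartAt_target (I := 𝓡 d) (1 : G)
  have hr : ContMDiff (𝓡 d) (𝓡 d) ∞ (fun x : G => x * g) := contMDiff_id.mul contMDiff_const
  have hψ : ContMDiffAt 𝓘(ℝ, 𝔼 d) (𝓡 d) ∞ ((fun x : G => x * g) ∘ (extChartAt (𝓡 d) (1 : G)).symm)
      (extChartAt (𝓡 d) (1 : G) 1) := hr.contMDiffAt.comp _ (contMDiffAt_extChartAt_symm e0)
  have hz : ((fun x : G => x * g) ∘ (extChartAt (𝓡 d) (1 : G)).symm)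
      (extChartAt (𝓡 d) (1 : G) 1) = g := by simp
  have h1 := tderiv_eq_tangentCoordChange_comp (c := (1 : G)) hψ (by
    rw [hz]; exact (extChartAt (𝓡 d) (1 : G)).map_target hp)
  rw [tderiv_comp_symm_self _ (hr.mdifferentiable (by simp) 1), hz] at h1
  rw [tderiv_extChartAt_symm hp, h1]
  rfl

/-- Since `g x = (g x g⁻¹) g`, left translation is conjugation followed by right translation. The
derivative of `Ad` can therefore be read off from those of the left- and right-invariant fields. -/
theorem chartFieldR_comp_conjD {p : 𝔼 d} (hp : p ∈ (extChartAt (𝓡 d) (1 : G)).target) :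
    (chartFieldR d G p).comp (conjD d ((extChartAt (𝓡 d) (1 : G)).symm p)) =
      chartField d (1 : G) p := by
  set g := (extChartAt (𝓡 d) (1 : G)).symm p with hg
  have hr : ContMDiff (𝓡 d) (𝓡 d) ∞ (fun x : G => x * g) := contMDiff_id.mul contMDiff_const
  have e : (fun x : G => x * g) ∘ (fun x => g * x * g⁻¹) = fun x => g * x := by
    funext x; simp
  have h := tderiv_comp (I := 𝓡 d) (I' := 𝓡 d) (I'' := 𝓡 d) (x := (1 : G))
    (hr.mdifferentiable (by simp) (g * 1 * g⁻¹)) ((contMDiff_conj d g).mdifferentiable (by simp) 1)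
  rw [e, mul_one, mul_inv_cancel, ← tderiv_symm_comp_chartFieldR d hp] at h
  have h2 := tderiv_symm_comp_chartField d hp
  have hi : Function.Injective
      (tderiv 𝓘(ℝ, 𝔼 d) (𝓡 d) (extChartAt (𝓡 d) (1 : G)).symm p) := by
    have h := isInvertible_mfderivWithin_extChartAt_symm (I := 𝓡 d) hp
    rw [ModelWithCorners.Boundaryless.range_eq_univ, mfderivWithin_univ] at h
    exact h.injective
  ext1 v
  apply hi
  exact (congrArg (fun l => l v) h).symm.trans (congrArg (fun l => l v) h2).symm

/-- The derivative of the adjoint representation is the bracket. -/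
theorem fderiv_conjD (a v : 𝔼 d) :
    fderiv ℝ (conjD d ∘ (extChartAt (𝓡 d) (1 : G)).symm) (extChartAt (𝓡 d) (1 : G) 1) a v =
      brD d G a v := by
  set e0 := extChartAt (𝓡 d) (1 : G) 1 with he0
  have he := mem_extChartAt_target (I := 𝓡 d) (1 : G)
  -- Multiplication in the chart at `1`. The left- and right-invariant fields are its partial
  -- derivatives in the second and in the first argument, so their derivatives at `e0` are mixed
  -- parts of the second derivative `D`.
  set m : 𝔼 d × 𝔼 d → 𝔼 d := fun z => extChartAt (𝓡 d) (1 : G) ((extChartAt (𝓡 d) (1 : G)).symm z.1 *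
      (extChartAt (𝓡 d) (1 : G)).symm z.2) with hm
  have hsm : ∀ z : 𝔼 d × 𝔼 d, z.1 ∈ (extChartAt (𝓡 d) (1 : G)).target →
      z.2 ∈ (extChartAt (𝓡 d) (1 : G)).target → (z.1 = e0 ∨ z.2 = e0) → ContDiffAt ℝ ∞ m z := by
    intro z h1 h2 h3
    refine contDiffAt_extChartAt_comp (contMDiffAt_symm_mul_symm d h1 h2) ?_
    rcases h3 with h3 | h3
    · simp only [h3, he0, extChartAt_to_inv, one_mul]
      exact (extChartAt (𝓡 d) (1 : G)).map_target h2
    · simp only [h3, he0, extChartAt_to_inv, mul_one]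
      exact (extChartAt (𝓡 d) (1 : G)).map_target h1
  have hm0 : ContDiffAt ℝ ∞ m (e0, e0) := hsm _ he he (Or.inl rfl)
  have hM : chartField d (1 : G) =ᶠ[𝓝 e0] fun p => (fderiv ℝ m (p, e0)).comp
      (ContinuousLinearMap.inr ℝ (𝔼 d) (𝔼 d)) := by
    filter_upwards [target_mem_nhds (n := d) he] with p hp
    have h1 := ((hsm (p, e0) hp he (Or.inr rfl)).differentiableAt (by simp)).hasFDerivAt
    exact (h1.comp e0 (hasFDerivAt_prodMk_right p e0)).fderiv
  have hR : chartFieldR d G =ᶠ[𝓝 e0] fun p => (fderiv ℝ m (e0, p)).comp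
      (ContinuousLinearMap.inl ℝ (𝔼 d) (𝔼 d)) := by
    filter_upwards [target_mem_nhds (n := d) he] with p hp
    have h1 := ((hsm (e0, p) he hp (Or.inl rfl)).differentiableAt (by simp)).hasFDerivAt
    exact (HasFDerivAt.comp (f := fun q : 𝔼 d => (q, p)) e0 h1 (hasFDerivAt_prodMk_left e0 p)).fderiv
  have hD : HasFDerivAt (fderiv ℝ m) (fderiv ℝ (fderiv ℝ m) (e0, e0)) (e0, e0) :=
    ((hm0.fderiv_right (m := ∞) (by simp)).differentiableAt (by simp)).hasFDerivAt
  set D := fderiv ℝ (fderiv ℝ m) (e0, e0) with hDdef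
  have hM' : HasFDerivAt (chartField d (1 : G))
      (((ContinuousLinearMap.compL ℝ (𝔼 d) (𝔼 d × 𝔼 d) (𝔼 d)).flip
        (ContinuousLinearMap.inr ℝ (𝔼 d) (𝔼 d))).comp
          (D.comp (ContinuousLinearMap.inl ℝ (𝔼 d) (𝔼 d)))) e0 := by
    refine HasFDerivAt.congr_of_eventuallyEq ?_ hM
    exact (((ContinuousLinearMap.compL ℝ (𝔼 d) (𝔼 d × 𝔼 d) (𝔼 d)).flip
        (ContinuousLinearMap.inr ℝ (𝔼 d) (𝔼 d))).hasFDerivAt).comp e0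
        (HasFDerivAt.comp (f := fun q : 𝔼 d => (q, e0)) e0 hD (hasFDerivAt_prodMk_left e0 e0))
  have hR' : HasFDerivAt (chartFieldR d G)
      (((ContinuousLinearMap.compL ℝ (𝔼 d) (𝔼 d × 𝔼 d) (𝔼 d)).flip
        (ContinuousLinearMap.inl ℝ (𝔼 d) (𝔼 d))).comp
          (D.comp (ContinuousLinearMap.inr ℝ (𝔼 d) (𝔼 d)))) e0 := by
    refine HasFDerivAt.congr_of_eventuallyEq ?_ hR
    exact (((ContinuousLinearMap.compL ℝ (𝔼 d) (𝔼 d × 𝔼 d) (𝔼 d)).flip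
        (ContinuousLinearMap.inl ℝ (𝔼 d) (𝔼 d))).hasFDerivAt).comp e0
        (hD.comp e0 (hasFDerivAt_prodMk_right e0 e0))
  have hC : HasFDerivAt (conjD d ∘ (extChartAt (𝓡 d) (1 : G)).symm) _ e0 :=
    ((contDiffAt_conjD_symm d (1 : G)).differentiableAt (by simp)).hasFDerivAt
  have hRC : (fun p => (chartFieldR d G p).comp ((conjD d ∘ (extChartAt (𝓡 d) (1 : G)).symm) p))
      =ᶠ[𝓝 e0] chartField d (1 : G) := by
    filter_upwards [target_mem_nhds (n := d) he] with p hp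
    exact chartFieldR_comp_conjD d hp
  -- The identity `R ∘ Ad = L` is differentiated at `e0`, where all three maps are the identity: `dR
  -- + dAd = dL`.
  have h1 := ((hR'.clm_comp hC).congr_of_eventuallyEq hRC.symm).unique hM'
  have hC0 : (conjD d ∘ (extChartAt (𝓡 d) (1 : G)).symm) e0 = ContinuousLinearMap.id ℝ _ := by
    rw [Function.comp_apply, he0, extChartAt_to_inv, conjD_one]
  have hM0 : chartField d (1 : G) e0 = ContinuousLinearMap.id ℝ _ := by
    rw [he0, chartField_self, leftD_one]
  have hR0 : chartFieldR d G e0 = ContinuousLinearMap.id ℝ _ := by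
    have h := hRC.self_of_nhds
    simp only [hC0, hM0, ContinuousLinearMap.comp_id] at h
    exact h
  have h2 := congrArg (fun l => l a v) h1
  rw [hC0, hR0] at h2
  have h3 := leftD_brD d (1 : G) a v
  have hap : ∀ w u : 𝔼 d, fderiv ℝ (fun p => chartField d (1 : G) p w) e0 u = D (u, 0) (0, w) := by
    intro w u
    have := (hM'.clm_apply (hasFDerivAt_const w e0)).fderiv
    rw [this]
    simp
  -- So far `dAd(a) v = D (a, 0) (0, v) - D (0, a) (v, 0)`; symmetry of the second derivative turns
  -- this into the commutator in `leftD_brD`.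
  have hsymm : D (0, a) (v, 0) = D (v, 0) (0, a) :=
    (hm0.isSymmSndFDerivAt minSmoothness_two_le) (0, a) (v, 0)
  rw [← he0, hap, hap, hM0, leftD_one] at h3
  simp at h2 h3
  rw [h3, ← hsymm, ← h2]
  simp [he0]

/-! ### The Maurer-Cartan form -/

/-- The Maurer-Cartan form as a form on `G`. -/
def mcForm (G : Type*) [TopologicalSpace G] [ChartedSpace (𝔼 d) G] [Group G]
    [LieGroup (𝓡 d) ∞ G] : DForm d 1 G (𝔼 d) := fun g =>
  ContinuousAlternatingMap.ofSubsingleton ℝ (𝔼 d) (𝔼 d) (0 : Fin 1) (mcD d g)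

theorem mcD_comp_tderiv_symm {c : G} {p : 𝔼 d} (hp : p ∈ (extChartAt (𝓡 d) c).target) :
    (mcD d ((extChartAt (𝓡 d) c).symm p)).comp
      (tderiv 𝓘(ℝ, 𝔼 d) (𝓡 d) (extChartAt (𝓡 d) c).symm p) =
    fderiv ℝ (fun q => extChartAt (𝓡 d) (1 : G) (((extChartAt (𝓡 d) c).symm p)⁻¹ *
      (extChartAt (𝓡 d) c).symm q)) p := by
  set g := (extChartAt (𝓡 d) c).symm p with hg
  have h1 := tderiv_comp (I := 𝓘(ℝ, 𝔼 d)) (I' := 𝓡 d) (I'' := 𝓡 d) (x := p)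
    (f := (extChartAt (𝓡 d) c).symm)
    ((contMDiff_left d g⁻¹).mdifferentiable (by simp) _)
    ((contMDiffAt_extChartAt_symm hp).mdifferentiableAt (by simp))
  rw [mcD, ← h1, tderiv_eq_fderiv_of_eq (c := (1 : G))
    ((contMDiff_left d g⁻¹).contMDiffAt.comp p (contMDiffAt_extChartAt_symm hp)) (by simp [hg])]
  rfl

theorem contDiffAt_mcD_symm {c : G} {p : 𝔼 d} (hp : p ∈ (extChartAt (𝓡 d) c).target) :
    ContDiffAt ℝ ∞ (fun p => (mcD d ((extChartAt (𝓡 d) c).symm p)).comp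
      (tderiv 𝓘(ℝ, 𝔼 d) (𝓡 d) (extChartAt (𝓡 d) c).symm p)) p := by
  have e : (fun p => (mcD d ((extChartAt (𝓡 d) c).symm p)).comp
      (tderiv 𝓘(ℝ, 𝔼 d) (𝓡 d) (extChartAt (𝓡 d) c).symm p)) =ᶠ[𝓝 p] fun p =>
    fderiv ℝ (fun q => extChartAt (𝓡 d) (1 : G) (((extChartAt (𝓡 d) c).symm p)⁻¹ *
      (extChartAt (𝓡 d) c).symm q)) p := by
    filter_upwards [target_mem_nhds (n := d) hp] with q hq
    exact mcD_comp_tderiv_symm d hq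
  refine ContDiffAt.congr_of_eventuallyEq ?_ e
  refine ContDiffAt.fderiv (m := ∞) (n := ∞) (f := fun p q => extChartAt (𝓡 d) (1 : G)
    (((extChartAt (𝓡 d) c).symm p)⁻¹ * (extChartAt (𝓡 d) c).symm q)) ?_ contDiffAt_id (by simp)
  have h1 : ContMDiffAt 𝓘(ℝ, 𝔼 d × 𝔼 d) 𝓘(ℝ, 𝔼 d) ∞ (fun z : 𝔼 d × 𝔼 d => z.1) (p, id p) :=
    contDiffAt_fst.contMDiffAt
  have h2 : ContMDiffAt 𝓘(ℝ, 𝔼 d × 𝔼 d) 𝓘(ℝ, 𝔼 d) ∞ (fun z : 𝔼 d × 𝔼 d => z.2) (p, id p) :=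
    contDiffAt_snd.contMDiffAt
  have h3 := ((contMDiffAt_extChartAt_symm hp).comp (p, id p) h1).inv.mul
    ((contMDiffAt_extChartAt_symm hp).comp (p, id p) h2)
  exact contDiffAt_extChartAt_comp h3 (by simp)

theorem inChart_mcForm {c : G} {p : 𝔼 d} (hp : p ∈ (extChartAt (𝓡 d) c).target) :
    inChart c (mcForm d G) p = ContinuousAlternatingMap.ofSubsingleton ℝ (𝔼 d) (𝔼 d) (0 : Fin 1)
      ((mcD d ((extChartAt (𝓡 d) c).symm p)).comp
      (tderiv 𝓘(ℝ, 𝔼 d) (𝓡 d) (extChartAt (𝓡 d) c).symm p)) := by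
  rw [inChart_eq_pull hp]
  rfl

theorem smoothFormOn_mcForm : SmoothFormOn univ (mcForm d G) := by
  intro c p hp
  refine contDiffWithinAt_alternating fun v => ?_
  have h := ((contDiffAt_mcD_symm d hp.1).clm_apply (contDiffAt_const (c := v 0))).contDiffWithinAt
    (s := chartPart c univ)
  exact h.congr_of_mem (fun w hw => by rw [inChart_mcForm d hw.1]; rfl) hp

/-- The Maurer-Cartan equation. -/
theorem extD_mcForm (c : G) (w : Fin 2 → 𝔼 d) :
    extD univ (mcForm d G) c w = - brD d G (mcD d c (w 0)) (mcD d c (w 1)) := by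
  set y := extChartAt (𝓡 d) c c with hy
  have hyt := mem_extChartAt_target (I := 𝓡 d) c
  set θ : 𝔼 d → 𝔼 d →L[ℝ] 𝔼 d := fun p => (mcD d ((extChartAt (𝓡 d) c).symm p)).comp
      (tderiv 𝓘(ℝ, 𝔼 d) (𝓡 d) (extChartAt (𝓡 d) c).symm p) with hθ
  have hθd : DifferentiableAt ℝ θ y := (contDiffAt_mcD_symm d hyt).differentiableAt (by simp)
  have hMd : DifferentiableAt ℝ (chartField d c) y :=
    (contDiffAt_chartField d hyt).differentiableAt (by simp)
  have hθy : θ y = mcD d c := by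
    simp only [hθ, hy, tderiv_extChartAt_symm_self, extChartAt_to_inv]
    rfl
  have hMy : chartField d c y = leftD d c := chartField_self d c
  -- The Maurer-Cartan form is constant on left-invariant fields, `θ(L a) = a`; differentiating this
  -- moves the derivative from `θ` to the field.
  have hco : ∀ a u : 𝔼 d, fderiv ℝ θ y u (leftD d c a) =
      - mcD d c (fderiv ℝ (fun p => chartField d c p a) y u) := by
    intro a u
    have h1 : (fun p => θ p (chartField d c p a)) =ᶠ[𝓝 y] fun _ => a := by
      filter_upwards [target_mem_nhds (n := d) hyt] with p hp
      have h2 := congrArg (fun l => mcD d ((extChartAt (𝓡 d) c).symm p) (l a))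
        (tderiv_symm_comp_chartField d hp)
      refine h2.trans ?_
      exact congrArg (fun l => l a) (mcD_comp_leftD d ((extChartAt (𝓡 d) c).symm p))
    have hMa : DifferentiableAt ℝ (fun p => chartField d c p a) y :=
      hMd.clm_apply (differentiableAt_const a)
    have h3 := (hθd.hasFDerivAt.clm_apply hMa.hasFDerivAt).fderiv
    rw [h1.fderiv_eq, fderiv_fun_const] at h3
    have h4 := congrArg (fun l => l u) h3
    simp [hMy, hθy] at h4
    rw [eq_neg_iff_add_eq_zero, add_comm]
    exact h4.symm
  have hfd : ∀ u v : 𝔼 d, fderivWithin ℝ (inChart c (mcForm d G)) (chartPart c univ) y u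
      (fun _ => v) = fderiv ℝ θ y u v := by
    intro u v
    have hopen := isOpen_chartPart (n := d) (isOpen_univ (X := G)) c
    have hmem := mem_chartPart (n := d) (mem_extChartAt_source (I := 𝓡 d) c) (mem_univ c)
    have hd : DifferentiableAt ℝ (inChart c (mcForm d G)) y :=
      ((smoothFormOn_mcForm d c y hmem).contDiffAt (hopen.mem_nhds hmem)).differentiableAt (by simp)
    rw [fderivWithin_of_isOpen hopen hmem]
    have h1 := (hd.hasFDerivAt.hasFDerivWithinAt.alternating_apply (T := univ)
      (fun _ => v)).hasFDerivAt_of_univ.fderiv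
    have h2 : (fun p => inChart c (mcForm d G) p fun _ => v) =ᶠ[𝓝 y] fun p => θ p v := by
      filter_upwards [target_mem_nhds (n := d) hyt] with p hp
      rw [inChart_mcForm d hp]
      rfl
    rw [h2.fderiv_eq, fderiv_clm_apply hθd (differentiableAt_const v)] at h1
    have h3 := congrArg (fun l => l u) h1
    simp at h3
    exact h3.symm
  -- Every tangent vector at `c` is the value of a left-invariant field, so it suffices to evaluate
  -- on those.
  have hw : ∀ i, w i = leftD d c (mcD d c (w i)) := fun i =>
    (congrArg (fun l => l (w i)) (leftD_comp_mcD d c)).symm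
  rw [extD, extDerivWithin_one_form, hfd, hfd]
  conv_lhs => rw [hw 0, hw 1]
  rw [hco, hco]
  have h5 := congrArg (mcD d c) (leftD_brD d c (mcD d c (w 0)) (mcD d c (w 1)))
  rw [← hy, hMy, map_sub] at h5
  have h6 := congrArg (fun l => l (brD d G (mcD d c (w 0)) (mcD d c (w 1)))) (mcD_comp_leftD d c)
  have h7 : brD d G (mcD d c (w 0)) (mcD d c (w 1)) = _ := h6.symm.trans h5
  rw [h7]
  abel

end LieGroup


/-! ### Differentials of functions; the adjoint representation on `𝔤` -/

section ExtDZeroForm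

variable {n : ℕ} {M : Type*} [TopologicalSpace M] [ChartedSpace (𝔼 n) M] [IsManifold (𝓡 n) ∞ M]
  {V : Type*} [NormedAddCommGroup V] [NormedSpace ℝ V] [FiniteDimensional ℝ V]

theorem extD_zeroForm_of_isOpen {W : Set M} (hW : IsOpen W) {x : M} (hx : x ∈ W) {f : M → V}
    (hf : MDifferentiableAt (𝓡 n) 𝓘(ℝ, V) f x) :
    extD (n := n) W (zeroForm f) x =
      ContinuousAlternatingMap.ofSubsingleton ℝ (𝔼 n) V (0 : Fin 1)
        (tderiv (𝓡 n) 𝓘(ℝ, V) f x) := by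
  rw [extD_zeroForm hW.regular hx, fderivWithin_of_isOpen (isOpen_chartPart hW x)
    (mem_chartPart (mem_extChartAt_source x) hx), ← tderiv_eq_fderiv,
    tderiv_comp_symm_self x hf]

theorem smoothFormOn_zeroForm_of_contMDiffOn {W : Set M} (hW : IsOpen W) {f : M → V}
    (hf : ContMDiffOn (𝓡 n) 𝓘(ℝ, V) ∞ f W) : SmoothFormOn (n := n) W (zeroForm f) := by
  refine smoothFormOn_zeroForm fun c y hy => ?_
  have h1 := (hf.contMDiffAt (hW.mem_nhds hy.2)).comp y (contMDiffAt_extChartAt_symm hy.1)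
  exact (contMDiffAt_iff_contDiffAt.1 h1).contDiffWithinAt

end ExtDZeroForm

namespace Sector

variable {ι X : Type*} [TopologicalSpace X] [ChartedSpace (𝔼 3) X] [IsManifold (𝓡 3) ∞ X]
  {d : ℕ} {G : Type*} [TopologicalSpace G] [ChartedSpace (𝔼 d) G] [Group G]
  [LieGroup (𝓡 d) ∞ G] {𝔤 : Type*} [NormedLieRing 𝔤] [NormedLieAlg 𝔤] [FiniteDimensional ℝ 𝔤]
  (P : Sector ι X d G 𝔤)

/-- The identification of the model space of `G` with `𝔤`. -/
def eL : 𝔼 d ≃L[ℝ] 𝔤 :=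
  LinearEquiv.toContinuousLinearEquiv (show 𝔼 d ≃ₗ[ℝ] 𝔤 from P.lieIso.toLinearEquiv)

theorem eL_brD (a b : 𝔼 d) : P.eL (brD d G a b) = ⁅P.eL a, P.eL b⁆ :=
  LieEquiv.map_lie P.lieIso a b

theorem Ad_eq (g : G) : P.Ad g = (P.eL : 𝔼 d →L[ℝ] 𝔤).comp ((conjD d g).comp
    (P.eL.symm : 𝔤 →L[ℝ] 𝔼 d)) := rfl

theorem Ad_mul (g h : G) : P.Ad (g * h) = (P.Ad g).comp (P.Ad h) := by
  ext v
  simp [Ad_eq, conjD_mul]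

theorem Ad_one : P.Ad 1 = ContinuousLinearMap.id ℝ 𝔤 := by
  ext v
  simp [Ad_eq, conjD_one]

theorem Ad_mul_apply (g h : G) (v : 𝔤) : P.Ad (g * h) v = P.Ad g (P.Ad h v) := by
  rw [Ad_mul]; rfl

theorem Ad_inv_apply (g : G) (v : 𝔤) : P.Ad g⁻¹ (P.Ad g v) = v := by
  rw [← Ad_mul_apply, inv_mul_cancel, Ad_one]; rfl

theorem Ad_apply_inv (g : G) (v : 𝔤) : P.Ad g (P.Ad g⁻¹ v) = v := by
  rw [← Ad_mul_apply, mul_inv_cancel, Ad_one]; rfl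

/-- Conjugation by the identification `eL`, on endomorphisms. -/
def conjL : (𝔼 d →L[ℝ] 𝔼 d) →L[ℝ] (𝔤 →L[ℝ] 𝔤) :=
  (ContinuousLinearMap.compL ℝ 𝔤 (𝔼 d) 𝔤 (P.eL : 𝔼 d →L[ℝ] 𝔤)).comp
    ((ContinuousLinearMap.compL ℝ 𝔤 (𝔼 d) (𝔼 d)).flip (P.eL.symm : 𝔤 →L[ℝ] 𝔼 d))

theorem contMDiff_Ad : ContMDiff (𝓡 d) 𝓘(ℝ, 𝔤 →L[ℝ] 𝔤) ∞ P.Ad := fun c =>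
  contMDiffAt_of_comp_symm (P.conjL.contDiff.contDiffAt.comp _ (contDiffAt_conjD_symm d c))

theorem mdifferentiableAt_Ad (g : G) : MDifferentiableAt (𝓡 d) 𝓘(ℝ, 𝔤 →L[ℝ] 𝔤) P.Ad g :=
  P.contMDiff_Ad.mdifferentiable (by simp) g

theorem tderiv_Ad_one (a : 𝔼 d) : tderiv (𝓡 d) 𝓘(ℝ, 𝔤 →L[ℝ] 𝔤) P.Ad 1 a = lieL 𝔤 (P.eL a) := by
  rw [← tderiv_comp_symm_self 1 (P.mdifferentiableAt_Ad 1), tderiv_eq_fderiv]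
  have e : P.Ad ∘ (extChartAt (𝓡 d) (1 : G)).symm =
      P.conjL ∘ (conjD d ∘ (extChartAt (𝓡 d) (1 : G)).symm) := rfl
  rw [e, fderiv_comp _ P.conjL.differentiableAt
    ((contDiffAt_conjD_symm d (1 : G)).differentiableAt (by simp)), P.conjL.fderiv]
  ext v
  change P.eL (fderiv ℝ (conjD d ∘ (extChartAt (𝓡 d) (1 : G)).symm) (extChartAt (𝓡 d) (1 : G) 1) a
    (P.eL.symm v)) = _
  rw [fderiv_conjD, eL_brD, ContinuousLinearEquiv.apply_symm_apply, lieL_apply]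

/-- `Ad x = Ad g ∘ Ad (g⁻¹ x)` carries the derivative at `1` to the point `g`; the Maurer-Cartan
form enters as the derivative of `x ↦ g⁻¹ x`. -/
theorem tderiv_Ad (g : G) (a : 𝔼 d) : tderiv (𝓡 d) 𝓘(ℝ, 𝔤 →L[ℝ] 𝔤) P.Ad g a =
    (P.Ad g).comp (lieL 𝔤 (P.eL (mcD d g a))) := by
  have e : P.Ad = (ContinuousLinearMap.compL ℝ 𝔤 𝔤 𝔤 (P.Ad g)) ∘ (P.Ad ∘ fun x : G => g⁻¹ * x) := by
    funext x
    change _ = (P.Ad g).comp (P.Ad (g⁻¹ * x))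
    rw [← Ad_mul, mul_inv_cancel_left]
  have hl : MDifferentiableAt (𝓡 d) (𝓡 d) (fun x : G => g⁻¹ * x) g :=
    (contMDiff_left d g⁻¹).mdifferentiable (by simp) g
  have h1 := tderiv_comp (I := 𝓡 d) (I' := 𝓡 d) (I'' := 𝓘(ℝ, 𝔤 →L[ℝ] 𝔤)) (x := g)
    (f := fun x : G => g⁻¹ * x) (g := P.Ad) (P.mdifferentiableAt_Ad _) hl
  have h2 := tderiv_comp (I := 𝓡 d) (I' := 𝓘(ℝ, 𝔤 →L[ℝ] 𝔤)) (I'' := 𝓘(ℝ, 𝔤 →L[ℝ] 𝔤)) (x := g)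
    (f := P.Ad ∘ fun x : G => g⁻¹ * x) (g := ContinuousLinearMap.compL ℝ 𝔤 𝔤 𝔤 (P.Ad g))
    (ContinuousLinearMap.differentiableAt _).mdifferentiableAt
    ((P.mdifferentiableAt_Ad _).comp g hl)
  have h0 : tderiv (𝓡 d) 𝓘(ℝ, 𝔤 →L[ℝ] 𝔤) P.Ad g = tderiv (𝓡 d) 𝓘(ℝ, 𝔤 →L[ℝ] 𝔤)
    ((ContinuousLinearMap.compL ℝ 𝔤 𝔤 𝔤 (P.Ad g)) ∘ (P.Ad ∘ fun x : G => g⁻¹ * x)) g :=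
    congrArg (fun f => tderiv (𝓡 d) 𝓘(ℝ, 𝔤 →L[ℝ] 𝔤) f g) e
  rw [h0, h2, h1, tderiv_eq_fderiv, ContinuousLinearMap.fderiv]
  change (P.Ad g).comp (tderiv (𝓡 d) 𝓘(ℝ, 𝔤 →L[ℝ] 𝔤) P.Ad (g⁻¹ * g) (mcD d g a)) = _
  rw [inv_mul_cancel, tderiv_Ad_one]

/-- Differentiating `Ad (g x g⁻¹) = Ad g ∘ Ad x ∘ Ad g⁻¹` in `x` at `1` shows that `Ad g`
intertwines the adjoint action of `a` with that of `Ad g a`. -/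
theorem Ad_lie (g : G) (a b : 𝔤) : P.Ad g ⁅a, b⁆ = ⁅P.Ad g a, P.Ad g b⁆ := by
  have e : P.Ad ∘ (fun x : G => g * x * g⁻¹) = ((ContinuousLinearMap.compL ℝ 𝔤 𝔤 𝔤 (P.Ad g)).comp
      ((ContinuousLinearMap.compL ℝ 𝔤 𝔤 𝔤).flip (P.Ad g⁻¹))) ∘ P.Ad := by
    funext x
    change P.Ad (g * x * g⁻¹) = (P.Ad g).comp ((P.Ad x).comp (P.Ad g⁻¹))
    rw [Ad_mul, Ad_mul]
    rfl
  have hc : MDifferentiableAt (𝓡 d) (𝓡 d) (fun x : G => g * x * g⁻¹) 1 :=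
    (contMDiff_conj d g).mdifferentiable (by simp) 1
  have h1 := tderiv_comp (I := 𝓡 d) (I' := 𝓡 d) (I'' := 𝓘(ℝ, 𝔤 →L[ℝ] 𝔤)) (x := 1)
    (f := fun x : G => g * x * g⁻¹) (g := P.Ad) (P.mdifferentiableAt_Ad _) hc
  have h2 := tderiv_comp (I := 𝓡 d) (I' := 𝓘(ℝ, 𝔤 →L[ℝ] 𝔤)) (I'' := 𝓘(ℝ, 𝔤 →L[ℝ] 𝔤)) (x := 1)
    (f := P.Ad) (g := ((ContinuousLinearMap.compL ℝ 𝔤 𝔤 𝔤 (P.Ad g)).comp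
      ((ContinuousLinearMap.compL ℝ 𝔤 𝔤 𝔤).flip (P.Ad g⁻¹))))
    (ContinuousLinearMap.differentiableAt _).mdifferentiableAt (P.mdifferentiableAt_Ad _)
  rw [← e, h1, tderiv_eq_fderiv, ContinuousLinearMap.fderiv] at h2
  -- Evaluation at `Ad g b` lets the factor `Ad g⁻¹` cancel.
  have h3 := congrArg (fun l => l (P.eL.symm a) (P.Ad g b)) h2
  have h4 : tderiv (𝓡 d) 𝓘(ℝ, 𝔤 →L[ℝ] 𝔤) P.Ad (g * 1 * g⁻¹) (conjD d g (P.eL.symm a)) (P.Ad g b) =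
      P.Ad g (tderiv (𝓡 d) 𝓘(ℝ, 𝔤 →L[ℝ] 𝔤) P.Ad 1 (P.eL.symm a) (P.Ad g⁻¹ (P.Ad g b))) := h3
  rw [mul_one, mul_inv_cancel, tderiv_Ad_one, tderiv_Ad_one, Ad_inv_apply, lieL_apply, lieL_apply,
    ContinuousLinearEquiv.apply_symm_apply] at h4
  exact h4.symm

/-! ### Pullbacks of the Maurer-Cartan form -/

/-- The pullback of the Maurer-Cartan form, as a form. -/
def mcPull (u : X → G) : DForm 3 1 X 𝔤 := fun x =>
  ContinuousAlternatingMap.ofSubsingleton ℝ (𝔼 3) 𝔤 (0 : Fin 1) (P.maurerCartan u x)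

theorem maurerCartan_apply {u : X → G} {x : X} (hu : MDifferentiableAt (𝓡 3) (𝓡 d) u x) (v : 𝔼 3) :
    P.maurerCartan u x v = P.eL (mcD d (u x) (tderiv (𝓡 3) (𝓡 d) u x v)) := by
  have h1 := tderiv_comp (I := 𝓡 3) (I' := 𝓡 d) (I'' := 𝓡 d) (x := x)
    (f := u) (g := fun y : G => (u x)⁻¹ * y)
    ((contMDiff_left d (u x)⁻¹).mdifferentiable (by simp) _) hu
  have h2 : P.maurerCartan u x v =
    P.eL (tderiv (𝓡 3) (𝓡 d) ((fun y : G => (u x)⁻¹ * y) ∘ u) x v) := rfl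
  rw [h2, h1]
  rfl

variable {W : Set X} (hW : IsOpen W) {u : X → G} (hu : ContMDiffOn (𝓡 3) (𝓡 d) ∞ u W)
include hW hu

theorem smoothFormOn_Ad : SmoothFormOn (n := 3) W (zeroForm fun x => P.Ad (u x)) :=
  smoothFormOn_zeroForm_of_contMDiffOn hW (P.contMDiff_Ad.comp_contMDiffOn hu)

theorem mdifferentiableAt_of_mem {x : X} (hx : x ∈ W) : MDifferentiableAt (𝓡 3) (𝓡 d) u x :=
  (hu.contMDiffAt (hW.mem_nhds hx)).mdifferentiableAt (by simp)

/-- The chain rule and `tderiv_Ad` give `d Ad_u = Ad_u ∘ [u⁻¹du, ·]`, the source of the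
inhomogeneous term in gauge transformations. -/
theorem extD_Ad {x : X} (hx : x ∈ W) (v : Fin 1 → 𝔼 3) :
    extD (n := 3) W (zeroForm fun x => P.Ad (u x)) x v =
      (P.Ad (u x)).comp (lieL 𝔤 (P.mcPull u x v)) := by
  have hux := mdifferentiableAt_of_mem hW hu hx
  change extD W (zeroForm (P.Ad ∘ u)) x v = _
  rw [extD_zeroForm_of_isOpen hW hx (f := P.Ad ∘ u) ((P.mdifferentiableAt_Ad _).comp x hux),
    tderiv_comp (P.mdifferentiableAt_Ad _) hux]
  change tderiv (𝓡 d) 𝓘(ℝ, 𝔤 →L[ℝ] 𝔤) P.Ad (u x) (tderiv (𝓡 3) (𝓡 d) u x (v 0)) = _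
  rw [tderiv_Ad, ← P.maurerCartan_apply hux]
  rfl

theorem inChart_mcPull {c : X} {y : 𝔼 3} (hy : y ∈ chartPart c W) :
    inChart c (P.mcPull u) y = (P.eL : 𝔼 d →L[ℝ] 𝔤).compContinuousAlternatingMap
      (pull (u ∘ (extChartAt (𝓡 3) c).symm) (mcForm d G) y) := by
  rw [inChart_eq_pull hy.1]
  have hux := mdifferentiableAt_of_mem hW hu hy.2
  ext v
  change P.maurerCartan u _ (tderiv 𝓘(ℝ, 𝔼 3) (𝓡 3) (extChartAt (𝓡 3) c).symm y (v 0)) =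
    P.eL (mcD d (u _) (tderiv 𝓘(ℝ, 𝔼 3) (𝓡 d) (u ∘ (extChartAt (𝓡 3) c).symm) y (v 0)))
  rw [P.maurerCartan_apply hux,
    tderiv_comp hux ((contMDiffAt_extChartAt_symm hy.1).mdifferentiableAt (by simp))]
  rfl

theorem contMDiffAt_comp_symm {c : X} {y : 𝔼 3} (hy : y ∈ chartPart c W) :
    ∀ᶠ w in 𝓝 y, ContMDiffAt 𝓘(ℝ, 𝔼 3) (𝓡 d) ∞ (u ∘ (extChartAt (𝓡 3) c).symm) w := by
  filter_upwards [(isOpen_chartPart hW c).mem_nhds hy] with w hw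
  exact (hu.contMDiffAt (hW.mem_nhds hw.2)).comp w (contMDiffAt_extChartAt_symm hw.1)

theorem smoothFormOn_mcPull : SmoothFormOn W (P.mcPull u) := by
  intro c y hy
  have h1 : ContDiffOn ℝ ∞ (pull (u ∘ (extChartAt (𝓡 3) c).symm) (mcForm d G)) (chartPart c W) :=
    (smoothFormOn_mcForm d).contDiffOn_pull
      (fun z hz => contMDiffAt_comp_symm hW hu hz) (mapsTo_univ _ _)
  refine ContDiffWithinAt.congr_of_mem ?_ (fun w hw => P.inChart_mcPull hW hu hw) hy
  exact (ContinuousLinearMap.compContinuousAlternatingMapCLM (𝕜 := ℝ) (E := 𝔼 3) (F := 𝔼 d)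
    (G := 𝔤) (ι := Fin 1) P.eL).contDiff.comp_contDiffWithinAt (h1 y hy)

/-- The Maurer-Cartan equation on `G`, pulled back along `u`; `d` commutes with the pullback and
with the constant identification `eL`. -/
theorem extD_mcPull {x : X} (hx : x ∈ W) (w : Fin 2 → 𝔼 3) :
    extD W (P.mcPull u) x w =
      - ⁅P.mcPull u x (fun _ => w 0), P.mcPull u x (fun _ => w 1)⁆ := by
  have hxc := mem_chartPart (n := 3) (mem_extChartAt_source (I := 𝓡 3) x) hx
  have hux := mdifferentiableAt_of_mem hW hu hx
  have h1 : ContDiffOn ℝ ∞ (pull (u ∘ (extChartAt (𝓡 3) x).symm) (mcForm d G)) (chartPart x W) :=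
    (smoothFormOn_mcForm d).contDiffOn_pull
      (fun z hz => contMDiffAt_comp_symm hW hu hz) (mapsTo_univ _ _)
  -- The constant map `eL` is treated as a function factor, whose derivative drops out below.
  have h2 := extDerivWithin_bilin (ContinuousLinearMap.id ℝ (𝔼 d →L[ℝ] 𝔤))
    (uniqueDiffWithinAt_chartPart hW.regular hx) (f := fun _ => (P.eL : 𝔼 d →L[ℝ] 𝔤))
    (differentiableWithinAt_const _) ((h1 _ hxc).differentiableWithinAt (by simp))
  rw [extDerivWithin_pull (contMDiffAt_comp_symm hW hu hxc) (hW.regular x).1 ((hW.regular x).2 hxc)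
    hxc (mapsTo_univ _ _) ((smoothFormOn_mcForm d).smoothFormAt (mem_univ _))] at h2
  have h3 : extD W (P.mcPull u) x = extDerivWithin (fun z => (ContinuousLinearMap.id ℝ
      (𝔼 d →L[ℝ] 𝔤) (P.eL : 𝔼 d →L[ℝ] 𝔤)).compContinuousAlternatingMap
      (pull (u ∘ (extChartAt (𝓡 3) x).symm) (mcForm d G) z)) (chartPart x W)
      (extChartAt (𝓡 3) x x) :=
    extDerivWithin_congr (fun w hw => P.inChart_mcPull hW hu hw) (P.inChart_mcPull hW hu hxc)
  rw [h3, h2]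
  simp only [fderivWithin_fun_const, Pi.zero_apply]
  have h4 : ContinuousAlternatingMap.ofSubsingleton ℝ (𝔼 3) (𝔼 d →L[ℝ] 𝔤) (0 : Fin 1)
      (0 : 𝔼 3 →L[ℝ] 𝔼 d →L[ℝ] 𝔤) = 0 := by ext; rfl
  rw [h4, wedge_zero_left, zero_add]
  change P.eL (extD univ (mcForm d G) (u ((extChartAt (𝓡 3) x).symm (extChartAt (𝓡 3) x x)))
    fun i => tderiv 𝓘(ℝ, 𝔼 3) (𝓡 d) (u ∘ (extChartAt (𝓡 3) x).symm) (extChartAt (𝓡 3) x x) (w i)) =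
    _
  rw [extChartAt_to_inv, extD_mcForm, map_neg, eL_brD, tderiv_comp_symm_self x hux]
  congr 2
  · exact (P.maurerCartan_apply hux _).symm
  · exact (P.maurerCartan_apply hux _).symm

end Sector


namespace Sector

variable {ι X : Type*} [TopologicalSpace X] [ChartedSpace (𝔼 3) X] [IsManifold (𝓡 3) ∞ X]
  {d : ℕ} {G : Type*} [TopologicalSpace G] [ChartedSpace (𝔼 d) G] [Group G]
  [LieGroup (𝓡 d) ∞ G] {𝔤 : Type*} [NormedLieRing 𝔤] [NormedLieAlg 𝔤] [FiniteDimensional ℝ 𝔤]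
  (P : Sector ι X d G 𝔤)

/-! ### Covariance -/

section GaugeTransformation

variable {W S : Set X} (hW : IsOpen W) (hS : Regular 3 S) {u : X → G}
  (hu : ContMDiffOn (𝓡 3) (𝓡 d) ∞ u W) {x : X} (hx : x ∈ W ∩ S)
include hW hS hu hx

/-- The exterior derivative of a gauge transformed form. -/
theorem extD_Ad_comp {k : ℕ} {ξ η : DForm 3 k X 𝔤} (hη : SmoothFormOn (W ∩ S) η)
    (h : ∀ y ∈ W ∩ S, ξ y = (P.Ad (u y)).compContinuousAlternatingMap (η y)) :
    extD S ξ x = (P.Ad (u x)).compContinuousAlternatingMap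
      (wedge (lieL 𝔤) (P.mcPull u x) (η x) + extD S η x) := by
  have hR : Regular 3 (W ∩ S) := hS.open_inter hW
  have h1 : extD S ξ x = extD (W ∩ S) (bilin (ContinuousLinearMap.id ℝ (𝔤 →L[ℝ] 𝔤))
      (fun x => P.Ad (u x)) η) x := by
    rw [extD_inter hW hx.1]
    exact extD_congr hW hx.1 hx.2 fun y hy => h y hy
  have hA := P.smoothFormOn_Ad hW hu
  rw [h1, extD_bilin _ hR hx (hA.mono inter_subset_left) hη,
    extD_mono hR hx inter_subset_left (hA.smoothFormAt hx.1), extD_inter hW hx.1]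
  ext v
  simp only [ContinuousAlternatingMap.add_apply, wedge_apply,
    ContinuousLinearMap.compContinuousAlternatingMap_coe, Function.comp_apply, map_add, map_sum]
  congr 1
  refine Finset.sum_congr rfl fun i _ => ?_
  rw [P.extD_Ad hW hu hx.1, map_zsmul]
  rfl

variable {A A' : DForm 3 1 X 𝔤}
  (h : ∀ y ∈ W ∩ S, A' y = (P.Ad (u y)⁻¹).compContinuousAlternatingMap (A y) + P.mcPull u y)

omit hW hS hu in
include h in
theorem gauge_apply (v : Fin 1 → 𝔼 3) :
    A x v = P.Ad (u x) (A' x v - P.mcPull u x v) := by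
  rw [h x hx]
  simp only [ContinuousAlternatingMap.add_apply, add_sub_cancel_right,
    ContinuousLinearMap.compContinuousAlternatingMap_coe, Function.comp_apply, Ad_apply_inv]

-- With `A = Ad_u (A' - u⁻¹du)`, the term `Ad_u [u⁻¹du ∧ η]` from the derivative of `Ad_u η` cancels
-- against the inhomogeneous part of the connection.
include h in
theorem covD_gauge {k : ℕ} {ξ η : DForm 3 k X 𝔤} (hη : SmoothFormOn (W ∩ S) η)
    (hξ : ∀ y ∈ W ∩ S, ξ y = (P.Ad (u y)).compContinuousAlternatingMap (η y)) :
    covD S A ξ x = (P.Ad (u x)).compContinuousAlternatingMap (covD S A' η x) := by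
  rw [covD, P.extD_Ad_comp hW hS hu hx hη hξ, covD, hξ x hx]
  ext v
  simp only [ContinuousAlternatingMap.add_apply, wedge_apply,
    ContinuousLinearMap.compContinuousAlternatingMap_coe, Function.comp_apply, map_add, map_sum,
    P.gauge_apply hx h]
  rw [add_right_comm, add_comm, ← Finset.sum_add_distrib]
  congr 1
  refine Finset.sum_congr rfl fun i _ => ?_
  simp only [map_zsmul, lieL_apply, ← Ad_lie, sub_lie]
  rw [← smul_add, ← map_add, add_sub_cancel]

-- With `θ = u⁻¹du` one has `A = Ad_u (A' - θ)`. The mixed terms `[θ ∧ A']` cancel, and the terms in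
-- `θ` alone do so by the Maurer-Cartan equation `dθ = -½ [θ ∧ θ]`.
include h in
theorem curvD_gauge (hA' : SmoothFormOn (W ∩ S) A') :
    curvD S A x = (P.Ad (u x)).compContinuousAlternatingMap (curvD S A' x) := by
  have hm : SmoothFormOn (W ∩ S) (P.mcPull u) :=
    (P.smoothFormOn_mcPull hW hu).mono inter_subset_left
  have hR : Regular 3 (W ∩ S) := hS.open_inter hW
  have h1 : extD S (A' + (-1 : ℝ) • P.mcPull u) x = extD S A' x - extD W (P.mcPull u) x := by
    rw [← extD_inter hW hx.1, extD_add hR hx hA' (hm.smul _), extD_smul hR hx,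
      extD_inter hW hx.1, extD_mono hR hx inter_subset_left
        ((P.smoothFormOn_mcPull hW hu).smoothFormAt hx.1)]
    module
  have h2 := P.extD_Ad_comp hW hS hu hx (ξ := A) (η := A' + (-1 : ℝ) • P.mcPull u)
    (hA'.add (hm.smul _)) (fun y hy => by
      ext v
      rw [P.gauge_apply hy h]
      change _ = P.Ad (u y) (A' y v + (-1 : ℝ) • P.mcPull u y v)
      congr 1
      module)
  rw [curvD, h2, h1, curvD]
  ext w
  simp only [ContinuousAlternatingMap.add_apply, ContinuousAlternatingMap.smul_apply,
    ContinuousAlternatingMap.sub_apply, Pi.add_apply, Pi.smul_apply,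
    ContinuousLinearMap.compContinuousAlternatingMap_coe, Function.comp_apply,
    wedge_one_form, P.gauge_apply hx h, lieL_apply, P.extD_mcPull hW hu hx.1, ← Ad_lie]
  simp only [← map_sub, ← map_add, ← map_smul]
  congr 1
  generalize (A' x fun _ => w 0) = a
  generalize (A' x fun _ => w 1) = b
  generalize (P.mcPull u x fun _ => w 0) = s
  generalize (P.mcPull u x fun _ => w 1) = t
  simp only [lie_add, lie_smul, lie_sub, sub_lie]
  rw [← lie_skew b a, ← lie_skew t s, ← lie_skew b s, ← lie_skew t a]
  module

end GaugeTransformation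

theorem mem_idx (x : X) : x ∈ P.U (P.idx x) := (P.cover x).choose_spec

/-- The cut-off of a family of local forms to the parts of `S` in the sets of the cover. -/
def cutoff {k : ℕ} (S : Set X) (ξ : ι → DForm 3 k X 𝔤) : ι → DForm 3 k X 𝔤 := fun i =>
  (P.U i ∩ S).indicator (ξ i)

theorem cutoff_apply {k : ℕ} {S : Set X} (ξ : ι → DForm 3 k X 𝔤) {i : ι} {x : X}
    (hx : x ∈ P.U i ∩ S) : P.cutoff S ξ i x = ξ i x := indicator_of_mem hx _

theorem cutoff_mem_forms {k : ℕ} {S : Set X} {ξ : ι → DForm 3 k X 𝔤}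
    (h : ∀ i, SmoothFormOn (P.U i ∩ S) (ξ i))
    (h' : ∀ i j, ∀ x ∈ P.U i ∩ P.U j ∩ S,
      ξ i x = (P.Ad (P.g i j x)).compContinuousAlternatingMap (ξ j x)) :
    P.cutoff S ξ ∈ P.forms S k := by
  refine ⟨fun i => (h i).congr fun y hy => P.cutoff_apply ξ hy,
    fun i x hx => indicator_of_notMem hx _, fun i j x hx => ?_⟩
  rw [P.cutoff_apply ξ ⟨hx.1.1, hx.2⟩, P.cutoff_apply ξ ⟨hx.1.2, hx.2⟩, h' i j x hx]

variable {S : Set X} {A : ι → DForm 3 1 X 𝔤}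

/-- The transformation law is `covD_gauge` for `u = g_ij`. Elements of `forms` are required to
vanish off `P.U i ∩ S`, a condition not built into the formula for `dCov`; hence the cut-off. -/
theorem cutoff_dCov_mem_forms {k : ℕ} (hS : Regular 3 S) (hA : P.IsConnection S A)
    {ξ : ι → DForm 3 k X 𝔤} (hξ : ξ ∈ P.forms S k) :
    P.cutoff S (P.dCov S A ξ) ∈ P.forms S (k + 1) := by
  refine P.cutoff_mem_forms (fun i => ?_) (fun i j x hx => ?_)
  · refine ((hA.1 i).covD (hS.open_inter (P.isOpen i)) (hξ.1 i)).congr fun y hy => ?_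
    unfold covD dCov
    rw [extD_inter (P.isOpen i) hy.1]
  · exact P.covD_gauge ((P.isOpen i).inter (P.isOpen j)) hS (P.smooth i j) hx
      (hA.2.2 i j) ((hξ.1 j).mono fun y hy => ⟨hy.1.2, hy.2⟩) (hξ.2.2 i j)

theorem cutoff_curv_mem_forms (hS : Regular 3 S) (hA : P.IsConnection S A) :
    P.cutoff S (P.curv S A) ∈ P.forms S 2 := by
  refine P.cutoff_mem_forms (fun i => ?_) (fun i j x hx => ?_)
  · refine ((hA.1 i).curvD (hS.open_inter (P.isOpen i))).congr fun y hy => ?_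
    unfold curvD curv
    rw [extD_inter (P.isOpen i) hy.1]
  · exact P.curvD_gauge ((P.isOpen i).inter (P.isOpen j)) hS (P.smooth i j) hx
      (hA.2.2 i j) ((hA.1 j).mono fun y hy => ⟨hy.1.2, hy.2⟩)

variable {B : LieMetric 𝔤} (hB : ∀ (g : G) (x y : 𝔤), B.form (P.Ad g x) (P.Ad g y) = B.form x y)
include hB

theorem toL_Ad (g : G) (x y : 𝔤) : B.toL (P.Ad g x) (P.Ad g y) = B.toL x y := hB g x y

theorem wedge_Ad {k : ℕ} (g : G) (ξ : (𝔼 3) [⋀^Fin 1]→L[ℝ] 𝔤) (η : (𝔼 3) [⋀^Fin k]→L[ℝ] 𝔤) :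
    wedge B.toL ((P.Ad g).compContinuousAlternatingMap ξ)
      ((P.Ad g).compContinuousAlternatingMap η) = wedge B.toL ξ η := by
  ext v
  simp only [wedge_apply, ContinuousLinearMap.compContinuousAlternatingMap_coe,
    Function.comp_apply, P.toL_Ad hB]

/-- The global form `⟨ξ ∧ η⟩`, read off in the local representations `i`. -/
theorem pairing_eq {k : ℕ} {ξ : ι → DForm 3 1 X 𝔤} {η : ι → DForm 3 k X 𝔤}
    (hξ : ξ ∈ P.forms S 1) (hη : η ∈ P.forms S k) {i : ι} {x : X} (hx : x ∈ P.U i ∩ S) :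
    wedge B.toL (ξ (P.idx x) x) (η (P.idx x) x) = wedge B.toL (ξ i x) (η i x) := by
  have h : x ∈ P.U (P.idx x) ∩ P.U i ∩ S := ⟨⟨P.mem_idx x, hx.1⟩, hx.2⟩
  rw [hξ.2.2 _ _ x h, hη.2.2 _ _ x h, P.wedge_Ad hB]

/-- The form `⟨ξ ∧ η⟩` on `X`. -/
theorem smoothFormOn_pairing {k : ℕ} {ξ : ι → DForm 3 1 X 𝔤} {η : ι → DForm 3 k X 𝔤}
    (hξ : ξ ∈ P.forms S 1) (hη : η ∈ P.forms S k) :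
    SmoothFormOn S fun x => wedge B.toL (ξ (P.idx x) x) (η (P.idx x) x) := by
  refine smoothFormOn_of_locally fun x hx => ⟨P.U (P.idx x), P.isOpen _, P.mem_idx x, ?_⟩
  exact ((hξ.1 _).wedge B.toL (hη.1 _)).congr fun y hy => P.pairing_eq hB hξ hη hy

end Sector


/-! ### Orientation signs and integration of forms of top degree -/

section Integral

open MeasureTheory Filter

variable {n : ℕ}

/-- The standard frame. -/
abbrev stdFrame (n : ℕ) : Fin n → 𝔼 n := fun i => EuclideanSpace.single i 1

theorem alternating_comp_stdFrame (η : (𝔼 n) [⋀^Fin n]→L[ℝ] ℝ) (L : 𝔼 n →L[ℝ] 𝔼 n) :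
    η.compContinuousLinearMap L (stdFrame n) = L.det * η (stdFrame n) := by
  set b := (EuclideanSpace.basisFun (Fin n) ℝ).toBasis with hb
  have hbe : (b : Fin n → 𝔼 n) = stdFrame n := by
    funext i
    simp [hb]
  have h := η.toAlternatingMap.eq_smul_basis_det b
  have h1 : ∀ v, η v = η b * b.det v := fun v => by
    exact congrArg (fun f => f v) h
  have h2 : b.det (L ∘ b) = L.det * b.det b := Module.Basis.det_comp b (L : 𝔼 n →ₗ[ℝ] 𝔼 n) b
  have h3 : η.compContinuousLinearMap L (stdFrame n) = η (L ∘ b) := by rw [hbe]; rfl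
  rw [h3, h1, h2, Module.Basis.det_self, mul_one, hbe, mul_comm]

theorem sign_mul' (r s : ℝ) : Real.sign (r * s) = Real.sign r * Real.sign s := by
  rcases lt_trichotomy r 0 with h | h | h <;> rcases lt_trichotomy s 0 with h' | h' | h' <;>
  simp [h, h', Real.sign_of_neg, Real.sign_of_pos, mul_pos_of_neg_of_neg, mul_neg_of_neg_of_pos,
    mul_neg_of_pos_of_neg]

variable {M : Type*} [TopologicalSpace M] [ChartedSpace (𝔼 n) M] [IsManifold (𝓡 n) ∞ M]

/-- The sign of the orientation of a parametrization. -/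
def MOrientation.frameSign (o : MOrientation n M) (ψ : 𝔼 n → M) (z : 𝔼 n) : ℝ :=
  o.sgn (ψ z) * Real.sign (tderiv 𝓘(ℝ, 𝔼 n) (𝓡 n) ψ z).det

theorem det_comp' (L L' : 𝔼 n →L[ℝ] 𝔼 n) : (L.comp L').det = L.det * L'.det :=
  LinearMap.det_comp (L : 𝔼 n →ₗ[ℝ] 𝔼 n) (L' : 𝔼 n →ₗ[ℝ] 𝔼 n)

theorem eventually_sign_eq {F : Type*} [TopologicalSpace F] {f : F → ℝ} {z : F}
    (hf : ContinuousAt f z) (h : f z ≠ 0) : ∀ᶠ w in 𝓝 z, Real.sign (f w) = Real.sign (f z) := by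
  rcases lt_or_gt_of_ne h with h | h
  · filter_upwards [hf.eventually (gt_mem_nhds h)] with w hw
    rw [Real.sign_of_neg h, Real.sign_of_neg hw]
  · filter_upwards [hf.eventually (lt_mem_nhds h)] with w hw
    rw [Real.sign_of_pos h, Real.sign_of_pos hw]

/-- In the fixed chart at `ψ z` the Jacobian determinant is continuous and nonzero, so its sign is
locally constant. The sign of the passage to the preferred chart at `ψ w` is compensated by
consistency of the orientation. -/
theorem MOrientation.frameSign_eventually_eq (o : MOrientation n M) {ψ : 𝔼 n → M} {z : 𝔼 n}
    (hψ : ∀ᶠ w in 𝓝 z, ContMDiffAt 𝓘(ℝ, 𝔼 n) (𝓡 n) ∞ ψ w)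
    (hd : (tderiv 𝓘(ℝ, 𝔼 n) (𝓡 n) ψ z).det ≠ 0) :
    ∀ᶠ w in 𝓝 z, o.frameSign ψ w = o.frameSign ψ z := by
  set c := ψ z with hc
  have hcont := hψ.self_of_nhds.continuousAt
  have h1 := contDiffAt_extChartAt_comp hψ.self_of_nhds (mem_extChartAt_source c)
  have h2 : ContinuousAt (fun w => (fderiv ℝ (extChartAt (𝓡 n) c ∘ ψ) w).det) z :=
    ContinuousLinearMap.continuous_det.continuousAt.comp
      (h1.fderiv_right (m := 0) (by simp)).continuousAt
  have hz : tderiv 𝓘(ℝ, 𝔼 n) (𝓡 n) ψ z = fderiv ℝ (extChartAt (𝓡 n) c ∘ ψ) z :=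
    tderiv_eq_fderiv_extChartAt_comp hψ.self_of_nhds
  have h3 := eventually_sign_eq h2 (by rw [← hz]; exact hd)
  filter_upwards [h3, hψ, hcont.eventually (o.consistent c),
    hcont ((isOpen_extChartAt_source (I := 𝓡 n) c).mem_nhds (mem_extChartAt_source c))]
    with w hw hw' hs hw''
  unfold frameSign
  rw [hz, tderiv_eq_tangentCoordChange_comp hw' hw'', det_comp', sign_mul', hw, ← mul_assoc]
  congr 1
  have h4 := Real.sign_of_pos hs
  rw [sign_mul', sign_mul'] at h4
  have hsg : ∀ x, Real.sign (o.sgn x) = o.sgn x := fun x => by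
    rcases o.sgn_eq x with h | h <;> simp [h, Real.sign_neg]
  rw [hsg, hsg] at h4
  rcases o.sgn_eq c with h | h
  · rw [h] at h4 ⊢; linarith
  · rw [h] at h4 ⊢; linarith

theorem MOrientation.chartSign_eq_frameSign (o : MOrientation n M) {c : M} {y : 𝔼 n}
    (hy : y ∈ (extChartAt (𝓡 n) c).target) :
    o.chartSign c ((extChartAt (𝓡 n) c).symm y) = o.frameSign (extChartAt (𝓡 n) c).symm y := by
  unfold chartSign frameSign
  rw [tderiv_extChartAt_symm hy]

theorem det_tangentCoordChange_ne_zero {a b x : M} (ha : x ∈ (extChartAt (𝓡 n) a).source)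
    (hb : x ∈ (extChartAt (𝓡 n) b).source) : (tangentCoordChange (𝓡 n) a b x).det ≠ 0 := by
  have h := tangentCoordChange_comp' (n := n) ha hb ha
  rw [tangentCoordChange_self' ha] at h
  have h1 := congrArg ContinuousLinearMap.det h
  rw [det_comp', show (ContinuousLinearMap.id ℝ (𝔼 n)).det = 1 from LinearMap.det_id] at h1
  exact right_ne_zero_of_mul_eq_one h1

theorem MOrientation.continuousOn_chartSign (o : MOrientation n M) (c : M) :
    ContinuousOn (fun y => o.chartSign c ((extChartAt (𝓡 n) c).symm y))
      (extChartAt (𝓡 n) c).target := by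
  intro y hy
  refine ContinuousAt.continuousWithinAt ?_
  have h := o.frameSign_eventually_eq (eventually_contMDiffAt_extChartAt_symm hy) (by
    rw [tderiv_extChartAt_symm hy]
    exact det_tangentCoordChange_ne_zero ((extChartAt (𝓡 n) c).map_target hy)
      (mem_extChartAt_source _))
  refine ContinuousAt.congr (f := fun _ => o.frameSign (extChartAt (𝓡 n) c).symm y)
    continuousAt_const ?_
  filter_upwards [h, target_mem_nhds (n := n) hy] with w hw hw'
  rw [o.chartSign_eq_frameSign hw', hw]

/-- Continuous `n`-forms on `S` with support in the compact set `K ⊆ S`. -/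
structure AdmOn (S K : Set M) (η : DForm n n M ℝ) : Prop where
  subset : K ⊆ S
  isCompact : IsCompact K
  eq_zero : ∀ x ∉ K, η x = 0
  continuousOn : ∀ c, ContinuousOn (inChart c η) (chartPart c S)

theorem AdmOn.add {S K : Set M} {η η' : DForm n n M ℝ} (h : AdmOn S K η) (h' : AdmOn S K η') :
    AdmOn S K (η + η') where
  subset := h.subset
  isCompact := h.isCompact
  eq_zero x hx := by
    change η x + η' x = 0
    rw [h.eq_zero x hx, h'.eq_zero x hx, add_zero]
  continuousOn c := by
    rw [inChart_add]
    exact (h.continuousOn c).add (h'.continuousOn c)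

theorem AdmOn.mono {S K K' : Set M} {η : DForm n n M ℝ} (h : AdmOn S K η) (hK : K ⊆ K')
    (hK' : IsCompact K') (hS : K' ⊆ S) : AdmOn S K' η where
  subset := hS
  isCompact := hK'
  eq_zero x hx := h.eq_zero x fun hx' => hx (hK hx')
  continuousOn := h.continuousOn

variable [T2Space M] [SigmaCompactSpace M]

/-- The partition of unity by which integrals are defined. -/
def intPart (n : ℕ) (M : Type*) [TopologicalSpace M] [ChartedSpace (𝔼 n) M] [IsManifold (𝓡 n) ∞ M]
    [T2Space M] [SigmaCompactSpace M] : SmoothPartitionOfUnity M (𝓡 n) M univ :=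
  (SmoothPartitionOfUnity.exists_isSubordinate_chartAt_source (𝓡 n) M).choose

theorem tsupport_intPart_subset (c : M) :
    tsupport (intPart n M c) ⊆ (extChartAt (𝓡 n) c).source := by
  rw [extChartAt_source]
  exact (SmoothPartitionOfUnity.exists_isSubordinate_chartAt_source (𝓡 n) M).choose_spec c

theorem intPart_eq_zero {c x : M} (h : x ∉ (extChartAt (𝓡 n) c).source) : intPart n M c x = 0 :=
  image_eq_zero_of_notMem_tsupport fun hx => h (tsupport_intPart_subset c hx)

/-- The contributions of the charts to an integral. -/
def MOrientation.integrand (o : MOrientation n M) (η : DForm n n M ℝ) (c : M) (y : 𝔼 n) : ℝ :=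
  intPart n M c ((extChartAt (𝓡 n) c).symm y) * o.chartSign c ((extChartAt (𝓡 n) c).symm y) *
    inChart c η y (stdFrame n)

theorem MOrientation.integral_eq_finsum (o : MOrientation n M) (η : DForm n n M ℝ) :
    o.integral η = ∑ᶠ c : M, ∫ y in (extChartAt (𝓡 n) c).target, o.integrand η c y := rfl

/-- The image in the chart at `c` of the part of `K` that contributes to integrals. -/
def chartCpt (n : ℕ) {M : Type*} [TopologicalSpace M] [ChartedSpace (𝔼 n) M]
    [IsManifold (𝓡 n) ∞ M] [T2Space M] [SigmaCompactSpace M] (K : Set M) (c : M) : Set (𝔼 n) :=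
  extChartAt (𝓡 n) c '' (K ∩ tsupport (intPart n M c))

theorem isCompact_chartCpt {K : Set M} (hK : IsCompact K) (c : M) : IsCompact (chartCpt n K c) :=
  (hK.inter_right (isClosed_tsupport _)).image_of_continuousOn
    ((continuousOn_extChartAt c).mono
      (inter_subset_right.trans (tsupport_intPart_subset c)))

theorem chartCpt_subset {K S : Set M} (hK : K ⊆ S) (c : M) : chartCpt n K c ⊆ chartPart c S := by
  rintro _ ⟨x, ⟨hx, hx'⟩, rfl⟩
  exact mem_chartPart (tsupport_intPart_subset c hx') (hK hx)

theorem mem_chartCpt {K : Set M} {c : M} {y : 𝔼 n} (hy : y ∈ (extChartAt (𝓡 n) c).target)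
    (hK : (extChartAt (𝓡 n) c).symm y ∈ K)
    (hs : (extChartAt (𝓡 n) c).symm y ∈ tsupport (intPart n M c)) : y ∈ chartCpt n K c :=
  ⟨_, ⟨hK, hs⟩, (extChartAt (𝓡 n) c).right_inv hy⟩

theorem continuousOn_intPart (c : M) :
    ContinuousOn (fun y => intPart n M c ((extChartAt (𝓡 n) c).symm y))
      (extChartAt (𝓡 n) c).target :=
  (intPart n M c).contMDiff.continuous.comp_continuousOn (continuousOn_extChartAt_symm c)

section
variable {S K : Set M} {η : DForm n n M ℝ} (h : AdmOn S K η) (o : MOrientation n M)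
include h

theorem AdmOn.integrand_eq_zero {c : M} {y : 𝔼 n} (hy : y ∈ (extChartAt (𝓡 n) c).target)
    (hK : y ∉ chartCpt n K c) : o.integrand η c y = 0 := by
  unfold MOrientation.integrand
  by_cases h1 : (extChartAt (𝓡 n) c).symm y ∈ K
  · rw [image_eq_zero_of_notMem_tsupport fun h2 => hK (mem_chartCpt hy h1 h2)]
    simp
  · unfold inChart
    rw [h.eq_zero _ h1]
    simp

theorem AdmOn.continuousOn_integrand (c : M) :
    ContinuousOn (o.integrand η c) (chartPart c S) := by
  refine ContinuousOn.mul (((continuousOn_intPart c).mono inter_subset_left).mul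
    ((o.continuousOn_chartSign c).mono inter_subset_left)) ?_
  exact (evalAlt ℝ (stdFrame n)).continuous.comp_continuousOn (h.continuousOn c)

/-- The integrand is continuous on the compact set `chartCpt n K c` and zero elsewhere in the chart.
Continuity on the whole chart is not available: a form cut off to a domain may jump at the boundary.
-/
theorem AdmOn.integrableOn_integrand (c : M) :
    IntegrableOn (o.integrand η c) (extChartAt (𝓡 n) c).target := by
  have h1 : IntegrableOn (o.integrand η c) (chartCpt n K c) :=
    ((h.continuousOn_integrand o c).mono (chartCpt_subset h.subset c)).integrableOn_compact
      (isCompact_chartCpt h.isCompact c)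
  refine h1.of_forall_sdiff_eq_zero (isOpen_extChartAt_target c).measurableSet fun y hy => ?_
  exact h.integrand_eq_zero o hy.1 hy.2

omit h in
theorem finite_relevant {K : Set M} (hK : IsCompact K) :
    {c : M | (Function.support (intPart n M c) ∩ K).Nonempty}.Finite :=
  (intPart n M).locallyFinite.finite_nonempty_inter_compact hK

theorem AdmOn.integral_eq_sum {F : Finset M}
    (hF : ∀ c, (Function.support (intPart n M c) ∩ K).Nonempty → c ∈ F) :
    o.integral η = ∑ c ∈ F, ∫ y in (extChartAt (𝓡 n) c).target, o.integrand η c y := by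
  rw [o.integral_eq_finsum]
  refine finsum_eq_sum_of_support_subset _ fun c hc => ?_
  by_contra hcF
  refine hc ?_
  refine setIntegral_eq_zero_of_forall_eq_zero fun y hy => ?_
  unfold MOrientation.integrand
  by_cases h1 : (extChartAt (𝓡 n) c).symm y ∈ K
  · have : intPart n M c ((extChartAt (𝓡 n) c).symm y) = 0 := by
      by_contra h2
      exact hcF (hF c ⟨_, h2, h1⟩)
    rw [this]; simp
  · unfold inChart
    rw [h.eq_zero _ h1]
    simp

end

theorem MOrientation.integral_add (o : MOrientation n M) {S K K' : Set M} {η η' : DForm n n M ℝ}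
    (h : AdmOn S K η) (h' : AdmOn S K' η') :
    o.integral (η + η') = o.integral η + o.integral η' := by
  have hc := h.isCompact.union h'.isCompact
  have hs := union_subset h.subset h'.subset
  replace h := h.mono (K' := K ∪ K') subset_union_left hc hs
  replace h' := h'.mono (K' := K ∪ K') subset_union_right hc hs
  have hF : ∀ c, (Function.support (intPart n M c) ∩ (K ∪ K')).Nonempty →
    c ∈ (finite_relevant (n := n) hc).toFinset := fun c hc' => by simpa using hc'
  rw [(h.add h').integral_eq_sum o hF, h.integral_eq_sum o hF, h'.integral_eq_sum o hF,
    ← Finset.sum_add_distrib]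
  refine Finset.sum_congr rfl fun c _ => ?_
  rw [← MeasureTheory.integral_add (h.integrableOn_integrand o c) (h'.integrableOn_integrand o c)]
  refine integral_congr_ae (Eventually.of_forall fun y => ?_)
  simp only [integrand, inChart_add, Pi.add_apply, ContinuousAlternatingMap.add_apply]
  ring

/-- No admissibility is needed: scalars pass through `finsum` and through the integral also when
these take their default value. -/
theorem MOrientation.integral_smul (o : MOrientation n M) (t : ℝ) (η : DForm n n M ℝ) :
    o.integral (t • η) = t * o.integral η := by
  rw [o.integral_eq_finsum, o.integral_eq_finsum, ← smul_eq_mul, smul_finsum]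
  refine finsum_congr fun c => ?_
  rw [smul_eq_mul, ← integral_const_mul]
  refine integral_congr_ae (Eventually.of_forall fun y => ?_)
  simp only [integrand, inChart_smul, Pi.smul_apply, ContinuousAlternatingMap.smul_apply,
    smul_eq_mul]
  ring

theorem MOrientation.integral_zero (o : MOrientation n M) :
    o.integral (0 : DForm n n M ℝ) = 0 := by
  have := o.integral_smul 0 (0 : DForm n n M ℝ)
  rwa [zero_smul, zero_mul] at this

end Integral


/-! ### Integration in a single parametrization -/

section ChangeOfVariables

open MeasureTheory Filter

variable {n : ℕ} {M : Type*} [TopologicalSpace M] [ChartedSpace (𝔼 n) M] [IsManifold (𝓡 n) ∞ M]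
  [T2Space M] [SigmaCompactSpace M] {S K : Set M} {η : DForm n n M ℝ}

/-- The factor `|D|` of the change of variables is `sign D * D`: the sign joins the orientation
sign, and `D` is absorbed by the pulled-back form. -/
theorem sign_mul_sign_self (o : MOrientation n M) (η : DForm n n M ℝ) {ψ : 𝔼 n → M} {z : 𝔼 n}
    (hψ : ContMDiffAt 𝓘(ℝ, 𝔼 n) (𝓡 n) ∞ ψ z) {c : M} (hc : ψ z ∈ (extChartAt (𝓡 n) c).source) :
    |(fderiv ℝ (extChartAt (𝓡 n) c ∘ ψ) z).det| • o.integrand η c (extChartAt (𝓡 n) c (ψ z)) =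
      intPart n M c (ψ z) * (o.frameSign ψ z * pull ψ η z (stdFrame n)) := by
  unfold MOrientation.integrand MOrientation.chartSign MOrientation.frameSign
  rw [(extChartAt (𝓡 n) c).left_inv hc, pull_eq_inChart hψ hc, alternating_comp_stdFrame,
    tderiv_eq_tangentCoordChange_comp hψ hc, det_comp', sign_mul', smul_eq_mul]
  set D := (fderiv ℝ (extChartAt (𝓡 n) c ∘ ψ) z).det
  have h : Real.sign D * D = |D| := by
    rcases lt_trichotomy D 0 with h | h | h
    · rw [Real.sign_of_neg h, abs_of_neg h]; ring
    · simp [h]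
    · rw [Real.sign_of_pos h, abs_of_pos h]; ring
  rw [← h]
  ring

/-- The change of variables is made in each chart separately, and the weights of the partition of
unity then add up to one. Injectivity and smoothness of `ψ` suffice, since at critical points both
sides of the pointwise identity vanish. -/
theorem integrableOn_and_integral_eq_of_param (h : AdmOn S K η) (o : MOrientation n M)
    {ψ : 𝔼 n → M} {V : Set (𝔼 n)} (hV : IsOpen V)
    (hψ : ∀ z ∈ V, ContMDiffAt 𝓘(ℝ, 𝔼 n) (𝓡 n) ∞ ψ z) (hinj : InjOn ψ V) (hK : K ⊆ ψ '' V) :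
    IntegrableOn (fun z => o.frameSign ψ z * pull ψ η z (stdFrame n)) V ∧
      o.integral η = ∫ z in V, o.frameSign ψ z * pull ψ η z (stdFrame n) := by
  set g : 𝔼 n → ℝ := fun z => o.frameSign ψ z * pull ψ η z (stdFrame n) with hg
  have hg0 : ∀ z, ψ z ∉ K → g z = 0 := fun z hz => by
    simp only [hg, pull]
    rw [h.eq_zero _ hz]
    simp
  have key : ∀ c : M, IntegrableOn (fun z => intPart n M c (ψ z) * g z) V ∧
      ∫ y in (extChartAt (𝓡 n) c).target, o.integrand η c y =
        ∫ z in V, intPart n M c (ψ z) * g z := by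
    intro c
    set Vc := V ∩ ψ ⁻¹' (extChartAt (𝓡 n) c).source with hVc
    have hVco : IsOpen Vc := ContinuousOn.isOpen_inter_preimage
      (fun z hz => (hψ z hz).continuousAt.continuousWithinAt) hV (isOpen_extChartAt_source c)
    set Φ : 𝔼 n → 𝔼 n := extChartAt (𝓡 n) c ∘ ψ with hΦ
    have hd : ∀ z ∈ Vc, HasFDerivWithinAt Φ (fderiv ℝ Φ z) Vc z := fun z hz =>
      ((contDiffAt_extChartAt_comp (hψ z hz.1) hz.2).differentiableAt
        (by simp)).hasFDerivAt.hasFDerivWithinAt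
    have hi : InjOn Φ Vc := fun z hz w hw hzw =>
      hinj hz.1 hw.1 ((extChartAt (𝓡 n) c).injOn hz.2 hw.2 hzw)
    have hsub : Φ '' Vc ⊆ (extChartAt (𝓡 n) c).target := by
      rintro _ ⟨z, hz, rfl⟩
      exact (extChartAt (𝓡 n) c).map_source hz.2
    -- Points of the chart that are not reached by `ψ` lie off the support, because `K ⊆ ψ '' V`.
    have hz : ∀ y ∈ (extChartAt (𝓡 n) c).target \ Φ '' Vc, o.integrand η c y = 0 := by
      rintro y ⟨hy, hy'⟩
      refine h.integrand_eq_zero o hy fun hyK => hy' ?_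
      obtain ⟨x, ⟨hxK, hx⟩, rfl⟩ := hyK
      obtain ⟨z, hzV, rfl⟩ := hK hxK
      exact ⟨z, ⟨hzV, tsupport_intPart_subset c hx⟩, rfl⟩
    have hout : ∀ z ∈ V \ Vc, intPart n M c (ψ z) * g z = 0 := fun z hz => by
      rw [intPart_eq_zero fun h => hz.2 ⟨hz.1, h⟩, zero_mul]
    have hpt : ∀ z ∈ Vc, |(fderiv ℝ Φ z).det| • o.integrand η c (Φ z) =
        intPart n M c (ψ z) * g z := fun z hz => sign_mul_sign_self o η (hψ z hz.1) hz.2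
    constructor
    · have h1 := (h.integrableOn_integrand o c).mono_set hsub
      rw [integrableOn_image_iff_integrableOn_abs_det_fderiv_smul volume hVco.measurableSet hd hi]
        at h1
      exact (h1.congr_fun hpt hVco.measurableSet).of_forall_sdiff_eq_zero hV.measurableSet hout
    · rw [setIntegral_eq_of_subset_of_forall_sdiff_eq_zero
        (isOpen_extChartAt_target c).measurableSet hsub hz,
        integral_image_eq_integral_abs_det_fderiv_smul volume hVco.measurableSet hd hi,
        setIntegral_congr_fun hVco.measurableSet hpt]
      exact (setIntegral_eq_of_subset_of_forall_sdiff_eq_zero hV.measurableSet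
        inter_subset_left hout).symm
  have hF : ∀ c, (Function.support (intPart n M c) ∩ K).Nonempty →
    c ∈ (finite_relevant (n := n) h.isCompact).toFinset := fun c hc' => by simpa using hc'
  set F := (finite_relevant (n := n) h.isCompact).toFinset
  have hsum : ∀ z, ∑ c ∈ F, intPart n M c (ψ z) * g z = g z := by
    intro z
    rw [← Finset.sum_mul]
    by_cases hz : ψ z ∈ K
    · have h1 : ∑ c ∈ F, intPart n M c (ψ z) = 1 := by
        rw [← (intPart n M).sum_eq_one (mem_univ (ψ z))]
        refine (finsum_eq_sum_of_support_subset _ fun c hc => ?_).symm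
        exact hF c ⟨_, hc, hz⟩
      rw [h1, one_mul]
    · rw [hg0 z hz, mul_zero]
  constructor
  · have h1 : IntegrableOn (fun z => ∑ c ∈ F, intPart n M c (ψ z) * g z) V :=
      integrable_finsetSum F fun c _ => (key c).1
    simpa only [hsum] using h1
  · rw [h.integral_eq_sum o hF, Finset.sum_congr rfl fun c _ => (key c).2,
      ← integral_finsetSum F fun c _ => (key c).1]
    simp only [hsum]

end ChangeOfVariables


/-! ### The divergence theorem on a half-space -/

section HalfSpace

open MeasureTheory Filter

/-- The theorem for boxes is applied to a box with one face in the plane `z 0 = 0` and so large that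
the functions vanish on all other faces. The remaining face is a lower one, which gives the minus
sign. Differentiability is needed only in the open half-space. -/
theorem integral_divergence_halfSpace_pi (f : Fin 3 → (Fin 3 → ℝ) → ℝ)
    (f' : Fin 3 → (Fin 3 → ℝ) → (Fin 3 → ℝ) →L[ℝ] ℝ) {K : Set (Fin 3 → ℝ)} (hK : IsCompact K)
    (hf : ∀ i, ∀ z ∉ K, f i z = 0) (hf' : ∀ i, ∀ z ∉ K, f' i z = 0)
    (hc : ∀ i, ContinuousOn (f i) {z | 0 ≤ z 0})
    (hd : ∀ i z, 0 < z 0 → HasFDerivAt (f i) (f' i z) z)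
    (hi : IntegrableOn (fun z => ∑ i, f' i z (Pi.single i 1)) {z | 0 ≤ z 0}) :
    ∫ z in {z : Fin 3 → ℝ | 0 ≤ z 0}, ∑ i, f' i z (Pi.single i 1) =
      - ∫ p : Fin 2 → ℝ, f 0 (Fin.cons 0 p) := by
  obtain ⟨R, hR0, hR⟩ := hK.isBounded.subset_ball_lt 0 0
  have hlt : ∀ z ∈ K, ∀ i, |z i| < R := fun z hz i =>
    lt_of_le_of_lt (norm_le_pi_norm z i) (by simpa using hR hz)
  set a : Fin 3 → ℝ := Fin.cons 0 fun _ => -R with ha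
  set b : Fin 3 → ℝ := fun _ => R with hb
  have ha0 : a 0 = 0 := rfl
  have ha1 : ∀ i : Fin 2, a i.succ = -R := fun i => by simp [ha]
  have hab : a ≤ b := by
    intro i
    refine Fin.cases ?_ (fun j => ?_) i
    · simpa [ha, hb] using hR0.le
    · rw [ha1]; simp only [hb]; linarith
  have hsub : Icc a b ⊆ {z : Fin 3 → ℝ | 0 ≤ z 0} := fun z hz => hz.1 0
  have hout : ∀ z ∈ {z : Fin 3 → ℝ | 0 ≤ z 0} \ Icc a b, ∑ i, f' i z (Pi.single i 1) = 0 := by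
    rintro z ⟨hz, hz'⟩
    refine Finset.sum_eq_zero fun i _ => ?_
    rw [hf' i z fun hzK => hz' ⟨fun j => ?_, fun j => (le_abs_self _).trans (hlt z hzK j).le⟩]
    · simp
    · refine Fin.cases hz (fun k => ?_) j
      rw [ha1]
      exact (neg_le_neg (hlt z hzK k.succ).le).trans (neg_abs_le _)
  have hmeas : MeasurableSet {z : Fin 3 → ℝ | 0 ≤ z 0} :=
    measurableSet_le measurable_const (measurable_pi_apply 0)
  rw [setIntegral_eq_of_subset_of_forall_sdiff_eq_zero hmeas hsub hout,
    integral_divergence_of_hasFDerivAt_off_countable' a b hab f f' ∅ countable_empty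
      (fun i => (hc i).mono hsub) (fun z hz i => hd i z ((hz.1 0 (mem_univ _)).1))
      (hi.mono_set hsub), Fin.sum_univ_succ]
  have hfront : ∀ i (x : Fin 2 → ℝ), f i (i.insertNth (b i) x) = 0 := fun i x => by
    refine hf i _ fun hK => ?_
    have := hlt _ hK i
    simp only [Fin.insertNth_apply_same, hb] at this
    rw [abs_of_pos hR0] at this
    exact lt_irrefl _ this
  have hback : ∀ (i : Fin 2) (x : Fin 2 → ℝ), f i.succ (i.succ.insertNth (a i.succ) x) = 0 :=
    fun i x => by
      refine hf _ _ fun hK => ?_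
      have := hlt _ hK i.succ
      rw [Fin.insertNth_apply_same, ha1, abs_neg, abs_of_pos hR0] at this
      exact lt_irrefl _ this
  simp only [hfront, hback, integral_zero, sub_zero, Finset.sum_const_zero, add_zero, zero_sub]
  congr 1
  rw [setIntegral_eq_integral_of_forall_compl_eq_zero]
  · simp only [Fin.insertNth_zero', ha0]
  · intro x hx
    refine hf _ _ fun hK => hx ?_
    have h1 : ∀ j : Fin 2, |x j| < R := fun j => by
      have := hlt _ hK j.succ
      simpa using this
    refine ⟨fun j => ?_, fun j => (le_abs_self _).trans (h1 j).le⟩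
    change a (Fin.succAbove 0 j) ≤ x j
    rw [Fin.succAbove_zero, ha1]
    exact (neg_le_neg (h1 j).le).trans (neg_abs_le _)

/-- The closed half-space. -/
abbrev halfSpace : Set (𝔼 3) := {z | 0 ≤ z 0}

/-- The inclusion of the boundary plane of the half-space, shifted by `r`. -/
def slice (r : ℝ) (p : 𝔼 2) : 𝔼 3 := WithLp.toLp 2 (Fin.cons r (WithLp.ofLp p))

theorem isClosed_halfSpace : IsClosed halfSpace :=
  isClosed_le continuous_const (by fun_prop)

theorem isOpen_openHalfSpace : IsOpen {z : 𝔼 3 | 0 < z 0} :=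
  isOpen_lt continuous_const (by fun_prop)

theorem openHalfSpace_subset_interior : {z : 𝔼 3 | 0 < z 0} ⊆ interior halfSpace :=
  interior_maximal (fun z hz => le_of_lt (show 0 < z 0 from hz)) isOpen_openHalfSpace

theorem convex_halfSpace : Convex ℝ halfSpace :=
  convex_halfSpace_ge (f := fun z : 𝔼 3 => z 0) ⟨fun _ _ => rfl, fun _ _ => rfl⟩ 0

theorem uniqueDiffOn_halfSpace : UniqueDiffOn ℝ halfSpace :=
  uniqueDiffOn_convex convex_halfSpace
    ⟨slice 1 0, openHalfSpace_subset_interior (show (0 : ℝ) < 1 from one_pos)⟩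

/-- The divergence theorem on a half-space. -/
theorem integral_divergence_halfSpace (f : Fin 3 → 𝔼 3 → ℝ) {K : Set (𝔼 3)} (hK : IsCompact K)
    (hf : ∀ i, ∀ z ∉ K, f i z = 0) (hd : ∀ i, ContDiffOn ℝ 1 (f i) halfSpace) :
    ∫ z in halfSpace, ∑ i, fderivWithin ℝ (f i) halfSpace z (EuclideanSpace.single i 1) =
      - ∫ p : 𝔼 2, f 0 (slice 0 p) := by
  have hz : ∀ i, ∀ z ∉ K, fderivWithin ℝ (f i) halfSpace z = 0 := fun i z hz => by
    have h1 : f i =ᶠ[𝓝 z] fun _ => 0 := by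
      filter_upwards [hK.isClosed.isOpen_compl.mem_nhds hz] with w hw using hf i w hw
    rw [(h1.filter_mono nhdsWithin_le_nhds).fderivWithin_eq h1.self_of_nhds,
      fderivWithin_fun_const]
    rfl
  have hcont : ∀ i, ContinuousOn (fderivWithin ℝ (f i) halfSpace) halfSpace := fun i =>
    (hd i).continuousOn_fderivWithin uniqueDiffOn_halfSpace le_rfl
  have hint : IntegrableOn (fun z => ∑ i, fderivWithin ℝ (f i) halfSpace z
      (EuclideanSpace.single i 1)) halfSpace := by
    have hc1 : ContinuousOn (fun z => ∑ i, fderivWithin ℝ (f i) halfSpace z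
        (EuclideanSpace.single i 1)) (halfSpace ∩ K) :=
      continuousOn_finsetSum _ fun i _ =>
        ((hcont i).mono inter_subset_left).clm_apply continuousOn_const
    refine (hc1.integrableOn_compact
      (hK.inter_left isClosed_halfSpace)).of_forall_sdiff_eq_zero isClosed_halfSpace.measurableSet
        fun z hz' => Finset.sum_eq_zero fun i _ => ?_
    rw [hz i z fun h => hz'.2 ⟨hz'.1, h⟩]
    rfl
  -- The box theorem lives on `Fin 3 → ℝ`; the identity map to Euclidean space preserves volume.
  let e : 𝔼 3 ≃L[ℝ] (Fin 3 → ℝ) := EuclideanSpace.equiv (Fin 3) ℝ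
  have hmp : MeasurePreserving (e.symm : (Fin 3 → ℝ) → 𝔼 3) := PiLp.volume_preserving_toLp (Fin 3)
  have hme : MeasurableEmbedding (e.symm : (Fin 3 → ℝ) → 𝔼 3) :=
    e.symm.toHomeomorph.measurableEmbedding
  have hes : ∀ i, e.symm (Pi.single i 1) = EuclideanSpace.single i (1 : ℝ) := fun i => rfl
  have hpre : e.symm ⁻¹' halfSpace = {z : Fin 3 → ℝ | 0 ≤ z 0} := rfl
  have key := integral_divergence_halfSpace_pi (fun i w => f i (e.symm w))
    (fun i w => (fderivWithin ℝ (f i) halfSpace (e.symm w)).comp (e.symm : (Fin 3 → ℝ) →L[ℝ] 𝔼 3))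
    (K := e '' K) (hK.image e.continuous)
    (fun i w hw => hf i _ fun h => hw ⟨_, h, e.apply_symm_apply w⟩)
    (fun i w hw => by
      rw [hz i _ fun h => hw ⟨_, h, e.apply_symm_apply w⟩]; rfl)
    (fun i => (hd i).continuousOn.comp e.symm.continuous.continuousOn fun w hw => hw)
    (fun i w hw => by
      have h1 : halfSpace ∈ 𝓝 (e.symm w) :=
        mem_interior_iff_mem_nhds.1 (openHalfSpace_subset_interior hw)
      have h2 := ((hd i).contDiffAt h1).differentiableAt one_ne_zero
      rw [fderivWithin_of_mem_nhds h1]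
      exact h2.hasFDerivAt.comp w e.symm.hasFDerivAt)
    (by
      have := (hmp.integrableOn_comp_preimage hme).2 hint
      exact this)
  have h1 := hmp.setIntegral_preimage_emb hme (fun z => ∑ i, fderivWithin ℝ (f i) halfSpace z
      (EuclideanSpace.single i 1)) halfSpace
  rw [← h1]
  refine key.trans ?_
  congr 1
  have hmp2 : MeasurePreserving (WithLp.toLp 2 : (Fin 2 → ℝ) → 𝔼 2) :=
    PiLp.volume_preserving_toLp (Fin 2)
  have hme2 : MeasurableEmbedding (WithLp.toLp 2 : (Fin 2 → ℝ) → 𝔼 2) :=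
    (EuclideanSpace.equiv (Fin 2) ℝ).symm.toHomeomorph.measurableEmbedding
  rw [← hmp2.integral_comp hme2]
  rfl

end HalfSpace


/-! ### Tubular coordinates, the orientation of the boundary, regularity of the exterior -/

/-- The projection onto the boundary plane of the half-space. -/
def tail : 𝔼 3 →L[ℝ] 𝔼 2 :=
  ((EuclideanSpace.equiv (Fin 2) ℝ).symm : (Fin 2 → ℝ) →L[ℝ] 𝔼 2).comp
    (ContinuousLinearMap.pi fun i => EuclideanSpace.proj i.succ)

/-- The normal coordinate. -/
def normalCoord : 𝔼 3 →L[ℝ] ℝ := EuclideanSpace.proj 0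

theorem tail_slice (r : ℝ) (p : 𝔼 2) : tail (slice r p) = p := rfl

theorem slice_zero_coord (r : ℝ) (p : 𝔼 2) : slice r p 0 = r := rfl

theorem slice_tail (z : 𝔼 3) : slice (z 0) (tail z) = z := by
  ext i
  exact Fin.cases rfl (fun _ => rfl) i

theorem continuous_slice : Continuous fun q : ℝ × 𝔼 2 => slice q.1 q.2 := by
  have h : Continuous fun q : ℝ × 𝔼 2 => (Fin.cons q.1 (WithLp.ofLp q.2) : Fin 3 → ℝ) := by
    refine continuous_pi fun i => ?_
    refine Fin.cases ?_ (fun j => ?_) i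
    · exact continuous_fst
    · simp only [Fin.cons_succ]; fun_prop
  exact (EuclideanSpace.equiv (Fin 3) ℝ).symm.continuous.comp h

theorem tail_single_succ (i : Fin 2) :
    tail (EuclideanSpace.single i.succ 1) = EuclideanSpace.single i 1 := by
  ext j
  change EuclideanSpace.single i.succ (1 : ℝ) j.succ = EuclideanSpace.single i (1 : ℝ) j
  simp

theorem tail_single_zero : tail (EuclideanSpace.single 0 1) = 0 := by
  ext j
  change EuclideanSpace.single (0 : Fin 3) (1 : ℝ) j.succ = 0
  simp

theorem det_three_smul {a b : ℝ} (x y z : 𝔼 3) :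
    (EuclideanSpace.basisFun (Fin 3) ℝ).toBasis.det ![a • x, y, b • z] =
      a * b * (EuclideanSpace.basisFun (Fin 3) ℝ).toBasis.det ![x, y, z] := by
  simp only [Module.Basis.det_apply, Matrix.det_fin_three, Module.Basis.toMatrix_apply]
  simp
  ring

theorem det_two_smul {b : ℝ} (x y : 𝔼 2) :
    (EuclideanSpace.basisFun (Fin 2) ℝ).toBasis.det ![x, b • y] =
      b * (EuclideanSpace.basisFun (Fin 2) ℝ).toBasis.det ![x, y] := by
  simp only [Module.Basis.det_apply, Matrix.det_fin_two, Module.Basis.toMatrix_apply]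
  simp
  ring

theorem basis_det_comp_stdFrame {n : ℕ} (L : 𝔼 n →L[ℝ] 𝔼 n) :
    (EuclideanSpace.basisFun (Fin n) ℝ).toBasis.det (fun i => L (stdFrame n i)) = L.det := by
  set b := (EuclideanSpace.basisFun (Fin n) ℝ).toBasis with hb
  have hbe : (b : Fin n → 𝔼 n) = stdFrame n := by
    funext i
    simp [hb]
  have h2 : b.det (L ∘ b) = L.det * b.det b := Module.Basis.det_comp b (L : 𝔼 n →ₗ[ℝ] 𝔼 n) b
  rw [Module.Basis.det_self, mul_one, hbe] at h2
  exact h2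

namespace Tube

variable {Y X : Type*} [TopologicalSpace Y] [ChartedSpace (𝔼 2) Y] [IsManifold (𝓡 2) ∞ Y]
  [TopologicalSpace X] [ChartedSpace (𝔼 3) X] [IsManifold (𝓡 3) ∞ X]
  {oY : MOrientation 2 Y} {oX : MOrientation 3 X} (κ : Tube oY oX)

theorem contMDiff : ContMDiff ((𝓡 2).prod 𝓘(ℝ, ℝ)) (𝓡 3) ∞ κ.toFun :=
  κ.isLocalDiffeomorph.contMDiff

/-- The derivative of the tubular neighbourhood. -/
def deriv (q : Y × ℝ) : 𝔼 2 × ℝ →L[ℝ] 𝔼 3 := tderiv ((𝓡 2).prod 𝓘(ℝ, ℝ)) (𝓡 3) κ.toFun q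

theorem deriv_injective (q : Y × ℝ) : Function.Injective (κ.deriv q) :=
  ((κ.isLocalDiffeomorph q).mfderivToContinuousLinearEquiv (by simp)).injective

theorem isOpenEmbedding : Topology.IsOpenEmbedding κ.toFun :=
  .of_continuous_injective_isOpenMap κ.contMDiff.continuous κ.injective
    κ.isLocalDiffeomorph.isOpenMap

/-- The part of the tubular neighbourhood over a chart of the surface, as a parametrized domain. -/
def param (s : Y) (z : 𝔼 3) : X := κ.toFun ((extChartAt (𝓡 2) s).symm (tail z), z 0)

/-- The domain of `param`. -/
def paramDom (s : Y) : Set (𝔼 3) := tail ⁻¹' (extChartAt (𝓡 2) s).target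

theorem isOpen_paramDom (s : Y) : IsOpen (paramDom s) :=
  (isOpen_extChartAt_target s).preimage tail.continuous

theorem contMDiffAt_coords {s : Y} {z : 𝔼 3} (hz : z ∈ paramDom s) :
    ContMDiffAt 𝓘(ℝ, 𝔼 3) ((𝓡 2).prod 𝓘(ℝ, ℝ)) ∞
      (fun z : 𝔼 3 => ((extChartAt (𝓡 2) s).symm (tail z), normalCoord z)) z := by
  refine ContMDiffAt.prodMk ?_ normalCoord.contDiff.contDiffAt.contMDiffAt
  exact (contMDiffAt_extChartAt_symm hz).comp z tail.contDiff.contDiffAt.contMDiffAt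

theorem contMDiffAt_param {s : Y} {z : 𝔼 3} (hz : z ∈ paramDom s) :
    ContMDiffAt 𝓘(ℝ, 𝔼 3) (𝓡 3) ∞ (κ.param s) z :=
  κ.contMDiff.contMDiffAt.comp z (contMDiffAt_coords hz)

theorem eventually_contMDiffAt_param {s : Y} {z : 𝔼 3} (hz : z ∈ paramDom s) :
    ∀ᶠ w in 𝓝 z, ContMDiffAt 𝓘(ℝ, 𝔼 3) (𝓡 3) ∞ (κ.param s) w := by
  filter_upwards [(isOpen_paramDom s).mem_nhds hz] with w hw using κ.contMDiffAt_param hw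

theorem injOn_param (s : Y) : InjOn (κ.param s) (paramDom s) := by
  intro z hz w hw h
  have h1 := κ.injective h
  have h2 := (extChartAt (𝓡 2) s).symm.injOn hz hw (congrArg Prod.fst h1)
  have h3 : z 0 = w 0 := congrArg Prod.snd h1
  rw [← slice_tail z, ← slice_tail w, h2, h3]

theorem tderiv_param {s : Y} {z : 𝔼 3} (hz : z ∈ paramDom s) (v : 𝔼 3) :
    tderiv 𝓘(ℝ, 𝔼 3) (𝓡 3) (κ.param s) z v =
      κ.deriv ((extChartAt (𝓡 2) s).symm (tail z), z 0)
        (tderiv 𝓘(ℝ, 𝔼 2) (𝓡 2) (extChartAt (𝓡 2) s).symm (tail z) (tail v), v 0) := by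
  have h1 := (contMDiffAt_extChartAt_symm (n := 2) hz).mdifferentiableAt (by simp)
  have ht : MDifferentiableAt 𝓘(ℝ, 𝔼 3) 𝓘(ℝ, 𝔼 2) tail z := tail.differentiableAt.mdifferentiableAt
  have hn : MDifferentiableAt 𝓘(ℝ, 𝔼 3) 𝓘(ℝ, ℝ) normalCoord z :=
    normalCoord.differentiableAt.mdifferentiableAt
  have h2 := tderiv_comp (I := 𝓘(ℝ, 𝔼 3)) (I' := (𝓡 2).prod 𝓘(ℝ, ℝ)) (I'' := 𝓡 3) (x := z)
    (g := κ.toFun) (f := fun z : 𝔼 3 => ((extChartAt (𝓡 2) s).symm (tail z), normalCoord z))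
    (κ.contMDiff.mdifferentiable (by simp) _)
    ((contMDiffAt_coords hz).mdifferentiableAt (by simp))
  have h3 : tderiv 𝓘(ℝ, 𝔼 3) ((𝓡 2).prod 𝓘(ℝ, ℝ))
      (fun z : 𝔼 3 => ((extChartAt (𝓡 2) s).symm (tail z), normalCoord z)) z =
      (tderiv 𝓘(ℝ, 𝔼 3) (𝓡 2) ((extChartAt (𝓡 2) s).symm ∘ tail) z).prod
        (tderiv 𝓘(ℝ, 𝔼 3) 𝓘(ℝ, ℝ) normalCoord z) :=
    mfderiv_prodMk (h1.comp z ht) hn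
  have h4 := tderiv_comp (I := 𝓘(ℝ, 𝔼 3)) (I' := 𝓘(ℝ, 𝔼 2)) (I'' := 𝓡 2) (x := z) h1 ht
  rw [tderiv_eq_fderiv, ContinuousLinearMap.fderiv] at h4
  rw [h4, tderiv_eq_fderiv, ContinuousLinearMap.fderiv] at h3
  rw [h3] at h2
  exact congrArg (fun l => l v) h2

theorem det_tderiv_extChartAt_symm_ne_zero {s : Y} {p : 𝔼 2}
    (hp : p ∈ (extChartAt (𝓡 2) s).target) :
    (tderiv 𝓘(ℝ, 𝔼 2) (𝓡 2) (extChartAt (𝓡 2) s).symm p).det ≠ 0 := by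
  rw [tderiv_extChartAt_symm hp]
  exact det_tangentCoordChange_ne_zero ((extChartAt (𝓡 2) s).map_target hp)
    (mem_extChartAt_source _)

theorem tderiv_extChartAt_symm_injective {s : Y} {p : 𝔼 2}
    (hp : p ∈ (extChartAt (𝓡 2) s).target) :
    Function.Injective (tderiv 𝓘(ℝ, 𝔼 2) (𝓡 2) (extChartAt (𝓡 2) s).symm p) := by
  have h := (LinearMap.equivOfDetNeZero
    (tderiv 𝓘(ℝ, 𝔼 2) (𝓡 2) (extChartAt (𝓡 2) s).symm p : 𝔼 2 →ₗ[ℝ] 𝔼 2)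
    (det_tderiv_extChartAt_symm_ne_zero hp)).injective
  exact h

theorem tderiv_param_injective {s : Y} {z : 𝔼 3} (hz : z ∈ paramDom s) :
    Function.Injective (tderiv 𝓘(ℝ, 𝔼 3) (𝓡 3) (κ.param s) z) := by
  intro v w h
  rw [κ.tderiv_param hz, κ.tderiv_param hz] at h
  have h1 := κ.deriv_injective _ h
  have h2 := tderiv_extChartAt_symm_injective hz (congrArg Prod.fst h1)
  have h3 : v 0 = w 0 := congrArg Prod.snd h1
  rw [← slice_tail v, ← slice_tail w, h2, h3]

theorem det_tderiv_param_ne_zero {s : Y} {z : 𝔼 3} (hz : z ∈ paramDom s) :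
    (tderiv 𝓘(ℝ, 𝔼 3) (𝓡 3) (κ.param s) z).det ≠ 0 := by
  intro h
  have h1 := LinearMap.bot_lt_ker_of_det_eq_zero
    (f := (tderiv 𝓘(ℝ, 𝔼 3) (𝓡 3) (κ.param s) z : 𝔼 3 →ₗ[ℝ] 𝔼 3)) h
  have h2 := (LinearMap.ker_eq_bot
    (f := (tderiv 𝓘(ℝ, 𝔼 3) (𝓡 3) (κ.param s) z : 𝔼 3 →ₗ[ℝ] 𝔼 3))).2 (κ.tderiv_param_injective hz)
  exact h1.ne' h2

/-- In the coordinates of `param` the normal direction comes first and points into the exterior,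
whereas the boundary orientation puts the outward normal first; the reversal gives the minus sign.
-/
theorem boundary_frameSign {s : Y} {z : 𝔼 3} (hz : z ∈ paramDom s) (hz0 : z 0 = 0) :
    oX.frameSign (κ.param s) z = - oY.frameSign (extChartAt (𝓡 2) s).symm (tail z) := by
  set T := tderiv 𝓘(ℝ, 𝔼 2) (𝓡 2) (extChartAt (𝓡 2) s).symm (tail z) with hT
  set L := tderiv 𝓘(ℝ, 𝔼 3) (𝓡 3) (κ.param s) z with hL
  set s' := (extChartAt (𝓡 2) s).symm (tail z) with hs'
  set σ := oY.frameSign (extChartAt (𝓡 2) s).symm (tail z) with hσ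
  have hσ' : σ = oY.sgn s' * Real.sign T.det := rfl
  have hTd : T.det ≠ 0 := det_tderiv_extChartAt_symm_ne_zero hz
  have hYs : oY.sgn s' * oY.sgn s' = 1 := by rcases oY.sgn_eq s' with h | h <;> simp [h]
  have hTe := basis_det_comp_stdFrame T
  have hLe := basis_det_comp_stdFrame L
  have h2 : (fun i => T (stdFrame 2 i)) = ![T (stdFrame 2 0), T (stdFrame 2 1)] := by
    funext i; fin_cases i <;> rfl
  have h3 : (fun i => L (stdFrame 3 i)) = ![L (stdFrame 3 0), L (stdFrame 3 1), L (stdFrame 3 2)] := by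
    funext i; fin_cases i <;> rfl
  rw [h2] at hTe
  rw [h3] at hLe
  have hsa : Real.sign T.det * T.det = |T.det| := by
    rcases lt_or_gt_of_ne hTd with h | h
    · rw [Real.sign_of_neg h, abs_of_neg h]; ring
    · rw [Real.sign_of_pos h, abs_of_pos h]; ring
  -- The second frame vector is multiplied by the sign `σ` of the chart, so that the frame is
  -- positive even if the chart reverses orientation.
  have hpos : oY.Positive s' ![T (stdFrame 2 0), σ • T (stdFrame 2 1)] := by
    unfold MOrientation.Positive
    rw [det_two_smul, hTe, hσ', ← mul_assoc, ← mul_assoc, hYs, one_mul, hsa]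
    exact abs_pos.2 hTd
  have hb := κ.boundary s' _ _ hpos
  have hx : κ.toFun (s', 0) = κ.param s z := by rw [param, hz0]
  have e0 : κ.deriv (s', 0) (0, -1) = (-1 : ℝ) • L (stdFrame 3 0) := by
    rw [hL, κ.tderiv_param hz, hz0, ← map_smul]
    congr 1
    ext1
    · simp [stdFrame, tail_single_zero]
    · simp [stdFrame]
  have e1 : κ.deriv (s', 0) (T (stdFrame 2 0), 0) = L (stdFrame 3 1) := by
    rw [hL, κ.tderiv_param hz, hz0]
    congr 1
    ext1
    · exact congrArg T (tail_single_succ 0).symm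
    · simp [stdFrame]
  have e2 : κ.deriv (s', 0) (σ • T (stdFrame 2 1), 0) = σ • L (stdFrame 3 2) := by
    have e3 : (σ • T (stdFrame 2 1), (0 : ℝ)) = σ • (T (tail (stdFrame 3 2)), stdFrame 3 2 0) := by
      ext1
      · exact congrArg (fun v => σ • T v) (tail_single_succ 1).symm
      · simp [stdFrame]
    rw [e3, map_smul, hL, κ.tderiv_param hz, hz0]
  have hb' : 0 < oX.sgn (κ.toFun (s', 0)) * (EuclideanSpace.basisFun (Fin 3) ℝ).toBasis.det
    ![κ.deriv (s', 0) (0, -1), κ.deriv (s', 0) (T (stdFrame 2 0), 0),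
      κ.deriv (s', 0) (σ • T (stdFrame 2 1), 0)] := hb
  rw [e0, e1, e2, det_three_smul, hLe, hx] at hb'
  have hσ1 : σ = 1 ∨ σ = -1 := by
    rw [hσ']
    rcases oY.sgn_eq s' with h | h <;> rcases Real.sign_apply_eq_of_ne_zero _ hTd with h' | h' <;>
      simp [h, h']
  have hX : oX.frameSign (κ.param s) z = Real.sign (oX.sgn (κ.param s z) * L.det) := by
    rw [sign_mul', MOrientation.frameSign]
    congr 1
    rcases oX.sgn_eq (κ.param s z) with h | h <;> simp [h, Real.sign_neg]
  rw [hX]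
  rcases hσ1 with h | h
  · rw [h] at hb' ⊢
    exact Real.sign_of_neg (by linarith)
  · rw [h] at hb' ⊢
    rw [neg_neg]
    exact Real.sign_of_pos (by linarith)

/-- The sign is locally constant along the normal line through `z`, which is connected and meets the
surface, where `boundary_frameSign` applies. -/
theorem frameSign_param {s : Y} {z : 𝔼 3} (hz : z ∈ paramDom s) :
    oX.frameSign (κ.param s) z = - oY.frameSign (extChartAt (𝓡 2) s).symm (tail z) := by
  have hmem : ∀ r, slice r (tail z) ∈ paramDom s := fun r => hz
  have hlc : IsLocallyConstant fun r : ℝ => oX.frameSign (κ.param s) (slice r (tail z)) := by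
    rw [IsLocallyConstant.iff_eventually_eq]
    intro r
    have h1 := oX.frameSign_eventually_eq (κ.eventually_contMDiffAt_param (hmem r))
      (κ.det_tderiv_param_ne_zero (hmem r))
    have hc : Continuous fun r : ℝ => slice r (tail z) :=
      continuous_slice.comp (continuous_id.prodMk continuous_const)
    exact hc.continuousAt.eventually h1
  have h2 := hlc.apply_eq_of_preconnectedSpace (z 0) 0
  simp only [slice_tail] at h2
  rw [h2, κ.boundary_frameSign (hmem 0) rfl, tail_slice]

theorem param_mem_exterior {s : Y} {z : 𝔼 3} (h0 : 0 ≤ z 0) : κ.param s z ∈ κ.exterior :=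
  ⟨_, h0, rfl⟩

theorem param_mem_exterior_iff {s : Y} {z : 𝔼 3} : κ.param s z ∈ κ.exterior ↔ 0 ≤ z 0 := by
  refine ⟨?_, κ.param_mem_exterior⟩
  rintro ⟨q, hq, hqz⟩
  have := κ.injective hqz
  rw [this] at hq
  exact hq

/-- The coordinates that belong to `param`. -/
def coords (s : Y) (q : Y × ℝ) : 𝔼 3 := slice q.2 (extChartAt (𝓡 2) s q.1)

theorem param_coords {s : Y} {q : Y × ℝ} (hq : q.1 ∈ (extChartAt (𝓡 2) s).source) :
    κ.param s (coords s q) = κ.toFun q := by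
  unfold param coords
  rw [tail_slice, slice_zero_coord, (extChartAt (𝓡 2) s).left_inv hq]

theorem coords_mem_paramDom {s : Y} {q : Y × ℝ} (hq : q.1 ∈ (extChartAt (𝓡 2) s).source) :
    coords s q ∈ paramDom s := by
  change tail (slice _ _) ∈ (extChartAt (𝓡 2) s).target
  rw [tail_slice]
  exact (extChartAt (𝓡 2) s).map_source hq

theorem continuousOn_coords (s : Y) :
    ContinuousOn (coords s) (Prod.fst ⁻¹' (extChartAt (𝓡 2) s).source) :=
  continuous_slice.comp_continuousOn (continuousOn_snd.prodMk
    ((continuousOn_extChartAt s).comp continuousOn_fst fun _ hq => hq))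

theorem uniqueDiffOn_paramDom_inter (s : Y) : UniqueDiffOn ℝ (paramDom s ∩ halfSpace) := by
  rw [inter_comm]
  exact uniqueDiffOn_halfSpace.inter (isOpen_paramDom s)

theorem halfSpace_subset_closure : halfSpace ⊆ closure {z : 𝔼 3 | 0 < z 0} := by
  intro z hz
  refine mem_closure_of_tendsto (f := fun r : ℝ => slice (z 0 + r) (tail z)) (b := 𝓝[>] 0) ?_ ?_
  · have hc : Continuous fun r : ℝ => slice (z 0 + r) (tail z) :=
      continuous_slice.comp ((continuous_const.add continuous_id).prodMk continuous_const)
    have := hc.tendsto 0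
    rw [add_zero, slice_tail] at this
    exact this.mono_left nhdsWithin_le_nhds
  · filter_upwards [self_mem_nhdsWithin] with r hr
    exact add_pos_of_nonneg_of_pos hz hr

theorem mem_closure_inter_openHalfSpace {V : Set (𝔼 3)} (hV : IsOpen V) {z : 𝔼 3}
    (hz : z ∈ V) (h0 : z ∈ halfSpace) : z ∈ closure (V ∩ {z : 𝔼 3 | 0 < z 0}) :=
  hV.inter_closure ⟨hz, halfSpace_subset_closure h0⟩

/-- The exterior is a domain with boundary. -/
theorem regular_exterior : Regular 3 κ.exterior := by
  intro c
  have main : ∀ y ∈ chartPart (n := 3) c κ.exterior,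
      UniqueDiffWithinAt ℝ (chartPart (n := 3) c κ.exterior) y ∧
      y ∈ closure (interior (chartPart (n := 3) c κ.exterior)) := by
    rintro y ⟨hy, q, hq, hqy⟩
    set s := q.1
    have hs : q.1 ∈ (extChartAt (𝓡 2) s).source := mem_extChartAt_source _
    set z := coords s q with hzdef
    have hz : z ∈ paramDom s := coords_mem_paramDom hs
    have hz0 : z ∈ halfSpace := hq
    have hpz : κ.param s z = (extChartAt (𝓡 3) c).symm y := (κ.param_coords hs).trans hqy
    have hsrc : κ.param s z ∈ (extChartAt (𝓡 3) c).source := by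
      rw [hpz]; exact (extChartAt (𝓡 3) c).map_target hy
    set V := paramDom s ∩ κ.param s ⁻¹' (extChartAt (𝓡 3) c).source with hV
    have hVo : IsOpen V := ContinuousOn.isOpen_inter_preimage
      (fun w hw => (κ.contMDiffAt_param hw).continuousAt.continuousWithinAt)
      (isOpen_paramDom s) (isOpen_extChartAt_source c)
    -- The passage from tubular coordinates to the chart at `c` has invertible derivatives and maps
    -- the half-space into the exterior. It transports both properties of the half-space: unique
    -- derivatives, and lying in the closure of the interior.
    set Φ : 𝔼 3 → 𝔼 3 := extChartAt (𝓡 3) c ∘ κ.param s with hΦ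
    have hΦz : Φ z = y := by
      simp only [hΦ, Function.comp_apply, hpz]
      exact (extChartAt (𝓡 3) c).right_inv hy
    have hΦd : ∀ w ∈ V, ContDiffAt ℝ ∞ Φ w := fun w hw =>
      contDiffAt_extChartAt_comp (κ.contMDiffAt_param hw.1) hw.2
    have hΦi : ∀ w ∈ V, Function.Injective (fderiv ℝ Φ w) := fun w hw => by
      have h := κ.tderiv_param_injective hw.1
      rw [tderiv_eq_tangentCoordChange_comp (κ.contMDiffAt_param hw.1) hw.2] at h
      exact Function.Injective.of_comp h
    have hΦs : ∀ w ∈ V, Function.Surjective (fderiv ℝ Φ w) := fun w hw =>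
      (LinearMap.injective_iff_surjective (f := (fderiv ℝ Φ w : 𝔼 3 →ₗ[ℝ] 𝔼 3))).1 (hΦi w hw)
    have hsub : Φ '' (V ∩ halfSpace) ⊆ chartPart c κ.exterior := by
      rintro _ ⟨w, ⟨hw, hw0⟩, rfl⟩
      exact mem_chartPart hw.2 (κ.param_mem_exterior hw0)
    constructor
    · have h1 : UniqueDiffWithinAt ℝ (V ∩ halfSpace) z := by
        rw [inter_comm]
        exact (uniqueDiffOn_halfSpace.inter hVo) z ⟨hz0, hz, hsrc⟩
      have h2 := ((hΦd z ⟨hz, hsrc⟩).differentiableAt (by simp)).hasFDerivAt.hasFDerivWithinAt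
        (s := V ∩ halfSpace) |>.uniqueDiffWithinAt h1 (hΦs z ⟨hz, hsrc⟩).denseRange
      rw [hΦz] at h2
      exact h2.mono hsub
    · have h1 := mem_closure_inter_openHalfSpace hVo ⟨hz, hsrc⟩ hz0
      have h2 : Φ z ∈ closure (Φ '' (V ∩ {z : 𝔼 3 | 0 < z 0})) :=
        (hΦd z ⟨hz, hsrc⟩).continuousAt.continuousWithinAt.mem_closure_image h1
      rw [hΦz] at h2
      refine closure_mono (interior_maximal ?_ ?_) h2
      · exact (image_mono (inter_subset_inter_right V
          (openHalfSpace_subset_interior.trans interior_subset))).trans hsub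
      · rw [isOpen_iff_mem_nhds]
        rintro _ ⟨w, hw, rfl⟩
        -- A strictly differentiable map with surjective derivative is open at `w`, so the image of
        -- the open half-space lies in the interior.
        have h3 := (hΦd w hw.1).hasStrictFDerivAt (by simp)
        rw [← h3.map_nhds_eq_of_surj (LinearMap.range_eq_top.2 (hΦs w hw.1))]
        exact Filter.image_mem_map ((hVo.inter isOpen_openHalfSpace).mem_nhds hw)
  exact ⟨fun y hy => (main y hy).1, fun y hy => (main y hy).2⟩

end Tube


/-! ### Stokes' theorem over one chart of the surface -/

section Support

variable {n k : ℕ} {M : Type*} [TopologicalSpace M] [ChartedSpace (𝔼 n) M] [IsManifold (𝓡 n) ∞ M]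
  {V : Type*} [NormedAddCommGroup V] [NormedSpace ℝ V] [FiniteDimensional ℝ V] {S K : Set M}

theorem SmoothFormOn.admOn_indicator {η : DForm n n M ℝ} (h : SmoothFormOn S η) (hK : K ⊆ S)
    (hc : IsCompact K) (h0 : ∀ x ∈ S, x ∉ K → η x = 0) : AdmOn S K (S.indicator η) where
  subset := hK
  isCompact := hc
  eq_zero x hx := by
    by_cases hxS : x ∈ S
    · rw [indicator_of_mem hxS, h0 x hxS hx]
    · rw [indicator_of_notMem hxS]
  continuousOn c := (h c).continuousOn.congr fun y hy => by
    unfold inChart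
    rw [indicator_of_mem (show (extChartAt (𝓡 n) c).symm y ∈ S from hy.2)]

theorem extD_eq_zero_of_notMem {η : DForm n k M V} (hK : IsClosed K) (h0 : ∀ x ∈ S, x ∉ K → η x = 0)
    {x : M} (hx : x ∈ S) (hxK : x ∉ K) : extD S η x = 0 := by
  rw [extD_congr (η := 0) hK.isOpen_compl hxK hx fun y hy => h0 y hy.2 hy.1, extD_zero]

end Support

/-- The inclusion of the boundary plane of the half-space. -/
def sliceL : 𝔼 2 →L[ℝ] 𝔼 3 :=
  ((EuclideanSpace.equiv (Fin 3) ℝ).symm : (Fin 3 → ℝ) →L[ℝ] 𝔼 3).comp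
    (ContinuousLinearMap.pi (Fin.cons 0 fun i => EuclideanSpace.proj i))

theorem sliceL_apply (p : 𝔼 2) : sliceL p = slice 0 p := by
  ext i
  exact Fin.cases rfl (fun _ => rfl) i

theorem sliceL_single (i : Fin 2) :
    sliceL (EuclideanSpace.single i 1) = EuclideanSpace.single i.succ 1 := by
  rw [sliceL_apply, ← slice_tail (EuclideanSpace.single i.succ 1), tail_single_succ]
  simp

namespace Tube

open MeasureTheory

variable {Y X : Type*} [TopologicalSpace Y] [ChartedSpace (𝔼 2) Y] [IsManifold (𝓡 2) ∞ Y]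
  [TopologicalSpace X] [ChartedSpace (𝔼 3) X] [IsManifold (𝓡 3) ∞ X]
  {oY : MOrientation 2 Y} {oX : MOrientation 3 X} (κ : Tube oY oX) {k : ℕ}
  {V : Type*} [NormedAddCommGroup V] [NormedSpace ℝ V] [FiniteDimensional ℝ V]

theorem contMDiff_incl : ContMDiff (𝓡 2) (𝓡 3) ∞ κ.incl :=
  κ.contMDiff.comp (contMDiff_id.prodMk contMDiff_const)

theorem incl_mem_exterior (s : Y) : κ.incl s ∈ κ.exterior := ⟨(s, 0), le_refl (0 : ℝ), rfl⟩

/-- The restriction of a form to the surface. -/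
def restr (η : DForm 3 k X V) : DForm 2 k Y V := fun s =>
  (η (κ.incl s)).compContinuousLinearMap (tderiv (𝓡 2) (𝓡 3) κ.incl s)

theorem inChart_restr (η : DForm 3 k X V) {c : Y} {y : 𝔼 2}
    (hy : y ∈ (extChartAt (𝓡 2) c).target) :
    inChart c (κ.restr η) y = pull (κ.incl ∘ (extChartAt (𝓡 2) c).symm) η y := by
  rw [inChart_eq_pull hy]
  unfold pull
  rw [tderiv_comp (κ.contMDiff_incl.mdifferentiable (by simp) _)
    ((contMDiffAt_extChartAt_symm hy).mdifferentiableAt (by simp))]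
  rfl

theorem smoothFormOn_restr {η : DForm 3 k X V} (hη : SmoothFormOn κ.exterior η) :
    SmoothFormOn univ (κ.restr η) := by
  intro c
  have h : ContDiffOn ℝ ∞ (pull (κ.incl ∘ (extChartAt (𝓡 2) c).symm) η) (chartPart c univ) := by
    refine hη.contDiffOn_pull (fun z hz => ?_) (fun z hz => κ.incl_mem_exterior _)
    filter_upwards [target_mem_nhds (n := 2) hz.1] with w hw
    exact κ.contMDiff_incl.contMDiffAt.comp w (contMDiffAt_extChartAt_symm hw)
  exact h.congr fun y hy => κ.inChart_restr η hy.1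

/-- In a chart, the inclusion of the surface is `param` on the boundary plane, and the frame of that
plane is the frame of space without its first vector. The right side is thus the boundary term of
the divergence theorem. -/
theorem pull_restr_frame (η : DForm 3 2 X V) {s : Y} {p : 𝔼 2}
    (hp : p ∈ (extChartAt (𝓡 2) s).target) :
    pull (extChartAt (𝓡 2) s).symm (κ.restr η) p (stdFrame 2) =
      pull (κ.param s) η (slice 0 p) ((0 : Fin 3).removeNth (stdFrame 3)) := by
  rw [← inChart_eq_pull hp, κ.inChart_restr η hp]
  have e : κ.incl ∘ (extChartAt (𝓡 2) s).symm = κ.param s ∘ sliceL := by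
    funext q
    simp only [Function.comp_apply, sliceL_apply]
    rfl
  have hp' : slice 0 p ∈ paramDom s := hp
  have h := tderiv_comp (I := 𝓘(ℝ, 𝔼 2)) (I' := 𝓘(ℝ, 𝔼 3)) (I'' := 𝓡 3) (x := p)
    (g := κ.param s) (f := sliceL) (by
      rw [sliceL_apply]
      exact (κ.contMDiffAt_param hp').mdifferentiableAt (by simp))
      sliceL.differentiableAt.mdifferentiableAt
  rw [sliceL_apply, tderiv_eq_fderiv (f := sliceL), ContinuousLinearMap.fderiv] at h
  unfold pull
  rw [e, h, Function.comp_apply, sliceL_apply]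
  simp only [ContinuousAlternatingMap.compContinuousLinearMap_apply]
  congr 1
  funext i
  simp only [Function.comp_apply, ContinuousLinearMap.comp_apply]
  rw [sliceL_single]
  rfl

variable [T2Space X] [SigmaCompactSpace X] [T2Space Y] [CompactSpace Y]

theorem isCompact_preimage {K : Set X} (hK : IsCompact K) (hKS : K ⊆ κ.exterior) :
    IsCompact (κ.toFun ⁻¹' K) :=
  κ.isOpenEmbedding.isInducing.isCompact_preimage' hK (hKS.trans (image_subset_range _ _))

theorem admOn_restr {K : Set X} (hK : IsCompact K) {η : DForm 3 2 X ℝ}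
    (hη : SmoothFormOn κ.exterior η) (h0 : ∀ x ∉ K, η x = 0) :
    AdmOn univ (κ.incl ⁻¹' K) (κ.restr η) where
  subset := subset_univ _
  isCompact := (hK.isClosed.preimage κ.contMDiff_incl.continuous).isCompact
  eq_zero s hs := by
    unfold restr
    rw [h0 _ hs]
    ext v
    simp
  continuousOn c := (κ.smoothFormOn_restr hη c).continuousOn

section Local

variable {K : Set X} (hK : IsCompact K) (hKS : K ⊆ κ.exterior) {η : DForm 3 2 X ℝ}
  (hη : SmoothFormOn κ.exterior η) (h0 : ∀ x ∉ K, η x = 0) {s : Y}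
  (hs : ∀ q, κ.toFun q ∈ K → q.1 ∈ (extChartAt (𝓡 2) s).source)

/-- The components of a 2-form over a chart of the surface, with the orientation sign. -/
def comp (κ : Tube oY oX) (η : DForm 3 2 X ℝ) (s : Y) (i : Fin 3) : 𝔼 3 → ℝ :=
  (paramDom s).indicator fun z => oY.frameSign (extChartAt (𝓡 2) s).symm (tail z) *
    ((-1) ^ i.val * pull (κ.param s) η z (i.removeNth (stdFrame 3)))

omit [T2Space X] [SigmaCompactSpace X] [T2Space Y] [CompactSpace Y] in
theorem mem_coords_image {z : 𝔼 3} (hz : z ∈ paramDom s) (hK : κ.param s z ∈ K) :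
    z ∈ coords s '' (κ.toFun ⁻¹' K) := by
  refine ⟨((extChartAt (𝓡 2) s).symm (tail z), z 0), hK, ?_⟩
  unfold coords
  simp only
  rw [(extChartAt (𝓡 2) s).right_inv hz, slice_tail]

include hK hKS hs in
theorem isCompact_coords_image : IsCompact (coords s '' (κ.toFun ⁻¹' K)) :=
  (κ.isCompact_preimage hK hKS).image_of_continuousOn ((continuousOn_coords s).mono hs)

omit [T2Space X] [SigmaCompactSpace X] [T2Space Y] [CompactSpace Y] in
include h0 in
theorem comp_eq_zero (i : Fin 3) {z : 𝔼 3} (hz : z ∉ coords s '' (κ.toFun ⁻¹' K)) :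
    κ.comp η s i z = 0 := by
  unfold comp
  by_cases h : z ∈ paramDom s
  · rw [indicator_of_mem h, pull, h0 _ fun hK => hz (κ.mem_coords_image h hK)]
    simp
  · rw [indicator_of_notMem h]

-- The orientation sign of a chart is locally constant, so under a derivative it may be frozen at
-- its value at `z`.
omit [T2Space X] [SigmaCompactSpace X] [T2Space Y] [CompactSpace Y] in
theorem comp_eventuallyEq (i : Fin 3) {z : 𝔼 3} (hz : z ∈ paramDom s) :
    κ.comp η s i =ᶠ[𝓝 z] fun w => oY.frameSign (extChartAt (𝓡 2) s).symm (tail z) *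
      ((-1) ^ i.val * pull (κ.param s) η w (i.removeNth (stdFrame 3))) := by
  have h1 := oY.frameSign_eventually_eq (eventually_contMDiffAt_extChartAt_symm hz)
    (det_tderiv_extChartAt_symm_ne_zero hz)
  filter_upwards [tail.continuous.continuousAt.eventually h1, (isOpen_paramDom s).mem_nhds hz]
    with w hw hw'
  unfold comp
  rw [indicator_of_mem hw', hw]

omit [T2Space X] [SigmaCompactSpace X] [T2Space Y] [CompactSpace Y] in
include hη in
theorem contDiffOn_pull_param :
    ContDiffOn ℝ ∞ (pull (κ.param s) η) (paramDom s ∩ halfSpace) :=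
  hη.contDiffOn_pull (fun _ hz => κ.eventually_contMDiffAt_param hz.1)
    fun _ hz => κ.param_mem_exterior hz.2

-- Inside `paramDom s` the pulled-back form is smooth up to the boundary. Outside, the function
-- vanishes near `z`, since its support lies in a compact subset of `paramDom s`.
include hK hKS hη h0 hs in
theorem contDiffOn_comp (i : Fin 3) : ContDiffOn ℝ 1 (κ.comp η s i) halfSpace := by
  intro z hz
  by_cases h : z ∈ paramDom s
  · have h1 := ((κ.contDiffOn_pull_param hη z ⟨h, hz⟩).of_le (m := 1) (by simp)).alternating_apply
      (i.removeNth (stdFrame 3))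
    rw [inter_comm, contDiffWithinAt_inter ((isOpen_paramDom s).mem_nhds h)] at h1
    exact (contDiffWithinAt_const.mul (contDiffWithinAt_const.mul h1)).congr_of_eventuallyEq
      ((κ.comp_eventuallyEq i h).filter_mono nhdsWithin_le_nhds)
      (κ.comp_eventuallyEq i h).self_of_nhds
  · have hc := (κ.isCompact_coords_image hK hKS hs).isClosed
    have hz' : z ∉ coords s '' (κ.toFun ⁻¹' K) := by
      rintro ⟨q, hq, rfl⟩
      exact h (coords_mem_paramDom (hs q hq))
    have h1 : κ.comp η s i =ᶠ[𝓝 z] fun _ => 0 := by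
      filter_upwards [hc.isOpen_compl.mem_nhds hz'] with w hw using κ.comp_eq_zero h0 i hw
    exact (contDiffAt_const.congr_of_eventuallyEq h1).contDiffWithinAt

-- With the alternating signs built into `comp`, the divergence is the formula for an exterior
-- derivative evaluated on the standard frame; `d` commutes with the pullback along `param`.
omit [T2Space X] [SigmaCompactSpace X] [T2Space Y] [CompactSpace Y] in
include hη in
theorem sum_fderivWithin_comp {z : 𝔼 3} (hz : z ∈ paramDom s) (hz0 : z ∈ halfSpace) :
    ∑ i, fderivWithin ℝ (κ.comp η s i) halfSpace z (EuclideanSpace.single i 1) =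
      oY.frameSign (extChartAt (𝓡 2) s).symm (tail z) *
        pull (κ.param s) (extD κ.exterior η) z (stdFrame 3) := by
  have hT := uniqueDiffOn_paramDom_inter s
  have hmem : z ∈ paramDom s ∩ halfSpace := ⟨hz, hz0⟩
  have hcl : z ∈ closure (interior (paramDom s ∩ halfSpace)) := by
    refine closure_mono ?_ (mem_closure_inter_openHalfSpace (isOpen_paramDom s) hz hz0)
    rw [interior_inter, (isOpen_paramDom s).interior_eq]
    exact inter_subset_inter_right _ openHalfSpace_subset_interior
  rw [← extDerivWithin_pull (κ.eventually_contMDiffAt_param hz) hT hcl hmem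
    (fun _ hw => κ.param_mem_exterior hw.2)
    (hη.smoothFormAt (κ.param_mem_exterior hz0)), extDerivWithin,
    ContinuousAlternatingMap.alternatizeUncurryFin_apply, Finset.mul_sum]
  refine Finset.sum_congr rfl fun i _ => ?_
  have hd := ((κ.contDiffOn_pull_param hη z hmem).differentiableWithinAt
    (by simp)).hasFDerivWithinAt
  have h1 := hd.alternating_apply (i.removeNth (stdFrame 3))
  have h2 : HasFDerivWithinAt (κ.comp η s i) _ (paramDom s ∩ halfSpace) z :=
    ((h1.const_mul ((-1) ^ i.val)).const_mul
      (oY.frameSign (extChartAt (𝓡 2) s).symm (tail z))).congr_of_eventuallyEq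
      ((κ.comp_eventuallyEq i hz).filter_mono nhdsWithin_le_nhds)
      (κ.comp_eventuallyEq i hz).self_of_nhds
  have h3 : fderivWithin ℝ (κ.comp η s i) halfSpace z =
      fderivWithin ℝ (κ.comp η s i) (paramDom s ∩ halfSpace) z := by
    rw [inter_comm, fderivWithin_inter ((isOpen_paramDom s).mem_nhds hz)]
  rw [h3, h2.fderivWithin (hT z hmem)]
  simp only [smul_apply, smul_eq_mul, ContinuousLinearMap.comp_apply, zsmul_eq_mul]
  push_cast
  rfl

include hK hKS hη h0 hs in
/-- Stokes' theorem for forms supported over a chart of the surface. -/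
theorem stokes_local : oX.integral (κ.exterior.indicator (extD κ.exterior η)) =
    oY.integral (κ.restr η) := by
  have hsm := hη.extD κ.regular_exterior
  have hadm := hsm.admOn_indicator hKS hK fun x hx hxK =>
    extD_eq_zero_of_notMem hK.isClosed (fun x _ hx => h0 x hx) hx hxK
  have hKim : K ⊆ κ.param s '' paramDom s := fun x hx => by
    obtain ⟨q, hq, rfl⟩ := hKS hx
    exact ⟨coords s q, coords_mem_paramDom (hs q hx), κ.param_coords (hs q hx)⟩
  have hL := (integrableOn_and_integral_eq_of_param hadm oX (isOpen_paramDom s)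
    (fun z hz => κ.contMDiffAt_param hz) (κ.injOn_param s) hKim).2
  have hKY : κ.incl ⁻¹' K ⊆ (extChartAt (𝓡 2) s).symm '' (extChartAt (𝓡 2) s).target := by
    intro y hy
    have h1 := hs (y, 0) hy
    exact ⟨_, (extChartAt (𝓡 2) s).map_source h1, (extChartAt (𝓡 2) s).left_inv h1⟩
  have hR := (integrableOn_and_integral_eq_of_param (κ.admOn_restr hK hη h0) oY
    (isOpen_extChartAt_target s) (fun z hz => contMDiffAt_extChartAt_symm hz)
    (extChartAt (𝓡 2) s).symm.injOn hKY).2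
  have hdiv := integral_divergence_halfSpace (κ.comp η s) (κ.isCompact_coords_image hK hKS hs)
    (fun i z hz => κ.comp_eq_zero h0 i hz) (fun i => κ.contDiffOn_comp hK hKS hη h0 hs i)
  have hcl := (κ.isCompact_coords_image hK hKS hs).isClosed
  have hzero : ∀ z ∈ halfSpace \ (paramDom s ∩ halfSpace),
      ∑ i, fderivWithin ℝ (κ.comp η s i) halfSpace z (EuclideanSpace.single i 1) = 0 := by
    rintro z ⟨hz, hz'⟩
    have hzK : z ∉ coords s '' (κ.toFun ⁻¹' K) := by
      rintro ⟨q, hq, rfl⟩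
      exact hz' ⟨coords_mem_paramDom (hs q hq), hz⟩
    refine Finset.sum_eq_zero fun i _ => ?_
    have h1 : κ.comp η s i =ᶠ[𝓝 z] fun _ => 0 := by
      filter_upwards [hcl.isOpen_compl.mem_nhds hzK] with w hw using κ.comp_eq_zero h0 i hw
    rw [(h1.filter_mono nhdsWithin_le_nhds).fderivWithin_eq h1.self_of_nhds,
      fderivWithin_fun_const]
    rfl
  have hout : ∀ z ∈ paramDom s \ (paramDom s ∩ halfSpace), oX.frameSign (κ.param s) z *
      pull (κ.param s) (κ.exterior.indicator (extD κ.exterior η)) z (stdFrame 3) = 0 := by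
    rintro z ⟨hz, hz'⟩
    rw [pull, indicator_of_notMem fun h => hz' ⟨hz, κ.param_mem_exterior_iff.1 h⟩]
    simp
  have hmeas : MeasurableSet (paramDom s ∩ halfSpace) :=
    (isOpen_paramDom s).measurableSet.inter isClosed_halfSpace.measurableSet
  rw [hL, setIntegral_eq_of_subset_of_forall_sdiff_eq_zero (isOpen_paramDom s).measurableSet
    inter_subset_left hout]
  rw [setIntegral_eq_of_subset_of_forall_sdiff_eq_zero isClosed_halfSpace.measurableSet
    inter_subset_right hzero] at hdiv
  -- The minus sign of `frameSign_param` will cancel the one of the divergence theorem.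
  have hin : ∀ z ∈ paramDom s ∩ halfSpace, oX.frameSign (κ.param s) z *
      pull (κ.param s) (κ.exterior.indicator (extD κ.exterior η)) z (stdFrame 3) =
      - ∑ i, fderivWithin ℝ (κ.comp η s i) halfSpace z (EuclideanSpace.single i 1) := by
    intro z hz
    rw [κ.sum_fderivWithin_comp hη hz.1 hz.2, κ.frameSign_param hz.1, pull, pull,
      indicator_of_mem (κ.param_mem_exterior hz.2), neg_mul]
  rw [setIntegral_congr_fun hmeas hin, integral_neg, hdiv, neg_neg, hR,
    ← setIntegral_eq_integral_of_forall_compl_eq_zero (s := (extChartAt (𝓡 2) s).target)]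
  · refine setIntegral_congr_fun (isOpen_extChartAt_target s).measurableSet fun p hp => ?_
    have hp' : slice 0 p ∈ paramDom s := hp
    simp only [comp]
    rw [indicator_of_mem hp', κ.pull_restr_frame η hp, tail_slice]
    simp
  · intro p hp
    have hp' : slice 0 p ∉ paramDom s := hp
    simp only [comp]
    rw [indicator_of_notMem hp']

end Local

end Tube


/-! ### Stokes' theorem on the exterior -/

namespace Tube

open MeasureTheory

variable {Y X : Type*} [TopologicalSpace Y] [ChartedSpace (𝔼 2) Y] [IsManifold (𝓡 2) ∞ Y]
  [TopologicalSpace X] [ChartedSpace (𝔼 3) X] [IsManifold (𝓡 3) ∞ X]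
  {oY : MOrientation 2 Y} {oX : MOrientation 3 X} (κ : Tube oY oX)

section Transport

variable {V : Type*} [NormedAddCommGroup V] [NormedSpace ℝ V]

/-- The function on `X` that corresponds to a function on the domain of the tubular neighbourhood,
extended by zero. -/
def transport (h : Y × ℝ → V) : X → V := Function.extend κ.toFun h (0 : X → V)

theorem transport_apply (h : Y × ℝ → V) (q : Y × ℝ) : κ.transport h (κ.toFun q) = h q :=
  κ.injective.extend_apply h (0 : X → V) q

theorem contMDiffAt_transport {h : Y × ℝ → V} {q : Y × ℝ}
    (hh : ContMDiffAt ((𝓡 2).prod 𝓘(ℝ, ℝ)) 𝓘(ℝ, V) ∞ h q) :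
    ContMDiffAt (𝓡 3) 𝓘(ℝ, V) ∞ (κ.transport h) (κ.toFun q) := by
  have hl := κ.isLocalDiffeomorph q
  have h1 : h ∘ hl.localInverse =ᶠ[𝓝 (κ.toFun q)] κ.transport h := by
    filter_upwards [hl.localInverse_eventuallyEq_right] with y hy
    have hy' : κ.toFun (hl.localInverse y) = y := hy
    conv_rhs => rw [← hy']
    rw [transport_apply]
    rfl
  refine ContMDiffAt.congr_of_eventuallyEq ?_ h1.symm
  refine ContMDiffAt.comp (κ.toFun q) ?_ hl.localInverse_contMDiffAt
  rw [hl.localInverse_left_inv hl.localInverse_mem_target]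
  exact hh

end Transport

variable {k : ℕ} {V : Type*} [NormedAddCommGroup V] [NormedSpace ℝ V] [FiniteDimensional ℝ V]

theorem restr_add (η η' : DForm 3 k X V) : κ.restr (η + η') = κ.restr η + κ.restr η' := rfl

variable [T2Space X] [SigmaCompactSpace X] [T2Space Y] [CompactSpace Y]

/-- Stokes' theorem is additive in the form. Smoothness and support are carried through the
induction because additivity of the integral depends on them. -/
theorem integral_extD_sum {K : Set X} (hK : IsCompact K) (hKS : K ⊆ κ.exterior) {F : Finset Y}
    {η : Y → DForm 3 2 X ℝ} (hη : ∀ c, SmoothFormOn κ.exterior (η c))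
    (h0 : ∀ c, ∀ x ∉ K, η c x = 0)
    (h : ∀ c, oX.integral (κ.exterior.indicator (extD κ.exterior (η c))) =
      oY.integral (κ.restr (η c))) :
    SmoothFormOn κ.exterior (∑ c ∈ F, η c) ∧ (∀ x ∉ K, (∑ c ∈ F, η c) x = 0) ∧
    oX.integral (κ.exterior.indicator (extD κ.exterior (∑ c ∈ F, η c))) =
      oY.integral (κ.restr (∑ c ∈ F, η c)) := by
  classical
  induction F using Finset.induction_on with
  | empty =>
    refine ⟨SmoothFormOn.zero _, fun x _ => rfl, ?_⟩
    have h1 : κ.exterior.indicator (extD κ.exterior (0 : DForm 3 2 X ℝ)) = 0 := by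
      funext x
      have : extD κ.exterior (0 : DForm 3 2 X ℝ) = 0 := funext fun x => extD_zero
      rw [this]
      simp
    have h2 : κ.restr (0 : DForm 3 2 X ℝ) = 0 := by
      funext s
      ext v
      simp [restr]
    rw [Finset.sum_empty, h1, h2, MOrientation.integral_zero, MOrientation.integral_zero]
  | insert a F ha ih =>
    obtain ⟨i1, i2, i3⟩ := ih
    rw [Finset.sum_insert ha]
    refine ⟨(hη a).add i1, fun x hx => ?_, ?_⟩
    · rw [Pi.add_apply, h0 a x hx, i2 x hx, add_zero]
    have hadm : ∀ {ζ : DForm 3 2 X ℝ}, SmoothFormOn κ.exterior ζ → (∀ x ∉ K, ζ x = 0) →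
        AdmOn κ.exterior K (κ.exterior.indicator (extD κ.exterior ζ)) := fun hζ hζ0 =>
      (hζ.extD κ.regular_exterior).admOn_indicator hKS hK fun x hx hxK =>
        extD_eq_zero_of_notMem hK.isClosed (fun x _ hx => hζ0 x hx) hx hxK
    have h1 : κ.exterior.indicator (extD κ.exterior (η a + ∑ c ∈ F, η c)) =
        κ.exterior.indicator (extD κ.exterior (η a)) +
          κ.exterior.indicator (extD κ.exterior (∑ c ∈ F, η c)) := by
      rw [← indicator_add']
      funext x
      by_cases hx : x ∈ κ.exterior
      · rw [indicator_of_mem hx, indicator_of_mem hx]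
        exact extD_add κ.regular_exterior hx (hη a) i1
      · rw [indicator_of_notMem hx, indicator_of_notMem hx]
    rw [h1, restr_add, oX.integral_add (hadm (hη a) (h0 a)) (hadm i1 i2),
      oY.integral_add (κ.admOn_restr hK (hη a) (h0 a)) (κ.admOn_restr hK i1 i2), h a, i3]

/-- Stokes' theorem for the exterior component of the tubular neighbourhood. -/
theorem stokes {K : Set X} (hK : IsCompact K) (hKS : K ⊆ κ.exterior) {η : DForm 3 2 X ℝ}
    (hη : SmoothFormOn κ.exterior η) (h0 : ∀ x ∉ K, η x = 0) :
    oX.integral (κ.exterior.indicator (extD κ.exterior η)) = oY.integral (κ.restr η) := by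
  -- The partition of unity of the surface, extended constantly along the normal direction. The
  -- extension by zero is known to be smooth only on the open range of the tube, which contains the
  -- exterior.
  set R : Y → X → ℝ := fun c => κ.transport fun q => intPart 2 Y c q.1 with hR
  set ζ : Y → DForm 3 2 X ℝ := fun c => bilin (ContinuousLinearMap.mul ℝ ℝ) (R c) η with hζ
  have hζa : ∀ c x, ζ c x = R c x • η x := fun c x => rfl
  have hRs : ∀ c, SmoothFormOn (n := 3) κ.exterior (zeroForm (R c)) := fun c => by
    refine SmoothFormOn.mono (smoothFormOn_zeroForm_of_contMDiffOn κ.isOpenEmbedding.isOpen_range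
      ?_) (image_subset_range _ _)
    rintro _ ⟨q, rfl⟩
    refine (κ.contMDiffAt_transport ?_).contMDiffWithinAt
    exact (intPart 2 Y c).contMDiff.contMDiffAt.comp q contMDiffAt_fst
  have hζs : ∀ c, SmoothFormOn κ.exterior (ζ c) := fun c => (hRs c).bilin _ hη
  have hζ0 : ∀ c, ∀ x ∉ K, ζ c x = 0 := fun c x hx => by rw [hζa, h0 x hx, smul_zero]
  set F : Finset Y := (finite_relevant (n := 2) (isCompact_univ (X := Y))).toFinset
  have hF : ∀ c, (Function.support (intPart 2 Y c) ∩ univ).Nonempty → c ∈ F := fun c hc => by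
    simpa [F] using hc
  have hsum : ∑ c ∈ F, ζ c = η := by
    funext x
    rw [Finset.sum_apply]
    simp only [hζa]
    rw [← Finset.sum_smul]
    by_cases hx : x ∈ K
    · obtain ⟨q, hq, rfl⟩ := hKS hx
      have h1 : ∑ c ∈ F, R c (κ.toFun q) = 1 := by
        simp only [hR, transport_apply]
        rw [← (intPart 2 Y).sum_eq_one (mem_univ q.1)]
        refine (finsum_eq_sum_of_support_subset _ fun c hc => ?_).symm
        exact hF c ⟨_, hc, mem_univ _⟩
      rw [h1, one_smul]
    · rw [h0 x hx, smul_zero]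
  have hloc : ∀ c, oX.integral (κ.exterior.indicator (extD κ.exterior (ζ c))) =
      oY.integral (κ.restr (ζ c)) := fun c => by
    have hc : IsCompact (κ.toFun '' (κ.toFun ⁻¹' K ∩ Prod.fst ⁻¹' tsupport (intPart 2 Y c))) :=
      ((κ.isCompact_preimage hK hKS).inter_right
        ((isClosed_tsupport _).preimage continuous_fst)).image κ.contMDiff.continuous
    refine κ.stokes_local (s := c) hc ?_ (hζs c) (fun x hx => ?_) (fun q hq => ?_)
    · rintro _ ⟨q, hq, rfl⟩
      exact hKS hq.1
    · by_cases hxK : x ∈ K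
      · obtain ⟨q, hq, rfl⟩ := hKS hxK
        have h1 : intPart 2 Y c q.1 = 0 :=
          image_eq_zero_of_notMem_tsupport fun h => hx ⟨q, ⟨hxK, h⟩, rfl⟩
        simp only [hζa, hR, transport_apply, h1, zero_smul]
      · exact hζ0 c x hxK
    · obtain ⟨q', hq', h⟩ := hq
      rw [← κ.injective h]
      exact tsupport_intPart_subset c hq'.2
  have := (κ.integral_extD_sum hK hKS (F := F) hζs hζ0 hloc).2.2
  rwa [hsum] at this

end Tube


/-! ### Variation of the connection and pairings of forms -/

namespace Sector

variable {ι X : Type*} [TopologicalSpace X] [ChartedSpace (𝔼 3) X] [IsManifold (𝓡 3) ∞ X]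
  {d : ℕ} {G : Type*} [TopologicalSpace G] [ChartedSpace (𝔼 d) G] [Group G]
  [LieGroup (𝓡 d) ∞ G] {𝔤 : Type*} [NormedLieRing 𝔤] [NormedLieAlg 𝔤] [FiniteDimensional ℝ 𝔤]
  (P : Sector ι X d G 𝔤) {S : Set X}

/-- The wedge product of forms with values in the adjoint bundle, by the Lie bracket. -/
def lieWedge {k : ℕ} (a : ι → DForm 3 1 X 𝔤) (ξ : ι → DForm 3 k X 𝔤) : ι → DForm 3 (k + 1) X 𝔤 :=
  fun i x => wedge (lieL 𝔤) (a i x) (ξ i x)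

theorem lieWedge_mem_forms {k : ℕ} {a : ι → DForm 3 1 X 𝔤} {ξ : ι → DForm 3 k X 𝔤}
    (ha : a ∈ P.forms S 1) (hξ : ξ ∈ P.forms S k) : lieWedge a ξ ∈ P.forms S (k + 1) := by
  refine ⟨fun i => (ha.1 i).wedge _ (hξ.1 i), fun i x hx => ?_, fun i j x hx => ?_⟩
  · rw [lieWedge, ha.2.1 i x hx, wedge_zero_left]
  · rw [lieWedge, ha.2.2 i j x hx, hξ.2.2 i j x hx]
    ext v
    simp only [lieWedge, wedge_apply, ContinuousLinearMap.compContinuousAlternatingMap_coe,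
      Function.comp_apply, lieL_apply, ← Ad_lie, map_sum, map_zsmul]

theorem lieWedge_mem_formsCpt {k : ℕ} {a : ι → DForm 3 1 X 𝔤} {ξ : ι → DForm 3 k X 𝔤}
    (ha : a ∈ P.forms S 1) (hξ : ξ ∈ P.formsCpt S k) : lieWedge a ξ ∈ P.formsCpt S (k + 1) := by
  obtain ⟨h1, K, hK, hKc, h0⟩ := hξ
  refine ⟨P.lieWedge_mem_forms ha h1, K, hK, hKc, fun i x hx => ?_⟩
  rw [lieWedge, h0 i x hx, wedge_zero_right]

theorem wedge_lie_comm (a b : (𝔼 3) [⋀^Fin 1]→L[ℝ] 𝔤) :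
    wedge (lieL 𝔤) a b = wedge (lieL 𝔤) b a := by
  ext w
  simp only [wedge_one_form, lieL_apply]
  rw [← lie_skew (a fun _ => w 0), ← lie_skew (a fun _ => w 1)]
  abel

theorem dCov_shift {k : ℕ} (A : ι → DForm 3 1 X 𝔤) (t : ℝ) (a : ι → DForm 3 1 X 𝔤)
    (ξ : ι → DForm 3 k X 𝔤) (i : ι) (x : X) :
    P.dCov S (A + t • a) ξ i x = P.dCov S A ξ i x + t • lieWedge a ξ i x := by
  unfold dCov lieWedge
  change _ + wedge (lieL 𝔤) (A i x + t • a i x) (ξ i x) = _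
  rw [wedge_add_left, wedge_smul_left, add_assoc]

/-- The bracket of `1`-forms is symmetric, so the two mixed terms `[A ∧ a]` and `[a ∧ A]` agree and
use up the factor `½`. -/
theorem curv_shift (hS : Regular 3 S) {A : ι → DForm 3 1 X 𝔤} (hA : P.IsConnection S A) (t : ℝ)
    {a : ι → DForm 3 1 X 𝔤} (ha : a ∈ P.forms S 1) {i : ι} {x : X} (hx : x ∈ P.U i ∩ S) :
    P.curv S (A + t • a) i x = P.curv S A i x + t • P.dCov S A a i x +
      (t ^ 2 / 2) • lieWedge a a i x := by
  have hR := hS.open_inter (P.isOpen i)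
  have h1 : extD S (A i + t • a i) x = extD S (A i) x + t • extD S (a i) x := by
    rw [← extD_inter (P.isOpen i) hx.1, extD_add hR hx (hA.1 i) ((ha.1 i).smul t),
      extD_smul hR hx, extD_inter (P.isOpen i) hx.1, extD_inter (P.isOpen i) hx.1]
  unfold curv dCov lieWedge
  change extD S (A i + t • a i) x + (1 / 2 : ℝ) •
    wedge (lieL 𝔤) (A i x + t • a i x) (A i x + t • a i x) = _
  rw [h1]
  simp only [wedge_add_left, wedge_add_right, wedge_smul_left, wedge_smul_right,
    wedge_lie_comm (a i x) (A i x)]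
  module

theorem dCov_eq_zero {k : ℕ} (A : ι → DForm 3 1 X 𝔤) {ξ : ι → DForm 3 k X 𝔤} {K : Set X}
    (hK : IsClosed K) (h0 : ∀ i, ∀ x ∉ K, ξ i x = 0) {i : ι} {x : X} (hx : x ∈ S) (hxK : x ∉ K) :
    P.dCov S A ξ i x = 0 := by
  rw [dCov, extD_eq_zero_of_notMem hK (fun x _ hx => h0 i x hx) hx hxK, h0 i x hxK,
    wedge_zero_right, add_zero]

theorem cutoff_dCov_mem_formsCpt [T2Space X] {k : ℕ} (hS : Regular 3 S) {A : ι → DForm 3 1 X 𝔤}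
    (hA : P.IsConnection S A) {ξ : ι → DForm 3 k X 𝔤} (hξ : ξ ∈ P.formsCpt S k) :
    P.cutoff S (P.dCov S A ξ) ∈ P.formsCpt S (k + 1) := by
  obtain ⟨h1, K, hK, hKc, h0⟩ := hξ
  refine ⟨P.cutoff_dCov_mem_forms hS hA h1, K, hK, hKc, fun i x hx => ?_⟩
  by_cases hxi : x ∈ P.U i ∩ S
  · rw [P.cutoff_apply _ hxi, P.dCov_eq_zero A hKc.isClosed h0 hxi.2 hx]
  · exact indicator_of_notMem hxi _

theorem isWeight_lie {α β : ι → X → 𝔤} (hα : P.IsWeight S α) (hβ : P.IsWeight S β) :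
    P.IsWeight S (fun i x => ⁅α i x, β i x⁆) := by
  obtain ⟨⟨a1, a2, a3⟩, -⟩ := hα
  obtain ⟨⟨b1, b2, b3⟩, K, hK, hKc, h0⟩ := hβ
  have e : ∀ i x, zeroForm (n := 3) (fun x => ⁅α i x, β i x⁆) x =
      (lieL 𝔤 (α i x)).compContinuousAlternatingMap (zeroForm (β i) x) := fun i x => by
    ext v
    rfl
  refine ⟨⟨fun i => ?_, fun i x hx => ?_, fun i j x hx => ?_⟩, K, hK, hKc, fun i x hx => ?_⟩
  · exact ((a1 i).bilin (lieL 𝔤) (b1 i)).congr fun y _ => e i y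
  · change zeroForm (fun x => ⁅α i x, β i x⁆) x = 0
    have := b2 i x hx
    simp only at this
    rw [e, this]
    ext v
    simp
  · have h1 : α i x = P.Ad (P.g i j x) (α j x) := congrArg (fun l => l ![]) (a3 i j x hx)
    have h2 : β i x = P.Ad (P.g i j x) (β j x) := congrArg (fun l => l ![]) (b3 i j x hx)
    ext v
    change ⁅α i x, β i x⁆ = P.Ad (P.g i j x) ⁅α j x, β j x⁆
    rw [h1, h2, Ad_lie]
  · change zeroForm (fun x => ⁅α i x, β i x⁆) x = 0
    have := h0 i x hx
    simp only at this
    rw [e, this]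
    ext v
    simp

/-! ### Pairings -/

section Pairing

variable [T2Space X] [SigmaCompactSpace X] {B : LieMetric 𝔤}

/-- The global form `⟨ξ ∧ η⟩`. -/
def pairForm (B : LieMetric 𝔤) (ξ : ι → DForm 3 1 X 𝔤) (η : ι → DForm 3 2 X 𝔤) : DForm 3 3 X ℝ :=
  fun x => wedge B.toL (ξ (P.idx x) x) (η (P.idx x) x)

theorem pairIntegral_eq (o : MOrientation 3 X) (ξ : ι → DForm 3 1 X 𝔤) (η : ι → DForm 3 2 X 𝔤) :
    P.pairIntegral B o S ξ η = o.integral (S.indicator (P.pairForm B ξ η)) := rfl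

/-- Only values on `P.U i ∩ S` enter the integral, so cut-offs of the two forms are invisible to it.
-/
theorem pairIntegral_congr (o : MOrientation 3 X) {ξ ξ' : ι → DForm 3 1 X 𝔤}
    {η η' : ι → DForm 3 2 X 𝔤}
    (h : ∀ i, ∀ x ∈ P.U i ∩ S, wedge B.toL (ξ i x) (η i x) = wedge B.toL (ξ' i x) (η' i x)) :
    P.pairIntegral B o S ξ η = P.pairIntegral B o S ξ' η' := by
  rw [pairIntegral_eq, pairIntegral_eq]
  congr 1
  funext x
  by_cases hx : x ∈ S
  · rw [indicator_of_mem hx, indicator_of_mem hx]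
    exact h _ x ⟨P.mem_idx x, hx⟩
  · rw [indicator_of_notMem hx, indicator_of_notMem hx]

/-- One of the forms `ξ` and `η` has compact support. -/
def Pairable (S : Set X) (ξ : ι → DForm 3 1 X 𝔤) (η : ι → DForm 3 2 X 𝔤) : Prop :=
  ξ ∈ P.forms S 1 ∧ η ∈ P.forms S 2 ∧ (ξ ∈ P.formsCpt S 1 ∨ η ∈ P.formsCpt S 2)

variable {P}

theorem Pairable.left {ξ : ι → DForm 3 1 X 𝔤} {η : ι → DForm 3 2 X 𝔤} (hξ : ξ ∈ P.formsCpt S 1)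
    (hη : η ∈ P.forms S 2) : P.Pairable S ξ η := ⟨hξ.1, hη, Or.inl hξ⟩

variable (hB : ∀ (g : G) (x y : 𝔤), B.form (P.Ad g x) (P.Ad g y) = B.form x y)
  (o : MOrientation 3 X)
include hB

theorem Pairable.admOn {ξ : ι → DForm 3 1 X 𝔤} {η : ι → DForm 3 2 X 𝔤} (h : P.Pairable S ξ η) :
    ∃ K, AdmOn S K (S.indicator (P.pairForm B ξ η)) := by
  obtain ⟨h1, h2, h3⟩ := h
  have hs := P.smoothFormOn_pairing hB h1 h2
  rcases h3 with ⟨-, K, hK, hKc, h0⟩ | ⟨-, K, hK, hKc, h0⟩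
  · refine ⟨K, hs.admOn_indicator hK hKc fun x _ hx => ?_⟩
    rw [h0 _ x hx, wedge_zero_left]
  · refine ⟨K, hs.admOn_indicator hK hKc fun x _ hx => ?_⟩
    rw [h0 _ x hx, wedge_zero_right]

theorem pairIntegral_add_left {ξ ξ' : ι → DForm 3 1 X 𝔤} {η : ι → DForm 3 2 X 𝔤}
    (h : P.Pairable S ξ η) (h' : P.Pairable S ξ' η) :
    P.pairIntegral B o S (ξ + ξ') η = P.pairIntegral B o S ξ η + P.pairIntegral B o S ξ' η := by
  obtain ⟨K, hK⟩ := h.admOn hB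
  obtain ⟨K', hK'⟩ := h'.admOn hB
  rw [pairIntegral_eq, pairIntegral_eq, pairIntegral_eq, ← o.integral_add hK hK', ← indicator_add']
  congr 2
  funext x
  exact wedge_add_left _ _ _ _

theorem pairIntegral_add_right {ξ : ι → DForm 3 1 X 𝔤} {η η' : ι → DForm 3 2 X 𝔤}
    (h : P.Pairable S ξ η) (h' : P.Pairable S ξ η') :
    P.pairIntegral B o S ξ (η + η') = P.pairIntegral B o S ξ η + P.pairIntegral B o S ξ η' := by
  obtain ⟨K, hK⟩ := h.admOn hB
  obtain ⟨K', hK'⟩ := h'.admOn hB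
  rw [pairIntegral_eq, pairIntegral_eq, pairIntegral_eq, ← o.integral_add hK hK', ← indicator_add']
  congr 2
  funext x
  exact wedge_add_right _ _ _ _

omit hB in
theorem pairIntegral_smul_left (t : ℝ) (ξ : ι → DForm 3 1 X 𝔤) (η : ι → DForm 3 2 X 𝔤) :
    P.pairIntegral B o S (t • ξ) η = t * P.pairIntegral B o S ξ η := by
  rw [pairIntegral_eq, pairIntegral_eq, ← o.integral_smul]
  congr 1
  funext x
  rw [Pi.smul_apply]
  by_cases hx : x ∈ S
  · rw [indicator_of_mem hx, indicator_of_mem hx]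
    exact wedge_smul_left _ _ _ _
  · rw [indicator_of_notMem hx, indicator_of_notMem hx, smul_zero]

omit hB in
theorem pairIntegral_smul_right (t : ℝ) (ξ : ι → DForm 3 1 X 𝔤) (η : ι → DForm 3 2 X 𝔤) :
    P.pairIntegral B o S ξ (t • η) = t * P.pairIntegral B o S ξ η := by
  rw [← pairIntegral_smul_left]
  refine P.pairIntegral_congr o fun i x _ => ?_
  change wedge B.toL (ξ i x) (t • η i x) = wedge B.toL (t • ξ i x) (η i x)
  rw [wedge_smul_left, wedge_smul_right]

omit hB in
theorem pairIntegral_zero_left (η : ι → DForm 3 2 X 𝔤) : P.pairIntegral B o S 0 η = 0 := by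
  have := pairIntegral_smul_left (P := P) (S := S) (B := B) o 0 0 η
  rwa [zero_smul, zero_mul] at this

end Pairing

end Sector


/-! ### The differentials of the regularized fluxes -/

namespace Sector

variable {ι X : Type*} [TopologicalSpace X] [ChartedSpace (𝔼 3) X] [IsManifold (𝓡 3) ∞ X]
  {d : ℕ} {G : Type*} [TopologicalSpace G] [ChartedSpace (𝔼 d) G] [Group G]
  [LieGroup (𝓡 d) ∞ G] {𝔤 : Type*} [NormedLieRing 𝔤] [NormedLieAlg 𝔤] [FiniteDimensional ℝ 𝔤]
  {P : Sector ι X d G 𝔤} {S : Set X}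

/-- A family of functions as a family of `0`-forms. -/
abbrev zeroForms (α : ι → X → 𝔤) : ι → DForm 3 0 X 𝔤 := fun i => zeroForm (α i)

theorem lieWedge_add {k : ℕ} (a b : ι → DForm 3 1 X 𝔤) (ξ : ι → DForm 3 k X 𝔤) :
    lieWedge (a + b) ξ = lieWedge a ξ + lieWedge b ξ := by
  funext i x
  exact wedge_add_left _ _ _ _

theorem lieWedge_smul {k : ℕ} (t : ℝ) (a : ι → DForm 3 1 X 𝔤) (ξ : ι → DForm 3 k X 𝔤) :
    lieWedge (t • a) ξ = t • lieWedge a ξ := by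
  funext i x
  exact wedge_smul_left _ _ _ _

theorem cutoff_dCov_add {k : ℕ} (hS : Regular 3 S) (A : ι → DForm 3 1 X 𝔤)
    {ξ ξ' : ι → DForm 3 k X 𝔤} (h : ξ ∈ P.forms S k) (h' : ξ' ∈ P.forms S k) :
    P.cutoff S (P.dCov S A (ξ + ξ')) =
      P.cutoff S (P.dCov S A ξ) + P.cutoff S (P.dCov S A ξ') := by
  funext i x
  rw [Pi.add_apply, Pi.add_apply]
  by_cases hx : x ∈ P.U i ∩ S
  · rw [P.cutoff_apply _ hx, P.cutoff_apply _ hx, P.cutoff_apply _ hx]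
    have hR := hS.open_inter (P.isOpen i)
    unfold dCov
    have h1 : extD S ((ξ + ξ') i) x = extD S (ξ i) x + extD S (ξ' i) x := by
      rw [← extD_inter (P.isOpen i) hx.1, Pi.add_apply, extD_add hR hx (h.1 i) (h'.1 i),
        extD_inter (P.isOpen i) hx.1, extD_inter (P.isOpen i) hx.1]
    rw [h1, Pi.add_apply, Pi.add_apply, wedge_add_right]
    abel
  · simp [cutoff, indicator_of_notMem hx]

theorem cutoff_dCov_smul {k : ℕ} (hS : Regular 3 S) (A : ι → DForm 3 1 X 𝔤) (t : ℝ)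
    (ξ : ι → DForm 3 k X 𝔤) :
    P.cutoff S (P.dCov S A (t • ξ)) = t • P.cutoff S (P.dCov S A ξ) := by
  funext i x
  rw [Pi.smul_apply, Pi.smul_apply]
  by_cases hx : x ∈ P.U i ∩ S
  · rw [P.cutoff_apply _ hx, P.cutoff_apply _ hx]
    unfold dCov
    rw [Pi.smul_apply, extD_smul hS hx.2, Pi.smul_apply, wedge_smul_right, smul_add]
  · simp [cutoff, indicator_of_notMem hx]

variable [T2Space X] [SigmaCompactSpace X] {B : LieMetric 𝔤}

theorem IsWeight.lieWedge_mem {α : ι → X → 𝔤} (hα : P.IsWeight S α) (a : P.forms S 1) :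
    lieWedge a.1 (zeroForms α) ∈ P.formsCpt S 1 := P.lieWedge_mem_formsCpt a.2 hα

variable (hB : ∀ (g : G) (x y : 𝔤), B.form (P.Ad g x) (P.Ad g y) = B.form x y)
  (o : MOrientation 3 X)

/-- The differential of the regularized electric flux in the direction of `A`. -/
def diffE {α : ι → X → 𝔤} (hα : P.IsWeight S α) (p : P.Phase S) : P.forms S 1 →ₗ[ℝ] ℝ where
  toFun a := P.pairIntegral B o S (lieWedge a.1 (zeroForms α)) p.E.1
  map_add' a b := by
    rw [Submodule.coe_add, lieWedge_add, pairIntegral_add_left hB o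
      (.left (hα.lieWedge_mem a) p.E.2) (.left (hα.lieWedge_mem b) p.E.2)]
  map_smul' t a := by
    rw [Submodule.coe_smul, lieWedge_smul, pairIntegral_smul_left]
    rfl

/-- The covariant derivative of a smearing function, as a form. -/
def weightForm (hS : Regular 3 S) {α : ι → X → 𝔤} (hα : P.IsWeight S α) (p : P.Phase S) :
    P.forms S 1 :=
  ⟨P.cutoff S (P.dCov S p.A (zeroForms α)),
    (P.cutoff_dCov_mem_formsCpt hS p.isConnection hα).1⟩

/-- The differential of the regularized magnetic flux in the direction of `A`. -/
def diffB (hS : Regular 3 S) {β : ι → X → 𝔤} (hβ : P.IsWeight S β) (p : P.Phase S) :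
    P.forms S 1 →ₗ[ℝ] ℝ where
  toFun a := P.pairIntegral B o S (lieWedge a.1 (zeroForms β)) (P.cutoff S (P.curv S p.A)) +
    P.pairIntegral B o S (P.cutoff S (P.dCov S p.A (zeroForms β)))
      (P.cutoff S (P.dCov S p.A a.1))
  map_add' a b := by
    have hF := P.cutoff_curv_mem_forms hS p.isConnection
    have hD := P.cutoff_dCov_mem_formsCpt hS p.isConnection hβ
    rw [Submodule.coe_add, lieWedge_add, pairIntegral_add_left hB o
      (.left (hβ.lieWedge_mem a) hF) (.left (hβ.lieWedge_mem b) hF),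
      cutoff_dCov_add hS p.A a.2 b.2, pairIntegral_add_right hB o
      (.left hD (P.cutoff_dCov_mem_forms hS p.isConnection a.2))
      (.left hD (P.cutoff_dCov_mem_forms hS p.isConnection b.2))]
    ring
  map_smul' t a := by
    rw [Submodule.coe_smul, lieWedge_smul, cutoff_dCov_smul hS, pairIntegral_smul_left,
      pairIntegral_smul_right, RingHom.id_apply, smul_eq_mul]
    ring

/-- Along an affine line in phase space the electric flux is a quadratic and the magnetic flux a
cubic polynomial in `t`; the derivative at `0` is the linear coefficient. -/
theorem hasDerivAt_cubic (c₀ c₁ c₂ c₃ : ℝ) :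
    HasDerivAt (fun t : ℝ => c₀ + t * c₁ + t ^ 2 * c₂ + t ^ 3 * c₃) c₁ 0 := by
  have h := ((((hasDerivAt_const (0 : ℝ) c₀).add ((hasDerivAt_id (0 : ℝ)).mul_const c₁)).add
    ((hasDerivAt_pow 2 (0 : ℝ)).mul_const c₂)).add ((hasDerivAt_pow 3 (0 : ℝ)).mul_const c₃))
  exact h.congr_deriv (by simp)

/-- The expansion of `∫⟨(d_A α + t [a, α]) ∧ (E + t e)⟩` has a linear coefficient in which `e` is
paired with `d_A α`; that form is the derivative in the direction of `E`. -/
theorem hasDifferentialAt_regFluxE (hS : Regular 3 S) {α : ι → X → 𝔤} (hα : P.IsWeight S α)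
    (p : P.Phase S) : P.HasDifferentialAt B o (P.regFluxE B o S α) p (diffE hB o hα p)
      (weightForm hS hα p) := by
  have hD := P.cutoff_dCov_mem_formsCpt hS p.isConnection hα
  refine ⟨hD, fun a e => ?_⟩
  have hW := hα.lieWedge_mem a
  set D := P.cutoff S (P.dCov S p.A (zeroForms α)) with hDdef
  set W := lieWedge a.1 (zeroForms α)
  have key : ∀ t : ℝ, P.regFluxE B o S α (p.shift t a e) = P.pairIntegral B o S D p.E.1 +
      t * (P.pairIntegral B o S W p.E.1 + P.pairIntegral B o S D e.1) +
      t ^ 2 * P.pairIntegral B o S W e.1 + t ^ 3 * 0 := by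
    intro t
    have h1 : P.regFluxE B o S α (p.shift t a e) =
        P.pairIntegral B o S (D + t • W) (p.E.1 + t • e.1) := by
      refine P.pairIntegral_congr o fun i x hx => ?_
      change wedge B.toL (P.dCov S (p.A + t • a.1) (zeroForms α) i x) (p.E.1 i x + t • e.1 i x) = _
      rw [P.dCov_shift, Pi.add_apply, Pi.add_apply, hDdef, P.cutoff_apply _ hx]
      rfl
    have hWt : t • W ∈ P.formsCpt S 1 := by
      have := hα.lieWedge_mem (t • a)
      rwa [Submodule.coe_smul, lieWedge_smul] at this
    have hDW : D + t • W ∈ P.formsCpt S 1 := by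
      obtain ⟨d1, K, hK, hKc, h0⟩ := hD
      obtain ⟨w1, K', hK', hKc', h0'⟩ := hWt
      refine ⟨(P.forms S 1).add_mem d1 w1, K ∪ K', union_subset hK hK', hKc.union hKc',
        fun i x hx => ?_⟩
      change D i x + (t • W) i x = 0
      rw [h0 i x fun h => hx (Or.inl h), h0' i x fun h => hx (Or.inr h), add_zero]
    have he : t • e.1 ∈ P.forms S 2 := (t • e).2
    rw [h1, pairIntegral_add_right hB o (.left hDW p.E.2) (.left hDW he),
      pairIntegral_add_left hB o (.left hD p.E.2) (.left hWt p.E.2),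
      pairIntegral_add_left hB o (.left hD he) (.left hWt he),
      pairIntegral_smul_left, pairIntegral_smul_left, pairIntegral_smul_right,
      pairIntegral_smul_right]
    ring
  simp only [key]
  exact hasDerivAt_cubic _ _ _ _

/-- The flux does not depend on `E`, whence the form `0`. In the linear coefficient the variation
`d_A a` of the curvature is kept as it stands, so no boundary term appears. -/
theorem hasDifferentialAt_regFluxB (hS : Regular 3 S) {β : ι → X → 𝔤} (hβ : P.IsWeight S β)
    (p : P.Phase S) : P.HasDifferentialAt B o (P.regFluxB B o S β) p (diffB hB o hS hβ p) 0 := by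
  refine ⟨⟨(P.forms S 1).zero_mem, ∅, empty_subset _, isCompact_empty, fun i x _ => rfl⟩,
    fun a e => ?_⟩
  have hD := P.cutoff_dCov_mem_formsCpt hS p.isConnection hβ
  have hW := hβ.lieWedge_mem a
  have hF := P.cutoff_curv_mem_forms hS p.isConnection
  have hQ := P.cutoff_dCov_mem_forms hS p.isConnection a.2
  have hR := P.lieWedge_mem_forms a.2 a.2
  set D := P.cutoff S (P.dCov S p.A (zeroForms β)) with hDdef
  set W := lieWedge a.1 (zeroForms β)
  set F := P.cutoff S (P.curv S p.A) with hFdef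
  set Q := P.cutoff S (P.dCov S p.A a.1) with hQdef
  set R := lieWedge a.1 a.1
  have key : ∀ t : ℝ, P.regFluxB B o S β (p.shift t a e) = P.pairIntegral B o S D F +
      t * (P.pairIntegral B o S W F + P.pairIntegral B o S D Q) +
      t ^ 2 * (P.pairIntegral B o S W Q + P.pairIntegral B o S D R / 2) +
      t ^ 3 * (P.pairIntegral B o S W R / 2) := by
    intro t
    have h1 : P.regFluxB B o S β (p.shift t a e) =
        P.pairIntegral B o S (D + t • W) (F + t • Q + (t ^ 2 / 2) • R) := by
      refine P.pairIntegral_congr o fun i x hx => ?_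
      change wedge B.toL (P.dCov S (p.A + t • a.1) (zeroForms β) i x)
        (P.curv S (p.A + t • a.1) i x) = _
      rw [P.dCov_shift, P.curv_shift hS p.isConnection t a.2 hx]
      change _ = wedge B.toL (D i x + t • W i x) (F i x + t • Q i x + (t ^ 2 / 2) • R i x)
      rw [hDdef, hFdef, hQdef, P.cutoff_apply _ hx, P.cutoff_apply _ hx, P.cutoff_apply _ hx]
    have hWt : t • W ∈ P.formsCpt S 1 := by
      have := hβ.lieWedge_mem (t • a)
      rwa [Submodule.coe_smul, lieWedge_smul] at this
    have hQt := (P.forms S 2).smul_mem t hQ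
    have hRt := (P.forms S 2).smul_mem (t ^ 2 / 2) hR
    have hFQ := (P.forms S 2).add_mem hF hQt
    rw [h1, pairIntegral_add_left hB o
        (.left hD ((P.forms S 2).add_mem hFQ hRt)) (.left hWt ((P.forms S 2).add_mem hFQ hRt)),
      pairIntegral_add_right hB o (.left hD hFQ) (.left hD hRt),
      pairIntegral_add_right hB o (.left hD hF) (.left hD hQt),
      pairIntegral_smul_left,
      pairIntegral_add_right hB o (.left hW hFQ) (.left hW hRt),
      pairIntegral_add_right hB o (.left hW hF) (.left hW hQt)]
    simp only [pairIntegral_smul_right]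
    ring
  simp only [key]
  have h0 : P.pairIntegral B o S (0 : P.forms S 1).1 e.1 = 0 := pairIntegral_zero_left o _
  rw [h0, add_zero]
  exact hasDerivAt_cubic _ _ _ _

variable {o} in
include hB in
theorem HasDifferentialAt.add {F F' : P.Phase S → ℝ} {p : P.Phase S}
    {δ δ' : P.forms S 1 →ₗ[ℝ] ℝ} {h h' : P.forms S 1} (hF : P.HasDifferentialAt B o F p δ h)
    (hF' : P.HasDifferentialAt B o F' p δ' h') :
    P.HasDifferentialAt B o (fun q => F q + F' q) p (δ + δ') (h + h') := by
  refine ⟨?_, fun a e => ?_⟩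
  · obtain ⟨d1, K, hK, hKc, h0⟩ := hF.1
    obtain ⟨w1, K', hK', hKc', h0'⟩ := hF'.1
    refine ⟨(h + h').2, K ∪ K', union_subset hK hK', hKc.union hKc', fun i x hx => ?_⟩
    change h.1 i x + h'.1 i x = 0
    rw [h0 i x fun h => hx (Or.inl h), h0' i x fun h => hx (Or.inr h), add_zero]
  · have h1 := (hF.2 a e).add (hF'.2 a e)
    rw [Submodule.coe_add, pairIntegral_add_left hB o (.left hF.1 e.2) (.left hF'.1 e.2)]
    exact h1.congr_deriv (by rw [LinearMap.add_apply]; ring)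

variable {o} in
theorem HasDifferentialAt.const_mul {F : P.Phase S → ℝ} {p : P.Phase S}
    {δ : P.forms S 1 →ₗ[ℝ] ℝ} {h : P.forms S 1} (c : ℝ) (hF : P.HasDifferentialAt B o F p δ h) :
    P.HasDifferentialAt B o (fun q => c * F q) p (c • δ) (c • h) := by
  refine ⟨?_, fun a e => ?_⟩
  · obtain ⟨d1, K, hK, hKc, h0⟩ := hF.1
    refine ⟨(c • h).2, K, hK, hKc, fun i x hx => ?_⟩
    change c • h.1 i x = 0
    rw [h0 i x hx, smul_zero]
  · have h1 := (hF.2 a e).const_mul c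
    rw [Submodule.coe_smul, pairIntegral_smul_left]
    exact h1.congr_deriv (by rw [LinearMap.smul_apply, smul_eq_mul]; ring)

theorem dCov_zeroForms_lie (hS : Regular 3 S) {α β : ι → X → 𝔤} (hα : P.IsWeight S α)
    (hβ : P.IsWeight S β) (A : ι → DForm 3 1 X 𝔤) {i : ι} {x : X} (hx : x ∈ P.U i ∩ S) :
    P.dCov S A (zeroForms fun i x => ⁅α i x, β i x⁆) i x =
      ((lieL 𝔤).flip (β i x)).compContinuousAlternatingMap (P.dCov S A (zeroForms α) i x) +
      (lieL 𝔤 (α i x)).compContinuousAlternatingMap (P.dCov S A (zeroForms β) i x) := by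
  have h := covD_bracket (A := A i) (hS.open_inter (P.isOpen i)) hx (hα.1.1 i) (hβ.1.1 i)
  unfold covD at h
  rw [extD_inter (P.isOpen i) hx.1, extD_inter (P.isOpen i) hx.1, extD_inter (P.isOpen i) hx.1] at h
  exact h

theorem lieWedge_zeroForms (a : ι → DForm 3 1 X 𝔤) (α : ι → X → 𝔤) (i : ι) (x : X) :
    lieWedge a (zeroForms α) i x = ((lieL 𝔤).flip (α i x)).compContinuousAlternatingMap (a i x) := by
  ext w
  have : (fun _ : Fin 1 => w 0) = w := by funext j; fin_cases j; rfl
  simp only [lieWedge, wedge_zero_form, this]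
  rfl

-- The two differentials combine to the integral of `⟨([d_A α, β] - [d_A β, α]) ∧ E⟩`, and the
-- bracket expression is `d_A[α, β]` by the derivation property.
include hB in
theorem diffE_weightForm (hS : Regular 3 S) {α β : ι → X → 𝔤} (hα : P.IsWeight S α)
    (hβ : P.IsWeight S β) (p : P.Phase S) :
    diffE hB o hβ p (weightForm hS hα p) - diffE hB o hα p (weightForm hS hβ p) =
      P.regFluxE B o S (fun i x => ⁅α i x, β i x⁆) p := by
  change P.pairIntegral B o S (lieWedge (weightForm hS hα p).1 (zeroForms β)) p.E.1 -
    P.pairIntegral B o S (lieWedge (weightForm hS hβ p).1 (zeroForms α)) p.E.1 = _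
  have h1 := hβ.lieWedge_mem (weightForm hS hα p)
  -- The minus sign is moved into the form, so that additivity of the pairing applies to the
  -- difference.
  have h2 := hα.lieWedge_mem ((-1 : ℝ) • weightForm hS hβ p)
  rw [sub_eq_add_neg, ← neg_one_mul, ← pairIntegral_smul_left, ← lieWedge_smul,
    ← Submodule.coe_smul, ← pairIntegral_add_left hB o (.left h1 p.E.2) (.left h2 p.E.2)]
  refine P.pairIntegral_congr o fun i x hx => ?_
  congr 1
  refine Eq.trans ?_ (dCov_zeroForms_lie hS hα hβ p.A hx).symm
  change lieWedge (weightForm hS hα p).1 (zeroForms β) i x +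
    lieWedge ((-1 : ℝ) • weightForm hS hβ p).1 (zeroForms α) i x = _
  rw [lieWedge_zeroForms, lieWedge_zeroForms]
  have e1 : (weightForm hS hα p).1 i x = P.dCov S p.A (zeroForms α) i x := P.cutoff_apply _ hx
  have e2 : ((-1 : ℝ) • weightForm hS hβ p).1 i x = (-1 : ℝ) • P.dCov S p.A (zeroForms β) i x := by
    change (-1 : ℝ) • (weightForm hS hβ p).1 i x = _
    congr 1
    exact P.cutoff_apply _ hx
  rw [e1, e2]
  congr 1
  ext w
  simp only [ContinuousLinearMap.compContinuousAlternatingMap_coe, Function.comp_apply,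
    ContinuousAlternatingMap.smul_apply, map_smul, ContinuousLinearMap.flip_apply, lieL_apply]
  rw [neg_one_smul, lie_skew]

-- The first summand contributes `[d_A α, β]`. In the second, `d_A d_A α = [F_A, α]`, and invariance
-- moves the bracket onto `d_A β`, giving `[α, d_A β]`. Their sum is `d_A[α, β]`.
include hB in
theorem diffB_weightForm (hS : Regular 3 S) {α β : ι → X → 𝔤} (hα : P.IsWeight S α)
    (hβ : P.IsWeight S β) (p : P.Phase S) :
    diffB hB o hS hβ p (weightForm hS hα p) =
      P.regFluxB B o S (fun i x => ⁅α i x, β i x⁆) p := by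
  have hF := P.cutoff_curv_mem_forms hS p.isConnection
  have hD := P.cutoff_dCov_mem_formsCpt hS p.isConnection hβ
  have h1 := hβ.lieWedge_mem (weightForm hS hα p)
  have hQ := P.cutoff_dCov_mem_forms hS p.isConnection (weightForm hS hα p).2
  obtain ⟨K, hK⟩ := (Pairable.left h1 hF).admOn hB
  obtain ⟨K', hK'⟩ := (Pairable.left hD hQ).admOn hB
  change P.pairIntegral B o S (lieWedge (weightForm hS hα p).1 (zeroForms β))
      (P.cutoff S (P.curv S p.A)) + P.pairIntegral B o S (P.cutoff S (P.dCov S p.A (zeroForms β)))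
      (P.cutoff S (P.dCov S p.A (weightForm hS hα p).1)) =
    P.pairIntegral B o S (P.dCov S p.A (zeroForms fun i x => ⁅α i x, β i x⁆)) (P.curv S p.A)
  rw [pairIntegral_eq, pairIntegral_eq, pairIntegral_eq]
  rw [← o.integral_add hK hK', ← indicator_add']
  congr 1
  funext x
  by_cases hx : x ∈ S
  swap
  · rw [indicator_of_notMem hx, indicator_of_notMem hx]
  rw [indicator_of_mem hx, indicator_of_mem hx]
  set i := P.idx x with hi
  have hxi : x ∈ P.U i ∩ S := ⟨P.mem_idx x, hx⟩
  change wedge B.toL (lieWedge _ _ i x) (P.cutoff S (P.curv S p.A) i x) +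
    wedge B.toL (P.cutoff S (P.dCov S p.A (zeroForms β)) i x)
      (P.cutoff S (P.dCov S p.A (weightForm hS hα p).1) i x) =
    wedge B.toL (P.dCov S p.A (zeroForms fun i x => ⁅α i x, β i x⁆) i x) (P.curv S p.A i x)
  rw [P.cutoff_apply _ hxi, P.cutoff_apply _ hxi, P.cutoff_apply _ hxi,
    dCov_zeroForms_lie hS hα hβ p.A hxi, lieWedge_zeroForms]
  have e1 : (weightForm hS hα p).1 i x = P.dCov S p.A (zeroForms α) i x := P.cutoff_apply _ hxi
  have hR := hS.open_inter (P.isOpen i)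
  -- The square of the covariant derivative is the curvature. The cut-off in `weightForm` is
  -- harmless, since it changes nothing on the relatively open set `P.U i ∩ S`.
  have e2 : P.dCov S p.A (weightForm hS hα p).1 i x =
      ((lieL 𝔤).flip (α i x)).compContinuousAlternatingMap (P.curv S p.A i x) := by
    have h := covD_covD (A := p.A i) hR hxi (p.isConnection.1 i) (hα.1.1 i)
    rw [covD, curvD, extD_inter (P.isOpen i) hxi.1, extD_inter (P.isOpen i) hxi.1] at h
    refine Eq.trans ?_ h
    unfold dCov
    rw [e1, extD_congr (P.isOpen i) hxi.1 hxi.2 (η := covD (P.U i ∩ S) (p.A i) (zeroForm (α i)))]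
    · unfold covD dCov
      rw [extD_inter (P.isOpen i) hxi.1]
    · intro y hy
      refine (P.cutoff_apply _ hy).trans ?_
      unfold covD dCov
      rw [extD_inter (P.isOpen i) hy.1]
  rw [e1, e2, wedge_add_left]
  congr 1
  ext w
  simp only [wedge_apply, ContinuousLinearMap.compContinuousAlternatingMap_coe,
    Function.comp_apply, ContinuousLinearMap.flip_apply, lieL_apply]
  refine Finset.sum_congr rfl fun j _ => ?_
  congr 1
  -- What remains is `⟨d_A β, [F_A, α]⟩ = ⟨[α, d_A β], F_A⟩`, by invariance and symmetry of the
  -- metric.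
  change B.form _ ⁅_, _⁆ = B.form ⁅_, _⁆ _
  rw [← B.invariant, B.symm, ← B.invariant]

end Sector


/-! ### The Poisson brackets of the regularized fluxes -/

namespace Sector

variable {ι X : Type*} [TopologicalSpace X] [ChartedSpace (𝔼 3) X] [IsManifold (𝓡 3) ∞ X]
  {d : ℕ} {G : Type*} [TopologicalSpace G] [ChartedSpace (𝔼 d) G] [Group G]
  [LieGroup (𝓡 d) ∞ G] {𝔤 : Type*} [NormedLieRing 𝔤] [NormedLieAlg 𝔤] [FiniteDimensional ℝ 𝔤]
  {P : Sector ι X d G 𝔤} {S : Set X}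

section Brackets

variable [T2Space X] [SigmaCompactSpace X] {B : LieMetric 𝔤}
  (hB : ∀ (g : G) (x y : 𝔤), B.form (P.Ad g x) (P.Ad g y) = B.form x y)
  (o : MOrientation 3 X) (hS : Regular 3 S) {α β : ι → X → 𝔤} (hα : P.IsWeight S α)
  (hβ : P.IsWeight S β) (p : P.Phase S)
include hB hS hα hβ

theorem bracket_regFluxE_regFluxE :
    P.HasPoissonBracketAt B o (P.regFluxE B o S α) (P.regFluxE B o S β) p
      (P.regFluxE B o S (fun i x => ⁅α i x, β i x⁆) p) :=
  ⟨_, _, _, _, hasDifferentialAt_regFluxE hB o hS hα p, hasDifferentialAt_regFluxE hB o hS hβ p,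
    (diffE_weightForm hB o hS hα hβ p).symm⟩

theorem bracket_regFluxE_regFluxB :
    P.HasPoissonBracketAt B o (P.regFluxE B o S α) (P.regFluxB B o S β) p
      (P.regFluxB B o S (fun i x => ⁅α i x, β i x⁆) p) :=
  ⟨_, _, _, _, hasDifferentialAt_regFluxE hB o hS hα p, hasDifferentialAt_regFluxB hB o hS hβ p, by
    rw [diffB_weightForm hB o hS hα hβ p, map_zero, sub_zero]⟩

theorem bracket_regFluxB_regFluxB :
    P.HasPoissonBracketAt B o (P.regFluxB B o S α) (P.regFluxB B o S β) p 0 :=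
  ⟨_, _, _, _, hasDifferentialAt_regFluxB hB o hS hα p, hasDifferentialAt_regFluxB hB o hS hβ p, by
    rw [map_zero, map_zero, sub_zero]⟩

end Brackets

/-! ### The restriction of fields to a regular subset -/

section Restriction

/-- Also at boundary points of `S` the derivative within `S` is that of the smooth form on `X`,
because derivatives within `S` are unique. -/
theorem extD_cutoff {k : ℕ} (hS : Regular 3 S) {ξ : ι → DForm 3 k X 𝔤} {i : ι}
    (hξ : SmoothFormOn (P.U i ∩ univ) (ξ i)) {x : X} (hx : x ∈ P.U i ∩ S) :
    extD S (P.cutoff S ξ i) x = extD univ (ξ i) x := by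
  rw [extD_congr (P.isOpen i) hx.1 hx.2 (η := ξ i) fun y hy => P.cutoff_apply ξ hy,
    ← extD_inter (P.isOpen i) hx.1, ← extD_inter (S := univ) (P.isOpen i) hx.1]
  exact extD_mono (hS.open_inter (P.isOpen i)) hx (inter_subset_inter_right _ (subset_univ _))
    (hξ.smoothFormAt ⟨hx.1, trivial⟩)

theorem isConnection_cutoff {A : ι → DForm 3 1 X 𝔤} (hA : P.IsConnection univ A) :
    P.IsConnection S (P.cutoff S A) := by
  refine ⟨fun i => ((hA.1 i).mono (inter_subset_inter_right _ (subset_univ _))).congr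
      fun y hy => P.cutoff_apply A hy, fun i x hx => indicator_of_notMem hx _, fun i j x hx => ?_⟩
  rw [P.cutoff_apply A ⟨hx.1.1, hx.2⟩, P.cutoff_apply A ⟨hx.1.2, hx.2⟩]
  exact hA.2.2 i j x ⟨hx.1, trivial⟩

theorem cutoff_mem_forms_of_univ {k : ℕ} {ξ : ι → DForm 3 k X 𝔤} (hξ : ξ ∈ P.forms univ k) :
    P.cutoff S ξ ∈ P.forms S k :=
  P.cutoff_mem_forms (fun i => (hξ.1 i).mono (inter_subset_inter_right _ (subset_univ _)))
    fun i j x hx => hξ.2.2 i j x ⟨hx.1, trivial⟩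

/-- The restriction to `S` of the fields on `X`. -/
def Phase.restrict (q : P.Phase univ) (S : Set X) : P.Phase S where
  A := P.cutoff S q.A
  isConnection := isConnection_cutoff q.isConnection
  E := ⟨P.cutoff S q.E.1, cutoff_mem_forms_of_univ q.E.2⟩

theorem Phase.curv_restrict (hS : Regular 3 S) (q : P.Phase univ) {i : ι} {x : X}
    (hx : x ∈ P.U i ∩ S) : P.curv S (q.restrict S).A i x = P.curv univ q.A i x := by
  have h : (q.restrict S).A i x = q.A i x := P.cutoff_apply _ hx
  unfold curv
  rw [h, ← extD_cutoff hS (q.isConnection.1 i) hx]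
  rfl

theorem Phase.gauss_restrict (hS : Regular 3 S) {q : P.Phase univ} (hq : P.Gauss q) :
    P.Gauss (q.restrict S) := fun i x hx => by
  have h : (q.restrict S).A i x = q.A i x := P.cutoff_apply _ hx
  have h' : (q.restrict S).E.1 i x = q.E.1 i x := P.cutoff_apply _ hx
  rw [← hq i x ⟨hx.1, trivial⟩]
  unfold dCov
  rw [h, h', ← extD_cutoff hS (q.E.2.1 i) hx]
  rfl

end Restriction

/-! ### Fluxes -/

section Flux

variable {B : LieMetric 𝔤}

/-- The global `2`-form `⟨α, F⟩`. -/
def fluxForm (P : Sector ι X d G 𝔤) (B : LieMetric 𝔤) (α : ι → X → 𝔤) (F : ι → DForm 3 2 X 𝔤) :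
    DForm 3 2 X ℝ :=
  fun x => bilin B.toL (α (P.idx x)) (F (P.idx x)) x

theorem fluxForm_eq (hB : ∀ (g : G) (x y : 𝔤), B.form (P.Ad g x) (P.Ad g y) = B.form x y)
    {α : ι → X → 𝔤} (hα : P.IsWeight S α) {F : ι → DForm 3 2 X 𝔤} (hF : F ∈ P.forms S 2) {i : ι}
    {x : X} (hx : x ∈ P.U i ∩ S) : P.fluxForm B α F x = bilin B.toL (α i) (F i) x := by
  have h : x ∈ P.U (P.idx x) ∩ P.U i ∩ S := ⟨⟨P.mem_idx x, hx.1⟩, hx.2⟩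
  have h1 : α (P.idx x) x = P.Ad (P.g (P.idx x) i x) (α i x) :=
    congrArg (fun l => l ![]) (hα.1.2.2 _ _ x h)
  ext w
  simp only [fluxForm, bilin, hF.2.2 _ _ x h, h1,
    ContinuousLinearMap.compContinuousAlternatingMap_coe, Function.comp_apply, P.toL_Ad hB]

end Flux

end Sector

namespace Tube

variable {Y X : Type*} [TopologicalSpace Y] [ChartedSpace (𝔼 2) Y] [IsManifold (𝓡 2) ∞ Y]
  [TopologicalSpace X] [ChartedSpace (𝔼 3) X] [IsManifold (𝓡 3) ∞ X]
  {oY : MOrientation 2 Y} {oX : MOrientation 3 X} (κ : Tube oY oX)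
  {ι : Type*} {d : ℕ} {G : Type*} [TopologicalSpace G] [ChartedSpace (𝔼 d) G] [Group G]
  [LieGroup (𝓡 d) ∞ G] {𝔤 : Type*} [NormedLieRing 𝔤] [NormedLieAlg 𝔤] [FiniteDimensional ℝ 𝔤]
  {P : Sector ι X d G 𝔤} [T2Space X] [SigmaCompactSpace X] [T2Space Y] [CompactSpace Y]
  {B : LieMetric 𝔤} (hB : ∀ (g : G) (x y : 𝔤), B.form (P.Ad g x) (P.Ad g y) = B.form x y)

/-- The Bianchi identity in each local representation. -/
theorem dCov_cutoff_curv {A : ι → DForm 3 1 X 𝔤} (hA : P.IsConnection κ.exterior A) {i : ι} {x : X}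
    (hx : x ∈ P.U i ∩ κ.exterior) :
    P.dCov κ.exterior A (P.cutoff κ.exterior (P.curv κ.exterior A)) i x = 0 := by
  have h := covD_curvD (κ.regular_exterior.open_inter (P.isOpen i)) hx (hA.1 i)
  have e : ∀ y ∈ P.U i ∩ κ.exterior, P.cutoff κ.exterior (P.curv κ.exterior A) i y =
      curvD (P.U i ∩ κ.exterior) (A i) y := fun y hy => by
    rw [P.cutoff_apply _ hy]
    unfold curvD Sector.curv
    rw [extD_inter (P.isOpen i) hy.1]
  rw [← h]
  unfold covD Sector.dCov
  rw [e x hx, extD_congr (P.isOpen i) hx.1 hx.2 e, extD_inter (P.isOpen i) hx.1]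

theorem surfaceIntegral_cutoff (a : ι → Y → 𝔤) (F : ι → DForm 3 2 X 𝔤) :
    κ.surfaceIntegral P B a (P.cutoff κ.exterior F) = κ.surfaceIntegral P B a F := by
  unfold surfaceIntegral
  congr 1
  funext s
  rw [P.cutoff_apply F ⟨P.mem_idx _, κ.incl_mem_exterior s⟩]

include hB

/-- Stokes' theorem for the flux of a covariantly closed form. -/
theorem pairIntegral_dCov_eq_surfaceIntegral {α : ι → X → 𝔤} {a : ι → Y → 𝔤}
    (hα : P.IsWeight κ.exterior α) (ha : κ.Restricts P α a) (A : ι → DForm 3 1 X 𝔤)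
    {F : ι → DForm 3 2 X 𝔤} (hF : F ∈ P.forms κ.exterior 2)
    (h0 : ∀ i, ∀ x ∈ P.U i ∩ κ.exterior, P.dCov κ.exterior A F i x = 0) :
    P.pairIntegral B oX κ.exterior (P.dCov κ.exterior A (Sector.zeroForms α)) F =
      κ.surfaceIntegral P B a F := by
  have hS := κ.regular_exterior
  have hω : ∀ {i : ι} {x : X}, x ∈ P.U i ∩ κ.exterior →
      P.fluxForm B α F x = bilin B.toL (α i) (F i) x := fun hx => Sector.fluxForm_eq hB hα hF hx
  obtain ⟨K, hKS, hK, hα0⟩ := hα.2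
  have hs : SmoothFormOn κ.exterior (P.fluxForm B α F) :=
    smoothFormOn_of_locally fun x hx => ⟨P.U (P.idx x), P.isOpen _, P.mem_idx x,
      (SmoothFormOn.bilin B.toL (hα.1.1 (P.idx x)) (hF.1 (P.idx x))).congr fun y hy => hω hy⟩
  have hsupp : ∀ x ∉ K, P.fluxForm B α F x = 0 := fun x hx => by
    have : α (P.idx x) x = 0 := congrArg (fun l => l ![]) (hα0 (P.idx x) x hx)
    ext w
    simp [Sector.fluxForm, bilin, this]
  -- Here `d⟨α, F⟩ = ⟨d_A α ∧ F⟩ + ⟨α, d_A F⟩` is used in a representation around `x`, the last term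
  -- being zero by `h0`.
  have hd : κ.exterior.indicator (P.pairForm B (P.dCov κ.exterior A (Sector.zeroForms α)) F) =
      κ.exterior.indicator (extD κ.exterior (P.fluxForm B α F)) := by
    refine indicator_congr fun x hx => ?_
    set i := P.idx x with hi
    have hxi : x ∈ P.U i ∩ κ.exterior := ⟨P.mem_idx x, hx⟩
    have h1 := extD_pairing B (A := A i) (hS.open_inter (P.isOpen i)) hxi (hα.1.1 i) (hF.1 i)
    have h2 := h0 i x hxi
    rw [covD, covD, extD_inter (P.isOpen i) hxi.1, extD_inter (P.isOpen i) hxi.1,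
      extD_inter (P.isOpen i) hxi.1] at h1
    unfold Sector.dCov at h2
    rw [h2] at h1
    rw [extD_congr (P.isOpen i) hxi.1 hx (η := bilin B.toL (α i) (F i)) fun y hy => hω hy, h1]
    have h3 : (B.toL (α i x)).compContinuousAlternatingMap (0 : (𝔼 3) [⋀^Fin 3]→L[ℝ] 𝔤) = 0 := by
      ext w; simp
    rw [h3, add_zero]
    rfl
  rw [P.pairIntegral_eq, hd, κ.stokes hK hKS hs hsupp]
  unfold surfaceIntegral
  congr 1
  funext s
  rw [← ha _ s (P.mem_idx _)]
  rfl

theorem regFluxE_eq_fluxE {α : ι → X → 𝔤} {a : ι → Y → 𝔤} (hα : P.IsWeight κ.exterior α)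
    (ha : κ.Restricts P α a) {p : P.Phase κ.exterior} (hp : P.Gauss p) :
    P.regFluxE B oX κ.exterior α p = κ.fluxE P B a p :=
  κ.pairIntegral_dCov_eq_surfaceIntegral hB hα ha p.A p.E.2 hp

/-- The Bianchi identity takes the place of the Gauss law, so the equality holds at every point of
phase space. -/
theorem regFluxB_eq_fluxB {α : ι → X → 𝔤} {a : ι → Y → 𝔤} (hα : P.IsWeight κ.exterior α)
    (ha : κ.Restricts P α a) (p : P.Phase κ.exterior) :
    P.regFluxB B oX κ.exterior α p = κ.fluxB P B a p := by
  have h := κ.pairIntegral_dCov_eq_surfaceIntegral hB hα ha p.A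
    (P.cutoff_curv_mem_forms κ.regular_exterior p.isConnection)
    fun i x hx => κ.dCov_cutoff_curv p.isConnection hx
  rw [κ.surfaceIntegral_cutoff] at h
  refine Eq.trans (P.pairIntegral_congr oX fun i x hx => ?_) h
  rw [P.cutoff_apply _ hx]

end Tube


/-! ### Extension of sections from the surface to the exterior -/

namespace Tube

variable {Y X : Type*} [TopologicalSpace Y] [ChartedSpace (𝔼 2) Y] [IsManifold (𝓡 2) ∞ Y]
  [TopologicalSpace X] [ChartedSpace (𝔼 3) X] [IsManifold (𝓡 3) ∞ X]
  {oY : MOrientation 2 Y} {oX : MOrientation 3 X} (κ : Tube oY oX)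
  {ι : Type*} {d : ℕ} {G : Type*} [TopologicalSpace G] [ChartedSpace (𝔼 d) G] [Group G]
  [LieGroup (𝓡 d) ∞ G] {𝔤 : Type*} [NormedLieRing 𝔤] [NormedLieAlg 𝔤] [FiniteDimensional ℝ 𝔤]
  (P : Sector ι X d G 𝔤)

/-- The part of the tube on which sections extend in the local representation at `incl s`. -/
def patch (s : Y) : Set X := κ.toFun '' {q | q.2 ∈ Ioo (-1 : ℝ) 1 ∧
  κ.toFun q ∈ P.U (P.idx (κ.incl s)) ∧ κ.incl q.1 ∈ P.U (P.idx (κ.incl s))}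

theorem isOpen_patch (s : Y) : IsOpen (κ.patch P s) := by
  refine κ.isOpenEmbedding.isOpenMap _ ?_
  exact (isOpen_Ioo.preimage continuous_snd).inter
    (((P.isOpen _).preimage κ.contMDiff.continuous).inter
      ((P.isOpen _).preimage (κ.contMDiff_incl.continuous.comp continuous_fst)))

theorem incl_mem_patch (s : Y) : κ.incl s ∈ κ.patch P s :=
  ⟨(s, 0), ⟨by simp, P.mem_idx _, P.mem_idx _⟩, rfl⟩

theorem patch_subset (s : Y) : κ.patch P s ⊆ P.U (P.idx (κ.incl s)) := by
  rintro _ ⟨q, hq, rfl⟩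
  exact hq.2.1

variable [T2Space X] [SigmaCompactSpace X] [CompactSpace Y]

theorem exists_partition : ∃ ρ : SmoothPartitionOfUnity Y (𝓡 3) X (range κ.incl),
    ρ.IsSubordinate (κ.patch P) :=
  SmoothPartitionOfUnity.exists_isSubordinate (𝓡 3)
    (isCompact_range κ.contMDiff_incl.continuous).isClosed _ (κ.isOpen_patch P) (by
      rintro _ ⟨s, rfl⟩
      exact mem_iUnion.2 ⟨s, κ.incl_mem_patch P s⟩)

variable {P} {a : ι → Y → 𝔤}

/-- The extension of a section over the surface by a partition of unity. -/
def extension (P : Sector ι X d G 𝔤) (ρ : SmoothPartitionOfUnity Y (𝓡 3) X (range κ.incl))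
    (a : ι → Y → 𝔤) (i : ι) (x : X) : 𝔤 :=
  ∑ᶠ s : Y, ρ s x • P.Ad (P.g i (P.idx (κ.incl s)) x)
    (κ.transport (fun q => a (P.idx (κ.incl s)) q.1) x)

section

variable {ρ : SmoothPartitionOfUnity Y (𝓡 3) X (range κ.incl)} (hρ : ρ.IsSubordinate (κ.patch P))
include hρ

theorem mem_patch_of_ne_zero {s : Y} {x : X} (h : ρ s x ≠ 0) : x ∈ κ.patch P s :=
  hρ s (subset_tsupport _ h)

/-- On the patch that contains the support of `ρ s`, the corresponding term is constant along the
normal direction in one trivialization and carried to the `i`-th one by the smooth map `Ad ∘ g`. -/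
theorem contMDiffOn_extension (ha : κ.IsSection P a) (i : ι) :
    ContMDiffOn (𝓡 3) 𝓘(ℝ, 𝔤) ∞ (κ.extension P ρ a i) (P.U i) := by
  intro x hx
  refine ContMDiffAt.contMDiffWithinAt (ρ.contMDiffAt_finsum fun s hs => ?_)
  obtain ⟨q, hq, rfl⟩ := hρ s hs
  have h1 := (P.smooth i (P.idx (κ.incl s))).contMDiffAt
    (((P.isOpen _).inter (P.isOpen _)).mem_nhds ⟨hx, hq.2.1⟩)
  have h2 : ContMDiffAt ((𝓡 2).prod 𝓘(ℝ, ℝ)) 𝓘(ℝ, 𝔤) ∞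
      (fun q : Y × ℝ => a (P.idx (κ.incl s)) q.1) q :=
    ((ha.1 (P.idx (κ.incl s))).contMDiffAt
      (((P.isOpen _).preimage κ.contMDiff_incl.continuous).mem_nhds hq.2.2)).comp q contMDiffAt_fst
  exact (P.contMDiff_Ad.contMDiffAt.comp _ h1).clm_apply (κ.contMDiffAt_transport h2)

/-- Term by term this is the cocycle condition; the sum is finite at each point, so `Ad` passes
through it. -/
theorem extension_apply_Ad {i j : ι} {x : X} (hx : x ∈ P.U i ∩ P.U j) :
    κ.extension P ρ a i x = P.Ad (P.g i j x) (κ.extension P ρ a j x) := by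
  unfold extension
  have hf : (Function.support fun s : Y => ρ s x • P.Ad (P.g j (P.idx (κ.incl s)) x)
      (κ.transport (fun q => a (P.idx (κ.incl s)) q.1) x)).Finite :=
    (ρ.locallyFinite.point_finite x).subset fun s hs h => hs (by
      simp only [h, zero_smul])
  rw [← ContinuousLinearMap.coe_coe, ← LinearMap.toAddMonoidHom_coe, AddMonoidHom.map_finsum _ hf]
  refine finsum_congr fun s => ?_
  by_cases h : ρ s x = 0
  · simp [h]
  have hs := κ.patch_subset P s (κ.mem_patch_of_ne_zero hρ h)
  rw [← P.cocycle i j _ x ⟨hx, hs⟩, P.Ad_mul_apply]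
  exact (map_smul (P.Ad (P.g i j x)) _ _).symm

/-- On the surface the transformation law of a section makes all terms multiples of the same vector
`a i s`, and the weights sum to one. -/
theorem extension_incl (ha : κ.IsSection P a) {i : ι} {s : Y} (hs : κ.incl s ∈ P.U i) :
    κ.extension P ρ a i (κ.incl s) = a i s := by
  have e : ∀ t : Y, ρ t (κ.incl s) • P.Ad (P.g i (P.idx (κ.incl t)) (κ.incl s))
      (κ.transport (fun q => a (P.idx (κ.incl t)) q.1) (κ.incl s)) = ρ t (κ.incl s) • a i s := by
    intro t
    by_cases h : ρ t (κ.incl s) = 0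
    · simp [h]
    have ht := κ.patch_subset P t (κ.mem_patch_of_ne_zero hρ h)
    rw [ha.2 i (P.idx (κ.incl t)) s ⟨hs, ht⟩]
    congr 2
    exact κ.transport_apply _ (s, 0)
  unfold extension
  rw [finsum_congr e, ← finsum_smul, ρ.sum_eq_one (mem_range_self s), one_smul]

/-- The patches stay within normal distance less than `1`, which confines the extension on the
exterior to the compact image of `Y × [0, 1]`. -/
theorem extension_eq_zero {i : ι} {x : X} (hx : x ∈ κ.exterior)
    (h : x ∉ κ.toFun '' (univ ×ˢ Icc 0 1)) : κ.extension P ρ a i x = 0 := by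
  refine finsum_eq_zero_of_forall_eq_zero fun s => ?_
  by_contra h0
  obtain ⟨q, hq, rfl⟩ := κ.mem_patch_of_ne_zero hρ (s := s) (x := x) fun h => h0 (by rw [h, zero_smul])
  obtain ⟨q', hq', e⟩ := hx
  rw [κ.injective e] at hq'
  exact h ⟨q, ⟨trivial, hq', hq.1.2.le⟩, rfl⟩

end

theorem exists_isWeight_restricts (ha : κ.IsSection P a) :
    ∃ α : ι → X → 𝔤, P.IsWeight κ.exterior α ∧ κ.Restricts P α a := by
  obtain ⟨ρ, hρ⟩ := κ.exists_partition P
  have hS : ∀ i, ∀ x ∈ P.U i ∩ κ.exterior, (P.U i ∩ κ.exterior).indicator (κ.extension P ρ a i) x =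
      κ.extension P ρ a i x := fun i x hx => indicator_of_mem hx _
  have h0 : ∀ i, ∀ x, (P.U i ∩ κ.exterior).indicator (κ.extension P ρ a i) x = 0 →
      zeroForm (n := 3) ((P.U i ∩ κ.exterior).indicator (κ.extension P ρ a i)) x = 0 := by
    intro i x h
    ext w
    exact h
  refine ⟨fun i => (P.U i ∩ κ.exterior).indicator (κ.extension P ρ a i),
    ⟨⟨fun i => ?_, fun i x hx => h0 i x (indicator_of_notMem hx _), fun i j x hx => ?_⟩,
      κ.toFun '' (univ ×ˢ Icc 0 1), ?_, ?_, fun i x hx => h0 i x ?_⟩, fun i s hs => ?_⟩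
  · refine ((smoothFormOn_zeroForm_of_contMDiffOn (P.isOpen i)
      (κ.contMDiffOn_extension hρ ha i)).mono inter_subset_left).congr fun x hx => ?_
    ext w
    exact hS i x hx
  · ext w
    change (P.U i ∩ κ.exterior).indicator _ x = P.Ad _ ((P.U j ∩ κ.exterior).indicator _ x)
    rw [hS i x ⟨hx.1.1, hx.2⟩, hS j x ⟨hx.1.2, hx.2⟩, κ.extension_apply_Ad hρ hx.1]
  · exact image_mono fun q hq => hq.2.1
  · exact (isCompact_univ.prod isCompact_Icc).image κ.contMDiff.continuous
  · by_cases hxS : x ∈ P.U i ∩ κ.exterior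
    · rw [hS i x hxS, κ.extension_eq_zero hρ hxS.2 hx]
    · exact indicator_of_notMem hxS _
  · exact (hS i _ ⟨hs, κ.incl_mem_exterior s⟩).trans (κ.extension_incl hρ ha hs)

end Tube


/-! ### The Fréchet topology on smooth maps -/

namespace SmoothMaps

variable {S : Type*} [TopologicalSpace S] [ChartedSpace (𝔼 2) S]
  {L : Type*} [NormedLieRing L] [NormedLieAlg L] [FiniteDimensional ℝ L]
  {L' : Type*} [NormedLieRing L'] [NormedLieAlg L'] [FiniteDimensional ℝ L']

/-- The local expression of a smooth map in a chart. -/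
def localRep (f : SmoothMaps S L) (c : S) : 𝔼 2 → L := f.1 ∘ (extChartAt (𝓡 2) c).symm

theorem tendsto_iff {α : Type*} {p : Filter α} {F : α → SmoothMaps S L} {f : SmoothMaps S L} :
    Filter.Tendsto F p (𝓝 f) ↔ ∀ (c : S) (k : ℕ) (K : Set (𝔼 2)), IsCompact K →
      K ⊆ (extChartAt (𝓡 2) c).target → TendstoUniformlyOn
        (fun a => iteratedFDeriv ℝ k ((F a).localRep c)) (iteratedFDeriv ℝ k (f.localRep c)) p K := by
  simp only [nhds_iInf, Filter.tendsto_iInf, nhds_induced, Filter.tendsto_comap_iff]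
  refine forall_congr' fun c => forall_congr' fun k => ?_
  rw [UniformOnFun.tendsto_iff_tendstoUniformlyOn]
  exact ⟨fun h K h1 h2 => h K ⟨h1, h2⟩, fun h K hK => h K hK.1 hK.2⟩

theorem tendstoUniformlyOn_localRep (f : SmoothMaps S L) {c : S} {K : Set (𝔼 2)} (hK : IsCompact K)
    (hKc : K ⊆ (extChartAt (𝓡 2) c).target) :
    TendstoUniformlyOn (fun g : SmoothMaps S L => g.localRep c) (f.localRep c) (𝓝 f) K := by
  have h := tendsto_iff.1 (Filter.tendsto_id (x := 𝓝 f)) c 0 K hK hKc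
  rw [Metric.tendstoUniformlyOn_iff] at h ⊢
  intro ε hε
  filter_upwards [h ε hε] with g hg y hy
  have := hg y hy
  rwa [iteratedFDeriv_zero_eq_comp, iteratedFDeriv_zero_eq_comp, Function.comp_apply,
    Function.comp_apply, LinearIsometryEquiv.dist_map] at this

variable [IsManifold (𝓡 2) ∞ S]

theorem contDiffAt_localRep (f : SmoothMaps S L) {c : S} {y : 𝔼 2}
    (hy : y ∈ (extChartAt (𝓡 2) c).target) : ContDiffAt ℝ ∞ (f.localRep c) y := by
  have h : ContMDiff (𝓡 2) 𝓘(ℝ, L) ∞ f.1 := f.2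
  exact contMDiffAt_iff_contDiffAt.1 (h.contMDiffAt.comp y (contMDiffAt_extChartAt_symm hy))

/-- The map between spaces of smooth maps that is given by a linear map. -/
def mapL (ℓ : L →L[ℝ] L') : SmoothMaps S L →ₗ[ℝ] SmoothMaps S L' where
  toFun f := ⟨fun s => ℓ (f.1 s), ℓ.contDiff.contMDiff.comp (f.2 : ContMDiff (𝓡 2) 𝓘(ℝ, L) ∞ f.1)⟩
  map_add' f g := Subtype.ext (funext fun s => map_add ℓ (f.1 s) (g.1 s))
  map_smul' t f := Subtype.ext (funext fun s => map_smul ℓ t (f.1 s))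

/-- Postcomposition with `ℓ` commutes with iterated derivatives in charts, and a continuous linear
map preserves uniform convergence. -/
theorem continuous_mapL (ℓ : L →L[ℝ] L') :
    Continuous (mapL ℓ : SmoothMaps S L → SmoothMaps S L') := by
  refine continuous_iff_continuousAt.2 fun f => tendsto_iff.2 fun c k K hK hKc => ?_
  have h := tendsto_iff.1 (Filter.tendsto_id (x := 𝓝 f)) c k K hK hKc
  have h2 := (ContinuousLinearMap.compContinuousMultilinearMapL ℝ (fun _ : Fin k => 𝔼 2) L L'
    ℓ).uniformContinuous.comp_tendstoUniformlyOn h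
  have e : ∀ g : SmoothMaps S L, ∀ y ∈ K, iteratedFDeriv ℝ k ((mapL ℓ g).localRep c) y =
      ContinuousLinearMap.compContinuousMultilinearMapL ℝ (fun _ : Fin k => 𝔼 2) L L' ℓ
        (iteratedFDeriv ℝ k (g.localRep c) y) := fun g y hy =>
    ℓ.iteratedFDeriv_comp_left (g.contDiffAt_localRep (hKc hy)) (by exact_mod_cast le_top)
  exact (h2.congr (Filter.Eventually.of_forall fun g y hy => (e g y hy).symm)).congr_right
    fun y hy => (e f y hy).symm

theorem continuous_add : Continuous fun z : SmoothMaps S L × SmoothMaps S L => z.1 + z.2 := by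
  refine continuous_iff_continuousAt.2 fun f => tendsto_iff.2 fun c k K hK hKc => ?_
  have h := (tendsto_iff.1 (continuous_fst.tendsto f) c k K hK hKc).add
    (tendsto_iff.1 (continuous_snd.tendsto f) c k K hK hKc)
  have e : ∀ z : SmoothMaps S L × SmoothMaps S L, ∀ y ∈ K,
      iteratedFDeriv ℝ k ((z.1 + z.2).localRep c) y =
      iteratedFDeriv ℝ k (z.1.localRep c) y + iteratedFDeriv ℝ k (z.2.localRep c) y := fun z y hy =>
    iteratedFDeriv_add_apply ((z.1.contDiffAt_localRep (hKc hy)).of_le (by exact_mod_cast le_top))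
      ((z.2.contDiffAt_localRep (hKc hy)).of_le (by exact_mod_cast le_top))
  exact (h.congr (Filter.Eventually.of_forall fun z y hy => (e z y hy).symm)).congr_right
    fun y hy => (e f y hy).symm

end SmoothMaps

/-! ### The splitting into electric and magnetic components -/

section FluxAlg

variable (ħ : ℝ) (𝔤 : Type*) [NormedLieRing 𝔤] [NormedLieAlg 𝔤] [FiniteDimensional ℝ 𝔤]

/-- The electric component. -/
def rightL : FluxAlg ħ 𝔤 →L[ℝ] Rescaled ħ 𝔤 := LinearMap.toContinuousLinearMap
  { toFun := fun x => x.right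
    map_add' := fun _ _ => rfl
    map_smul' := fun _ _ => rfl }

/-- The magnetic component. -/
def leftL : FluxAlg ħ 𝔤 →L[ℝ] Abelian 𝔤 := LinearMap.toContinuousLinearMap
  { toFun := fun x => x.left
    map_add' := fun _ _ => rfl
    map_smul' := fun _ _ => rfl }

/-- The inclusion of the electric part. -/
def inrL : Rescaled ħ 𝔤 →L[ℝ] FluxAlg ħ 𝔤 :=
  LinearMap.toContinuousLinearMap (LieAlgebra.SemiDirectSum.inr (adAction ħ 𝔤)).toLinearMap

/-- The inclusion of the magnetic part. -/
def inlL : Abelian 𝔤 →L[ℝ] FluxAlg ħ 𝔤 :=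
  LinearMap.toContinuousLinearMap (LieAlgebra.SemiDirectSum.inl (adAction ħ 𝔤)).toLinearMap

variable (S : Type*) [TopologicalSpace S] [ChartedSpace (𝔼 2) S] [IsManifold (𝓡 2) ∞ S]

/-- Smooth maps to the semidirect product, by components. -/
def componentsEquiv : SmoothMaps S (FluxAlg ħ 𝔤) ≃ₗ⁅ℝ⁆ SemidirectMaps S ħ 𝔤 where
  toFun x := ⟨SmoothMaps.mapL (leftL ħ 𝔤) x, SmoothMaps.mapL (rightL ħ 𝔤) x⟩
  map_add' _ _ := rfl
  map_smul' _ _ := rfl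
  -- Both brackets are given by the same formula at each point of the surface.
  map_lie' := rfl
  invFun z := SmoothMaps.mapL (inlL ħ 𝔤) z.left + SmoothMaps.mapL (inrL ħ 𝔤) z.right
  left_inv x := Subtype.ext (funext fun s =>
    LieAlgebra.SemiDirectSum.ext (add_zero (x.1 s).left) (zero_add (x.1 s).right))
  right_inv z := LieAlgebra.SemiDirectSum.ext
    (Subtype.ext (funext fun s => add_zero (z.left.1 s)))
    (Subtype.ext (funext fun s => zero_add (z.right.1 s)))

theorem continuous_componentsEquiv : Continuous (componentsEquiv ħ 𝔤 S) :=
  continuous_induced_rng.2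
    ((SmoothMaps.continuous_mapL (leftL ħ 𝔤)).prodMk (SmoothMaps.continuous_mapL (rightL ħ 𝔤)))

theorem continuous_componentsEquiv_symm : Continuous (componentsEquiv ħ 𝔤 S).symm := by
  have h : Continuous (LieAlgebra.SemiDirectSum.toProd (ψ := adActionMaps S ħ 𝔤)) :=
    continuous_induced_dom
  exact SmoothMaps.continuous_add.comp
    (((SmoothMaps.continuous_mapL (inlL ħ 𝔤)).comp (continuous_fst.comp h)).prodMk
      ((SmoothMaps.continuous_mapL (inrL ħ 𝔤)).comp (continuous_snd.comp h)))

end FluxAlg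


/-! ### Continuity of the fluxes in the smearing function -/

section SmearedIntegral

variable {n : ℕ} {M : Type*} [TopologicalSpace M] [ChartedSpace (𝔼 n) M] [IsManifold (𝓡 n) ∞ M]

/-- The multiple of a form by a function. -/
def mulForm (f : M → ℝ) (η : DForm n n M ℝ) : DForm n n M ℝ := fun x => f x • η x

theorem AdmOn.mulForm {K : Set M} {f : M → ℝ} (hf : Continuous f) {η : DForm n n M ℝ}
    (h : AdmOn univ K η) : AdmOn univ K (mulForm f η) where
  subset := h.subset
  isCompact := h.isCompact
  eq_zero x hx := by rw [YMFlux.mulForm, h.eq_zero x hx, smul_zero]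
  continuousOn c := ((hf.comp_continuousOn (continuousOn_extChartAt_symm c)).mono
    inter_subset_left).smul (h.continuousOn c)

variable [T2Space M] [SigmaCompactSpace M] (o : MOrientation n M)

theorem MOrientation.integral_finset_sum {β : Type*} (T : Finset β) {K : Set M} (hK : IsCompact K)
    {η : β → DForm n n M ℝ} (h : ∀ b, AdmOn univ K (η b)) :
    o.integral (∑ b ∈ T, η b) = ∑ b ∈ T, o.integral (η b) ∧ AdmOn univ K (∑ b ∈ T, η b) := by
  classical
  induction T using Finset.induction_on with
  | empty =>
    refine ⟨o.integral_zero, subset_univ _, hK, fun _ _ => rfl, fun c => ?_⟩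
    have : inChart c (∑ b ∈ (∅ : Finset β), η b) = fun _ => 0 := rfl
    rw [this]
    exact continuousOn_const
  | insert b T hb ih =>
    rw [Finset.sum_insert hb, Finset.sum_insert hb, o.integral_add (h b) ih.2, ih.1]
    exact ⟨rfl, (h b).add ih.2⟩

theorem MOrientation.integrand_mulForm (f : M → ℝ) (η : DForm n n M ℝ) (c : M) (y : 𝔼 n) :
    o.integrand (mulForm f η) c y = f ((extChartAt (𝓡 n) c).symm y) * o.integrand η c y := by
  unfold integrand
  have : inChart c (mulForm f η) y (stdFrame n) =
    f ((extChartAt (𝓡 n) c).symm y) * inChart c η y (stdFrame n) := rfl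
  rw [this]
  ring

/-- The integral of `f η` depends continuously on `f`, for uniform convergence on the compact
subsets of charts. -/
theorem MOrientation.tendsto_integral_mulForm {α : Type*} {p : Filter α} {K : Set M}
    {η : DForm n n M ℝ} (h : AdmOn univ K η) {F : α → M → ℝ} {f : M → ℝ}
    (hF : ∀ a, Continuous (F a)) (hf : Continuous f)
    (hu : ∀ (c : M) (T : Set (𝔼 n)), IsCompact T → T ⊆ (extChartAt (𝓡 n) c).target →
      TendstoUniformlyOn (fun a => F a ∘ (extChartAt (𝓡 n) c).symm)
        (f ∘ (extChartAt (𝓡 n) c).symm) p T) :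
    Filter.Tendsto (fun a => o.integral (mulForm (F a) η)) p (𝓝 (o.integral (mulForm f η))) := by
  have hfin := finite_relevant (n := n) h.isCompact
  have hmem : ∀ c : M, (Function.support (intPart n M c) ∩ K).Nonempty → c ∈ hfin.toFinset :=
    fun c hc => hfin.mem_toFinset.2 hc
  have e : ∀ u : M → ℝ, Continuous u → o.integral (mulForm u η) =
      ∑ c ∈ hfin.toFinset, ∫ y in (extChartAt (𝓡 n) c).target, o.integrand (mulForm u η) c y :=
    fun u hu => (h.mulForm hu).integral_eq_sum o hmem
  simp only [e _ (hF _), e _ hf]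
  refine tendsto_finsetSum _ fun c _ => ?_
  have hI := h.integrableOn_integrand o c
  set J := ∫ y in (extChartAt (𝓡 n) c).target, ‖o.integrand η c y‖ with hJ
  have hJ0 : 0 ≤ J := MeasureTheory.integral_nonneg fun y => norm_nonneg _
  rw [Metric.tendsto_nhds]
  intro ε hε
  have hT := isCompact_chartCpt (n := n) h.isCompact c
  have hTt : chartCpt n K c ⊆ (extChartAt (𝓡 n) c).target := fun y hy =>
    (chartCpt_subset h.subset c hy).1
  -- The `1` in the denominator keeps the bound meaningful for `J = 0` and the final inequality
  -- strict.
  have hδ : 0 < ε / (J + 1) := by positivity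
  filter_upwards [Metric.tendstoUniformlyOn_iff.1 (hu c _ hT hTt) _ hδ] with a ha
  rw [dist_eq_norm, ← MeasureTheory.integral_sub ((h.mulForm (hF a)).integrableOn_integrand o c)
    ((h.mulForm hf).integrableOn_integrand o c)]
  have hb : ‖∫ y in (extChartAt (𝓡 n) c).target,
      o.integrand (mulForm (F a) η) c y - o.integrand (mulForm f η) c y‖ ≤
      ∫ y in (extChartAt (𝓡 n) c).target, ε / (J + 1) * ‖o.integrand η c y‖ := by
    refine MeasureTheory.norm_integral_le_of_norm_le (hI.norm.const_mul _) ?_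
    refine (MeasureTheory.ae_restrict_iff' (isOpen_extChartAt_target c).measurableSet).2
      (Filter.Eventually.of_forall fun y hy => ?_)
    rw [integrand_mulForm, integrand_mulForm, ← sub_mul, norm_mul]
    -- Off this compact set the integrand vanishes, so uniform convergence on it is enough.
    by_cases hyT : y ∈ chartCpt n K c
    · have := ha y hyT
      rw [dist_comm, dist_eq_norm] at this
      exact mul_le_mul_of_nonneg_right this.le (norm_nonneg _)
    · rw [h.integrand_eq_zero o hy hyT]
      simp
  refine hb.trans_lt ?_
  rw [MeasureTheory.integral_const_mul, ← hJ, div_mul_eq_mul_div, div_lt_iff₀ (by positivity)]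
  nlinarith

end SmearedIntegral

namespace Tube

variable {Y X : Type*} [TopologicalSpace Y] [ChartedSpace (𝔼 2) Y] [IsManifold (𝓡 2) ∞ Y]
  [TopologicalSpace X] [ChartedSpace (𝔼 3) X] [IsManifold (𝓡 3) ∞ X]
  {oY : MOrientation 2 Y} {oX : MOrientation 3 X} (κ : Tube oY oX)
  {ι : Type*} {d : ℕ} {G : Type*} [TopologicalSpace G] [ChartedSpace (𝔼 d) G] [Group G]
  [LieGroup (𝓡 d) ∞ G] {𝔤 : Type*} [NormedLieRing 𝔤] [NormedLieAlg 𝔤] [FiniteDimensional ℝ 𝔤]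
  {P : Sector ι X d G 𝔤}

/-- The section that corresponds to a `𝔤`-valued function under a trivialization. -/
def trivSection (P : Sector ι X d G 𝔤) (τ : ι → Y → G) (v : Y → 𝔤) : ι → Y → 𝔤 :=
  fun i s => P.Ad (τ i s) (v s)

theorem isSection_trivSection {τ : ι → Y → G} (hτ : κ.IsTrivialization P τ) {v : Y → 𝔤}
    (hv : ContMDiff (𝓡 2) 𝓘(ℝ, 𝔤) ∞ v) : κ.IsSection P (trivSection P τ v) := by
  refine ⟨fun i => ?_, fun i j s hs => ?_⟩
  · exact (P.contMDiff_Ad.comp_contMDiffOn (hτ.1 i)).clm_apply hv.contMDiffOn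
  · unfold trivSection
    rw [← hτ.2 i j s hs, P.Ad_mul_apply]

/-- The `2`-form `⟨a, F⟩` on the surface. -/
def surfaceForm (P : Sector ι X d G 𝔤) (B : LieMetric 𝔤) (a : ι → Y → 𝔤)
    (F : ι → DForm 3 2 X 𝔤) : DForm 2 2 Y ℝ := fun s =>
  ((B.toL (a (P.idx (κ.incl s)) s)).compContinuousAlternatingMap
    (F (P.idx (κ.incl s)) (κ.incl s))).compContinuousLinearMap (tderiv (𝓡 2) (𝓡 3) κ.incl s)

variable [T2Space X] [SigmaCompactSpace X] [T2Space Y] [CompactSpace Y] {B : LieMetric 𝔤}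

theorem surfaceIntegral_eq (a : ι → Y → 𝔤) (F : ι → DForm 3 2 X 𝔤) :
    κ.surfaceIntegral P B a F = oY.integral (κ.surfaceForm P B a F) := rfl

theorem surfaceForm_add (a b : ι → Y → 𝔤) (F : ι → DForm 3 2 X 𝔤) :
    κ.surfaceForm P B (a + b) F = κ.surfaceForm P B a F + κ.surfaceForm P B b F := by
  funext s
  ext w
  simp [surfaceForm]

theorem surfaceForm_smul (t : ℝ) (a : ι → Y → 𝔤) (F : ι → DForm 3 2 X 𝔤) :
    κ.surfaceForm P B (t • a) F = t • κ.surfaceForm P B a F := by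
  funext s
  ext w
  simp [surfaceForm]

theorem surfaceIntegral_smul (t : ℝ) (a : ι → Y → 𝔤) (F : ι → DForm 3 2 X 𝔤) :
    κ.surfaceIntegral P B (t • a) F = t * κ.surfaceIntegral P B a F := by
  rw [surfaceIntegral_eq, surfaceForm_smul, oY.integral_smul]
  rfl

variable (hB : ∀ (g : G) (x y : 𝔤), B.form (P.Ad g x) (P.Ad g y) = B.form x y)
include hB

/-- After extending the section into the exterior, the form on the surface is the restriction of the
smooth global form `⟨α, F⟩`, hence continuous. -/
theorem admOn_surfaceForm {a : ι → Y → 𝔤} (ha : κ.IsSection P a) {F : ι → DForm 3 2 X 𝔤}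
    (hF : F ∈ P.forms κ.exterior 2) : AdmOn univ univ (κ.surfaceForm P B a F) := by
  obtain ⟨α, hα, hr⟩ := κ.exists_isWeight_restricts ha
  obtain ⟨K, hKS, hK, hα0⟩ := hα.2
  have hs : SmoothFormOn κ.exterior (P.fluxForm B α F) :=
    smoothFormOn_of_locally fun x hx => ⟨P.U (P.idx x), P.isOpen _, P.mem_idx x,
      (SmoothFormOn.bilin B.toL (hα.1.1 (P.idx x)) (hF.1 (P.idx x))).congr fun y hy =>
        Sector.fluxForm_eq hB hα hF hy⟩
  have hsupp : ∀ x ∉ K, P.fluxForm B α F x = 0 := fun x hx => by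
    have : α (P.idx x) x = 0 := congrArg (fun l => l ![]) (hα0 (P.idx x) x hx)
    ext w
    simp [Sector.fluxForm, bilin, this]
  have h := (κ.admOn_restr hK hs hsupp).mono (subset_univ _) isCompact_univ (subset_univ _)
  have e : κ.surfaceForm P B a F = κ.restr (P.fluxForm B α F) := by
    funext s
    unfold surfaceForm
    rw [← hr _ s (P.mem_idx _)]
    rfl
  rwa [e]

theorem surfaceIntegral_add {a b : ι → Y → 𝔤} (ha : κ.IsSection P a) (hb : κ.IsSection P b)
    {F : ι → DForm 3 2 X 𝔤} (hF : F ∈ P.forms κ.exterior 2) :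
    κ.surfaceIntegral P B (a + b) F = κ.surfaceIntegral P B a F + κ.surfaceIntegral P B b F := by
  rw [surfaceIntegral_eq, surfaceForm_add,
    oY.integral_add (κ.admOn_surfaceForm hB ha hF) (κ.admOn_surfaceForm hB hb hF)]
  rfl

variable {L : Type*} [NormedLieRing L] [NormedLieAlg L] [FiniteDimensional ℝ L]

/-- The flux as a functional of a smooth function on the surface. -/
def fluxL {τ : ι → Y → G} (hτ : κ.IsTrivialization P τ) {F : ι → DForm 3 2 X 𝔤}
    (hF : F ∈ P.forms κ.exterior 2) (ℓ : L →L[ℝ] 𝔤) : SmoothMaps Y L →ₗ[ℝ] ℝ where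
  toFun x := κ.surfaceIntegral P B (trivSection P τ fun s => ℓ (x.1 s)) F
  map_add' x y := by
    have hs : ∀ x : SmoothMaps Y L, κ.IsSection P (trivSection P τ fun s => ℓ (x.1 s)) := fun x =>
      κ.isSection_trivSection hτ (ℓ.contDiff.contMDiff.comp (x.2 : ContMDiff (𝓡 2) 𝓘(ℝ, L) ∞ x.1))
    rw [← κ.surfaceIntegral_add hB (hs x) (hs y) hF]
    congr 1
    funext i s
    change P.Ad _ (ℓ (x.1 s + y.1 s)) = P.Ad _ _ + P.Ad _ _
    rw [map_add, map_add]
  map_smul' t x := by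
    rw [RingHom.id_apply, smul_eq_mul, ← κ.surfaceIntegral_smul]
    congr 1
    funext i s
    change P.Ad _ (ℓ (t • x.1 s)) = t • P.Ad _ _
    rw [map_smul, map_smul]

/-- In a basis of `𝔤` the flux is a finite sum of integrals of the coordinate functions of `ℓ ∘ x`
against fixed forms, each continuous already for locally uniform convergence of `x`. -/
theorem continuous_fluxL {τ : ι → Y → G} (hτ : κ.IsTrivialization P τ) {F : ι → DForm 3 2 X 𝔤}
    (hF : F ∈ P.forms κ.exterior 2) (ℓ : L →L[ℝ] 𝔤) : Continuous (κ.fluxL hB hτ hF ℓ) := by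
  let b := Module.finBasis ℝ 𝔤
  let co : Fin (Module.finrank ℝ 𝔤) → L →L[ℝ] ℝ := fun j =>
    (LinearMap.toContinuousLinearMap (b.coord j)).comp ℓ
  let η : Fin (Module.finrank ℝ 𝔤) → DForm 2 2 Y ℝ := fun j =>
    κ.surfaceForm P B (trivSection P τ fun _ => b j) F
  have hη : ∀ j, AdmOn univ univ (η j) := fun j =>
    κ.admOn_surfaceForm hB (κ.isSection_trivSection hτ contMDiff_const) hF
  have hc : ∀ (x : SmoothMaps Y L) j, Continuous fun s => co j (x.1 s) := fun x j =>
    (co j).continuous.comp (x.2 : ContMDiff (𝓡 2) 𝓘(ℝ, L) ∞ x.1).continuous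
  have e : ∀ x : SmoothMaps Y L, κ.fluxL hB hτ hF ℓ x =
      ∑ j, oY.integral (mulForm (fun s => co j (x.1 s)) (η j)) := by
    intro x
    rw [← (oY.integral_finset_sum Finset.univ isCompact_univ
      fun j => (hη j).mulForm (hc x j)).1]
    change oY.integral (κ.surfaceForm P B _ F) = _
    congr 1
    funext s
    ext w
    rw [Finset.sum_apply, ContinuousAlternatingMap.sum_apply]
    change B.toL (P.Ad _ (ℓ (x.1 s))) _ = ∑ j, b.repr (ℓ (x.1 s)) j • B.toL (P.Ad _ (b j)) _
    conv_lhs => rw [← b.sum_repr (ℓ (x.1 s))]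
    simp only [map_sum, map_smul, sum_apply, smul_apply]
  have e' : (κ.fluxL hB hτ hF ℓ : SmoothMaps Y L → ℝ) = _ := funext e
  rw [e']
  refine continuous_finsetSum _ fun j _ => continuous_iff_continuousAt.2 fun x =>
    oY.tendsto_integral_mulForm (hη j) (fun x => hc x j) (hc x j) fun c T hT hTc => ?_
  exact (co j).uniformContinuous.comp_tendstoUniformlyOn (x.tendstoUniformlyOn_localRep hT hTc)

end Tube


/-! ### The Lie-Poisson brackets of the fluxes -/

section Components

variable (ħ : ℝ) (𝔤 : Type*) [NormedLieRing 𝔤] [NormedLieAlg 𝔤] [FiniteDimensional ℝ 𝔤]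

/-- The electric component, as an element of `𝔤`. -/
def elecL : FluxAlg ħ 𝔤 →L[ℝ] 𝔤 := LinearMap.toContinuousLinearMap
  { toFun := fun x => x.right.out
    map_add' := fun _ _ => rfl
    map_smul' := fun _ _ => rfl }

/-- The magnetic component, as an element of `𝔤`. -/
def magnL : FluxAlg ħ 𝔤 →L[ℝ] 𝔤 := LinearMap.toContinuousLinearMap
  { toFun := fun x => x.left.out
    map_add' := fun _ _ => rfl
    map_smul' := fun _ _ => rfl }

variable {ħ 𝔤}

theorem elecL_lie (x y : FluxAlg ħ 𝔤) : elecL ħ 𝔤 ⁅x, y⁆ = ħ • ⁅elecL ħ 𝔤 x, elecL ħ 𝔤 y⁆ := rfl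

/-- The magnetic ideal is abelian, so only the two mixed terms contribute. The difference is written
as a sum with a factor `-1` to suit the additivity of surface integrals. -/
theorem magnL_lie (x y : FluxAlg ħ 𝔤) : magnL ħ 𝔤 ⁅x, y⁆ =
    ħ • (⁅elecL ħ 𝔤 x, magnL ħ 𝔤 y⁆ + (-1 : ℝ) • ⁅elecL ħ 𝔤 y, magnL ħ 𝔤 x⁆) := by
  change (0 : 𝔤) + ħ • ⁅elecL ħ 𝔤 x, magnL ħ 𝔤 y⁆ - ħ • ⁅elecL ħ 𝔤 y, magnL ħ 𝔤 x⁆ = _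
  module

end Components

namespace Sector

variable {ι X : Type*} [TopologicalSpace X] [ChartedSpace (𝔼 3) X] [IsManifold (𝓡 3) ∞ X]
  {d : ℕ} {G : Type*} [TopologicalSpace G] [ChartedSpace (𝔼 d) G] [Group G]
  [LieGroup (𝓡 d) ∞ G] {𝔤 : Type*} [NormedLieRing 𝔤] [NormedLieAlg 𝔤] [FiniteDimensional ℝ 𝔤]
  {P : Sector ι X d G 𝔤} {S : Set X} [T2Space X] [SigmaCompactSpace X] {B : LieMetric 𝔤}

/-- The Poisson bracket of linear combinations of regularized fluxes. -/
theorem bracket_regFlux_add (hB : ∀ (g : G) (x y : 𝔤), B.form (P.Ad g x) (P.Ad g y) = B.form x y)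
    (o : MOrientation 3 X) (hS : Regular 3 S) {α β α' β' : ι → X → 𝔤} (hα : P.IsWeight S α)
    (hβ : P.IsWeight S β) (hα' : P.IsWeight S α') (hβ' : P.IsWeight S β') (c : ℝ)
    (p : P.Phase S) :
    P.HasPoissonBracketAt B o (fun q => c * (P.regFluxE B o S α q + P.regFluxB B o S β q))
      (fun q => c * (P.regFluxE B o S α' q + P.regFluxB B o S β' q)) p
      (c * (c * (P.regFluxE B o S (fun i x => ⁅α i x, α' i x⁆) p +
        (P.regFluxB B o S (fun i x => ⁅α i x, β' i x⁆) p -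
          P.regFluxB B o S (fun i x => ⁅α' i x, β i x⁆) p)))) := by
  refine ⟨_, _, _, _,
    ((hasDifferentialAt_regFluxE hB o hS hα p).add hB
      (hasDifferentialAt_regFluxB hB o hS hβ p)).const_mul c,
    ((hasDifferentialAt_regFluxE hB o hS hα' p).add hB
      (hasDifferentialAt_regFluxB hB o hS hβ' p)).const_mul c, ?_⟩
  rw [← diffE_weightForm hB o hS hα hα' p, ← diffB_weightForm hB o hS hα hβ' p,
    ← diffB_weightForm hB o hS hα' hβ p, add_zero, add_zero, map_smul, map_smul]
  simp only [LinearMap.smul_apply, LinearMap.add_apply, smul_eq_mul]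
  ring

end Sector

namespace Tube

variable {Y X : Type*} [TopologicalSpace Y] [ChartedSpace (𝔼 2) Y] [IsManifold (𝓡 2) ∞ Y]
  [TopologicalSpace X] [ChartedSpace (𝔼 3) X] [IsManifold (𝓡 3) ∞ X]
  {oY : MOrientation 2 Y} {oX : MOrientation 3 X} (κ : Tube oY oX)
  {ι : Type*} {d : ℕ} {G : Type*} [TopologicalSpace G] [ChartedSpace (𝔼 d) G] [Group G]
  [LieGroup (𝓡 d) ∞ G] {𝔤 : Type*} [NormedLieRing 𝔤] [NormedLieAlg 𝔤] [FiniteDimensional ℝ 𝔤]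
  {P : Sector ι X d G 𝔤} [T2Space X] [SigmaCompactSpace X] [T2Space Y] [CompactSpace Y]
  {B : LieMetric 𝔤} (hB : ∀ (g : G) (x y : 𝔤), B.form (P.Ad g x) (P.Ad g y) = B.form x y)
  {τ : ι → Y → G} (hτ : κ.IsTrivialization P τ) (p : P.Phase κ.exterior) {ħ : ℝ}

include hτ in
theorem isSection_elec (x : SmoothMaps Y (FluxAlg ħ 𝔤)) : κ.IsSection P (P.elec τ x) :=
  κ.isSection_trivSection hτ (v := fun s => elecL ħ 𝔤 (x.1 s)) ((elecL ħ 𝔤).contDiff.contMDiff.comp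
    (x.2 : ContMDiff (𝓡 2) 𝓘(ℝ, FluxAlg ħ 𝔤) ∞ x.1))

include hτ in
theorem isSection_magn (x : SmoothMaps Y (FluxAlg ħ 𝔤)) : κ.IsSection P (P.magn τ x) :=
  κ.isSection_trivSection hτ (v := fun s => magnL ħ 𝔤 (x.1 s)) ((magnL ħ 𝔤).contDiff.contMDiff.comp
    (x.2 : ContMDiff (𝓡 2) 𝓘(ℝ, FluxAlg ħ 𝔤) ∞ x.1))

/-- The momentum map of the fluxes. -/
def momentum : SmoothMaps Y (FluxAlg ħ 𝔤) →L[ℝ] ℝ where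
  toLinearMap := ħ • (κ.fluxL hB hτ p.E.2 (elecL ħ 𝔤) +
    κ.fluxL hB hτ (P.cutoff_curv_mem_forms κ.regular_exterior p.isConnection) (magnL ħ 𝔤))
  cont := ((κ.continuous_fluxL hB hτ p.E.2 (elecL ħ 𝔤)).add (κ.continuous_fluxL hB hτ
    (P.cutoff_curv_mem_forms κ.regular_exterior p.isConnection) (magnL ħ 𝔤))).const_smul ħ

theorem momentum_apply (x : SmoothMaps Y (FluxAlg ħ 𝔤)) : κ.momentum hB hτ p x =
    ħ * (κ.fluxE P B (P.elec τ x) p + κ.fluxB P B (P.magn τ x) p) := by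
  unfold fluxB
  rw [← κ.surfaceIntegral_cutoff]
  rfl

theorem Restricts.lie {α β : ι → X → 𝔤} {a b : ι → Y → 𝔤} (ha : κ.Restricts P α a)
    (hb : κ.Restricts P β b) :
    κ.Restricts P (fun i x => ⁅α i x, β i x⁆) (fun i s => ⁅a i s, b i s⁆) := fun i s hs => by
  change ⁅α i _, β i _⁆ = _
  rw [ha i s hs, hb i s hs]

/-- Brackets of smearing functions restrict to brackets of sections, which by `Ad_lie` correspond to
pointwise brackets under the trivialization. Of the two factors `ħ` from bilinearity, one is the
prefactor of `μ` and the other belongs to the bracket of `𝔤_ħ`. The Gauss law is needed only for the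
electric term. -/
theorem bracket_momentum {p : P.Phase κ.exterior} (hp : P.Gauss p)
    {x x' : SmoothMaps Y (FluxAlg ħ 𝔤)} {α β α' β' : ι → X → 𝔤}
    (hα : P.IsWeight κ.exterior α) (hβ : P.IsWeight κ.exterior β)
    (hα' : P.IsWeight κ.exterior α') (hβ' : P.IsWeight κ.exterior β')
    (ha : κ.Restricts P α (P.elec τ x)) (hb : κ.Restricts P β (P.magn τ x))
    (ha' : κ.Restricts P α' (P.elec τ x')) (hb' : κ.Restricts P β' (P.magn τ x')) :
    P.HasPoissonBracketAt B oX
      (fun q => ħ * (P.regFluxE B oX κ.exterior α q + P.regFluxB B oX κ.exterior β q))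
      (fun q => ħ * (P.regFluxE B oX κ.exterior α' q + P.regFluxB B oX κ.exterior β' q))
      p (κ.momentum hB hτ p ⁅x, x'⁆) := by
  have h := Sector.bracket_regFlux_add hB oX κ.regular_exterior hα hβ hα' hβ' ħ p
  have hE := κ.regFluxE_eq_fluxE hB (P.isWeight_lie hα hα') (Restricts.lie κ ha ha') hp
  have hB1 := κ.regFluxB_eq_fluxB hB (P.isWeight_lie hα hβ') (Restricts.lie κ ha hb') p
  have hB2 := κ.regFluxB_eq_fluxB hB (P.isWeight_lie hα' hβ) (Restricts.lie κ ha' hb) p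
  rw [hE, hB1, hB2] at h
  have hF := P.cutoff_curv_mem_forms κ.regular_exterior p.isConnection
  have hlie : ∀ (u v : FluxAlg ħ 𝔤 →L[ℝ] 𝔤) (y z : SmoothMaps Y (FluxAlg ħ 𝔤)),
      κ.IsSection P (trivSection P τ fun s => ⁅u (y.1 s), v (z.1 s)⁆) := fun u v y z =>
    κ.isSection_trivSection hτ ((contMDiff_const (c := lieL 𝔤)).clm_apply
      (u.contDiff.contMDiff.comp (y.2 : ContMDiff (𝓡 2) 𝓘(ℝ, FluxAlg ħ 𝔤) ∞ y.1)) |>.clm_apply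
      (v.contDiff.contMDiff.comp (z.2 : ContMDiff (𝓡 2) 𝓘(ℝ, FluxAlg ħ 𝔤) ∞ z.1)))
  have e : ∀ (u v : FluxAlg ħ 𝔤 →L[ℝ] 𝔤) (y z : SmoothMaps Y (FluxAlg ħ 𝔤)),
      (fun i s => ⁅trivSection P τ (fun s => u (y.1 s)) i s,
        trivSection P τ (fun s => v (z.1 s)) i s⁆) =
      trivSection P τ fun s => ⁅u (y.1 s), v (z.1 s)⁆ := fun u v y z => by
    funext i s
    exact (P.Ad_lie _ _ _).symm
  have eE : P.elec τ ⁅x, x'⁆ = ħ • fun i s => ⁅P.elec τ x i s, P.elec τ x' i s⁆ := by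
    refine Eq.trans ?_ (congrArg (ħ • ·) (e (elecL ħ 𝔤) (elecL ħ 𝔤) x x').symm)
    funext i s
    exact (congrArg (P.Ad (τ i s)) (elecL_lie (x.1 s) (x'.1 s))).trans (map_smul _ _ _)
  have eB : P.magn τ ⁅x, x'⁆ = ħ • ((fun i s => ⁅P.elec τ x i s, P.magn τ x' i s⁆) +
      (-1 : ℝ) • fun i s => ⁅P.elec τ x' i s, P.magn τ x i s⁆) := by
    refine Eq.trans ?_ (congrArg (ħ • ·) (congrArg₂ (· + ·)
      (e (elecL ħ 𝔤) (magnL ħ 𝔤) x x').symm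
      (congrArg ((-1 : ℝ) • ·) (e (elecL ħ 𝔤) (magnL ħ 𝔤) x' x).symm)))
    funext i s
    refine (congrArg (P.Ad (τ i s)) (magnL_lie (x.1 s) (x'.1 s))).trans ?_
    rw [map_smul, map_add, map_smul]
    rfl
  have s1 : κ.IsSection P fun i s => ⁅P.elec τ x i s, P.magn τ x' i s⁆ := by
    have := hlie (elecL ħ 𝔤) (magnL ħ 𝔤) x x'
    rwa [← e] at this
  have s2 : κ.IsSection P ((-1 : ℝ) • fun i s => ⁅P.elec τ x' i s, P.magn τ x i s⁆) := by
    -- The sign is absorbed into the linear map, so that `hlie` covers this section too.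
    have := hlie ((-1 : ℝ) • elecL ħ 𝔤) (magnL ħ 𝔤) x' x
    rw [← e] at this
    convert this using 1
    funext i s
    change (-1 : ℝ) • ⁅P.Ad _ (elecL ħ 𝔤 (x'.1 s)), P.magn τ x i s⁆ =
      ⁅P.Ad _ ((-1 : ℝ) • elecL ħ 𝔤 (x'.1 s)), P.magn τ x i s⁆
    rw [map_smul, smul_lie]
  rw [momentum_apply, eE, eB]
  unfold fluxE fluxB at *
  rw [κ.surfaceIntegral_smul, κ.surfaceIntegral_smul, ← κ.surfaceIntegral_cutoff _ (P.curv κ.exterior p.A),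
    κ.surfaceIntegral_add hB s1 s2 hF, κ.surfaceIntegral_smul, κ.surfaceIntegral_cutoff,
    κ.surfaceIntegral_cutoff]
  convert h using 1
  ring

end Tube

end YMFlux

open YMFlux in
theorem theorem1
    -- the metric Lie algebra and the structure group
    {𝔤 : Type*} [NormedLieRing 𝔤] [NormedLieAlg 𝔤] [FiniteDimensional ℝ 𝔤] (B : LieMetric 𝔤)
    {d : ℕ} {G : Type*} [TopologicalSpace G] [ChartedSpace (𝔼 d) G] [Group G] [LieGroup (𝓡 d) ∞ G]
    -- the oriented Cauchy surface
    {X : Type*} [TopologicalSpace X] [T2Space X] [SigmaCompactSpace X] [ChartedSpace (𝔼 3) X]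
    [IsManifold (𝓡 3) ∞ X] (oX : MOrientation 3 X)
    -- the topological sector
    {ι : Type*} (P : Sector ι X d G 𝔤)
    (hAd : ∀ (g : G) (x y : 𝔤), B.form (P.Ad g x) (P.Ad g y) = B.form x y)
    -- the closed oriented surface and its tubular neighbourhood
    {Y : Type*} [TopologicalSpace Y] [T2Space Y] [CompactSpace Y] [ChartedSpace (𝔼 2) Y]
    [IsManifold (𝓡 2) ∞ Y] (oY : MOrientation 2 Y) (κ : Tube oY oX) :
    -- the fields on `X` restrict to fields on the exterior component
    (∀ q : P.Phase univ, ∃ p : P.Phase κ.exterior,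
      (∀ i, ∀ x ∈ P.U i ∩ κ.exterior, p.A i x = q.A i x ∧ p.E.1 i x = q.E.1 i x ∧
        P.curv κ.exterior p.A i x = P.curv univ q.A i x) ∧ (P.Gauss q → P.Gauss p)) ∧
    -- the Poisson brackets of the regularized fluxes
    (∀ α β : ι → X → 𝔤, P.IsWeight κ.exterior α → P.IsWeight κ.exterior β →
      P.IsWeight κ.exterior (fun i x => ⁅α i x, β i x⁆) ∧
      ∀ p : P.Phase κ.exterior,
        P.HasPoissonBracketAt B oX (P.regFluxE B oX κ.exterior α) (P.regFluxE B oX κ.exterior β) p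
          (P.regFluxE B oX κ.exterior (fun i x => ⁅α i x, β i x⁆) p) ∧
        P.HasPoissonBracketAt B oX (P.regFluxE B oX κ.exterior α) (P.regFluxB B oX κ.exterior β) p
          (P.regFluxB B oX κ.exterior (fun i x => ⁅α i x, β i x⁆) p) ∧
        P.HasPoissonBracketAt B oX (P.regFluxB B oX κ.exterior α) (P.regFluxB B oX κ.exterior β) p
          0) ∧
    -- the regularized fluxes are the fluxes through the surface, the electric ones on shell
    (∀ (α : ι → X → 𝔤) (a : ι → Y → 𝔤), P.IsWeight κ.exterior α → κ.Restricts P α a →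
      ∀ p : P.Phase κ.exterior,
        P.regFluxB B oX κ.exterior α p = κ.fluxB P B a p ∧
        (P.Gauss p → P.regFluxE B oX κ.exterior α p = κ.fluxE P B a p)) ∧
    -- every smearing function on the surface extends
    (∀ a : ι → Y → 𝔤, κ.IsSection P a →
      ∃ α : ι → X → 𝔤, P.IsWeight κ.exterior α ∧ κ.Restricts P α a) ∧
    -- the Lie-Poisson brackets of `C^∞(Y, 𝔤_ħ ⋉ 𝔤_0)`
    ∀ ħ : ℝ, 0 < ħ →
      (∀ τ : ι → Y → G, κ.IsTrivialization P τ →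
        (∀ x : SmoothMaps Y (FluxAlg ħ 𝔤),
          κ.IsSection P (P.elec τ x) ∧ κ.IsSection P (P.magn τ x)) ∧
        ∀ p : P.Phase κ.exterior, P.Gauss p →
          ∃ μ : SmoothMaps Y (FluxAlg ħ 𝔤) →L[ℝ] ℝ,
            (∀ x, μ x = ħ * (κ.fluxE P B (P.elec τ x) p + κ.fluxB P B (P.magn τ x) p)) ∧
            ∀ (x x' : SmoothMaps Y (FluxAlg ħ 𝔤)) (α β α' β' : ι → X → 𝔤),
              P.IsWeight κ.exterior α → P.IsWeight κ.exterior β →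
              P.IsWeight κ.exterior α' → P.IsWeight κ.exterior β' →
              κ.Restricts P α (P.elec τ x) → κ.Restricts P β (P.magn τ x) →
              κ.Restricts P α' (P.elec τ x') → κ.Restricts P β' (P.magn τ x') →
              P.HasPoissonBracketAt B oX
                (fun q => ħ * (P.regFluxE B oX κ.exterior α q + P.regFluxB B oX κ.exterior β q))
                (fun q => ħ * (P.regFluxE B oX κ.exterior α' q + P.regFluxB B oX κ.exterior β' q))
                p (μ ⁅x, x'⁆)) ∧
      -- `C^∞(Y, 𝔤_ħ ⋉ 𝔤_0) ≃ C^∞(Y, 𝔤_ħ) ⋉ C^∞(Y, 𝔤_0)`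
      ∃ Ψ : SmoothMaps Y (FluxAlg ħ 𝔤) ≃ₗ⁅ℝ⁆ SemidirectMaps Y ħ 𝔤,
        Continuous Ψ ∧ Continuous Ψ.symm ∧
        ∀ (x : SmoothMaps Y (FluxAlg ħ 𝔤)) (s : Y),
          (Ψ x).right.1 s = (x.1 s).right ∧ (Ψ x).left.1 s = (x.1 s).left := by
  have hS := κ.regular_exterior
  refine ⟨fun q => ⟨q.restrict κ.exterior, fun i x hx => ⟨P.cutoff_apply q.A hx,
      P.cutoff_apply q.E.1 hx, q.curv_restrict hS hx⟩, Sector.Phase.gauss_restrict hS⟩,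
    fun α β hα hβ => ⟨P.isWeight_lie hα hβ, fun p =>
      ⟨Sector.bracket_regFluxE_regFluxE hAd oX hS hα hβ p,
        Sector.bracket_regFluxE_regFluxB hAd oX hS hα hβ p,
        Sector.bracket_regFluxB_regFluxB hAd oX hS hα hβ p⟩⟩,
    fun α a hα ha p => ⟨κ.regFluxB_eq_fluxB hAd hα ha p, κ.regFluxE_eq_fluxE hAd hα ha⟩,
    fun a ha => κ.exists_isWeight_restricts ha, fun ħ _ => ⟨fun τ hτ => ?_, ?_⟩⟩
  · exact ⟨fun x => ⟨κ.isSection_elec hτ x, κ.isSection_magn hτ x⟩, fun p hp =>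
      ⟨κ.momentum hAd hτ p, κ.momentum_apply hAd hτ p, fun x x' α β α' β' hα hβ hα' hβ' ha hb ha' hb' =>
        κ.bracket_momentum hAd hτ hp hα hβ hα' hβ' ha hb ha' hb'⟩⟩
  · exact ⟨componentsEquiv ħ 𝔤 Y, continuous_componentsEquiv ħ 𝔤 Y,
      continuous_componentsEquiv_symm ħ 𝔤 Y, fun _ _ => ⟨rfl, rfl⟩⟩
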